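/- Conventions. A triangulated $3$-sphere is a finite simplicial complex whose underlying space is homeomorphic to the unit sphere of $\mathbb{R}^4$; only nonempty faces are considered. The dual graph of $S$ has the tetrahedra of $S$ as nodes, two of them being adjacent if they share a triangle. A face of a complex is free if it is properly contained in exactly one other face; an elementary collapse deletes a free face together with the only other face containing it. A complex is collapsible if some finite sequence of elementary collapses reduces it to a single vertex, and extensively collapsible if every complex obtained from it by a finite (possibly empty) sequence of elementary collapses is collapsible. For a spanning tree $T$ of the dual graph of $S$, let $K^T$ be the subcomplex of $S$ consisting of all triangles not crossed by $T$ (that is, not the common triangle of two tetrahedra joined by an edge of $T$) and of all faces of these triangles. For a tetrahedron $\Delta$ of $S$, let $S-\Delta$ be the subcomplex of all faces of $S$ other than $\Delta$. Cell complexes are glued from the tetrahedra of $S$, regarded as pairwise disjoint simplices, by identifying faces. Such a complex is a pseudomanifold if it is regular (distinct faces of one simplex are never identified with one another) and each of its triangles belongs to at most two tetrahedra; a triangle is a boundary triangle if it belongs to exactly one tetrahedron. An LC gluing identifies, through a bijection of their vertices, two distinct boundary triangles whose intersection is $1$-dimensional, and results in a pseudomanifold. The tree of tetrahedra $T_N$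 dual to $T$ is obtained from the disjoint tetrahedra of $S$ by gluing the common triangle of any two tetrahedra that are adjacent in $T$, and nothing else. $S$ is extensively LC if, for every spanning tree $T$ of the dual graph of $S$, a finite (possibly empty) sequence of LC gluings leads from $T_N$ to $S$, i.e. to the complex in which two faces of the disjoint tetrahedra are identified exactly when they are the same face of $S$. Theorem. Let $S$ be a triangulated $3$-sphere. The following are equivalent: (i) $S$ is extensively LC; (ii) for every spanning tree $T$ of the dual graph of $S$, the complex $K^T$ is collapsible; (iii) for every tetrahedron $\Delta$ of $S$, the complex $S-\Delta$ is extensively collapsible; (iv) for some tetrahedron $\Delta$ of $S$, the complex $S-\Delta$ is extensively collapsible. -/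

import Mathlib

namespace PreAbstractSimplicialComplex

variable {V : Type*}

/-! ### Collapses -/

/-- `σ` is a free face of `K`, and `τ` is the only face of `K` that properly contains it. -/
def IsFreePair (K : PreAbstractSimplicialComplex V) (σ τ : Finset V) : Prop :=
  σ ∈ K.faces ∧ τ ∈ K.faces ∧ σ ⊂ τ ∧ ∀ ρ ∈ K.faces, σ ⊂ ρ → ρ = τ

/-- `L` arises from `K` by an elementary collapse: a free face is deleted, together with the only
other face that contains it. -/
def ElementaryCollapse (K L : PreAbstractSimplicialComplex V) : Prop :=
  ∃ σ τ, K.IsFreePair σ τ ∧ L.faces = K.faces \ {σ, τ}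

/-- `L` arises from `K` by a finite (possibly empty) sequence of elementary collapses. -/
def CollapsesTo (K L : PreAbstractSimplicialComplex V) : Prop :=
  Relation.ReflTransGen ElementaryCollapse K L

/-- `K` collapses to a single vertex. -/
def Collapsible (K : PreAbstractSimplicialComplex V) : Prop :=
  ∃ (L : PreAbstractSimplicialComplex V) (v : V), K.CollapsesTo L ∧ L.faces = {{v}}

/-- Any sequence of elementary collapses reduces `K` to a complex that is itself collapsible. -/
def ExtensivelyCollapsible (K : PreAbstractSimplicialComplex V) : Prop :=
  ∀ L : PreAbstractSimplicialComplex V, K.CollapsesTo L → L.Collapsible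

/-! ### Simplices, the dual graph, and the complex `K^T` -/

/-- The `k`-dimensional faces of `K`. -/
abbrev Simplices (K : PreAbstractSimplicialComplex V) (k : ℕ) : Type _ :=
  {σ : Finset V // σ ∈ K.faces ∧ σ.card = k + 1}

/-- The complex obtained from `K` by deleting the face `Δ` and the faces containing it. If `Δ` is
a maximal face, then only `Δ` itself is deleted. -/
def deleteFace (K : PreAbstractSimplicialComplex V) (Δ : Finset V) :
    PreAbstractSimplicialComplex V where
  faces := {σ | σ ∈ K.faces ∧ ¬ Δ ⊆ σ}
  isRelLowerSet_faces := by
    intro σ hσ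
    refine ⟨(K.isRelLowerSet_faces hσ.1).1, fun τ hτ hne => ?_⟩
    exact ⟨(K.isRelLowerSet_faces hσ.1).2 hτ hne, fun h => hσ.2 (h.trans hτ)⟩

/-- The dual graph of a `d`-dimensional complex `K`: its nodes are the `d`-simplices of `K`, and
two of them are adjacent if they share a `(d-1)`-face. -/
def dualGraph (K : PreAbstractSimplicialComplex V) (d : ℕ) : SimpleGraph (K.Simplices d) where
  Adj F G := F ≠ G ∧ ∃ ρ : Finset V, ρ.card = d ∧ ρ ⊆ F.1 ∧ ρ ⊆ G.1
  symm := ⟨fun _ _ h => ⟨h.1.symm, h.2.imp fun _ hρ => ⟨hρ.1, hρ.2.2, hρ.2.1⟩⟩⟩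
  loopless := ⟨fun _ h => h.1 rfl⟩

/-- `T` is a spanning tree of the dual graph of `K`. -/
def IsDualSpanningTree (K : PreAbstractSimplicialComplex V) (d : ℕ)
    (T : SimpleGraph (K.Simplices d)) : Prop :=
  T ≤ K.dualGraph d ∧ T.IsTree

/-- The subcomplex `K^T` determined by the `(d-1)`-faces of `K` that `T` does not cross: it
consists of these `(d-1)`-faces and of all their faces. -/
def cutComplex (K : PreAbstractSimplicialComplex V) (d : ℕ) (T : SimpleGraph (K.Simplices d)) :
    PreAbstractSimplicialComplex V where
  faces := {σ | σ.Nonempty ∧ ∃ ρ ∈ K.faces, ρ.card = d ∧ σ ⊆ ρ ∧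
    ¬ ∃ F G : K.Simplices d, T.Adj F G ∧ ρ ⊆ F.1 ∧ ρ ⊆ G.1}
  isRelLowerSet_faces := by
    rintro σ ⟨hσ, ρ, hρ, hd, hsub, hT⟩
    exact ⟨hσ, fun τ hτ hne => ⟨hne, ρ, hρ, hd, le_trans hτ hsub, hT⟩⟩

/-! ### Cell complexes glued from the `d`-simplices of `K`

Take the `d`-simplices of `K` apart, as pairwise disjoint simplices. The cells of this disjoint
union are the pairs `(F, σ)` with `F` a `d`-simplex of `K` and `σ` a nonempty face of `F`. A cell
complex obtained from the disjoint simplices by identifying faces is given by the equivalence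
relation `r` that tells which cells have been identified; the cells of the complex are the classes
of `r`. -/

/-- A cell of the disjoint union of the `d`-simplices of `K`. -/
@[ext]
structure Cell (K : PreAbstractSimplicialComplex V) (d : ℕ) where
  /-- the `d`-simplex to which the cell belongs -/
  simplex : K.Simplices d
  /-- the face of this simplex -/
  face : Finset V
  nonempty : face.Nonempty
  subset : face ⊆ simplex.1

variable {K : PreAbstractSimplicialComplex V} {d : ℕ}

/-- `c` is a face of `a` in the disjoint union of the `d`-simplices. -/
def Cell.IsFaceOf (c a : K.Cell d) : Prop :=
  c.simplex = a.simplex ∧ c.face ⊆ a.face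

/-- The complex glued by `r` is a pseudomanifold: it is regular (distinct faces of one simplex are
not identified with one another), and each `(d-1)`-cell belongs to at most two `d`-cells. -/
def IsPseudomanifold (r : Setoid (K.Cell d)) : Prop :=
  (∀ c c' : K.Cell d, r c c' → c.simplex = c'.simplex → c = c') ∧
  (∀ c₁ c₂ c₃ : K.Cell d, c₁.face.card = d → c₂.face.card = d → c₃.face.card = d →
    r c₁ c₂ → r c₂ c₃ →
    c₁.simplex = c₂.simplex ∨ c₂.simplex = c₃.simplex ∨ c₁.simplex = c₃.simplex)

/-- `a` is a boundary facet of the complex glued by `r`: a `(d-1)`-cell that belongs to exactly one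
`d`-cell. -/
def IsBoundaryFacet (r : Setoid (K.Cell d)) (a : K.Cell d) : Prop :=
  a.face.card = d ∧ ∀ c : K.Cell d, r a c → c.simplex = a.simplex

/-- The identifications of cells that take place when the cell `a` is identified with the cell `b`
through the bijection `φ` of their vertices: each face `c` of `a` is identified with the face `c'`
of `b` that is the image of `c` under `φ`. -/
def Identify (a b : K.Cell d) (φ : {v // v ∈ a.face} ≃ {v // v ∈ b.face}) (c c' : K.Cell d) : Prop :=
  c.IsFaceOf a ∧ c'.IsFaceOf b ∧ ∀ v : {v // v ∈ a.face}, v.1 ∈ c.face ↔ (φ v).1 ∈ c'.face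

/-- The pseudomanifold glued by `r'` is obtained from the complex glued by `r` by an LC gluing: two
distinct boundary facets `a`, `b` whose intersection is `(d-2)`-dimensional (that is, some
`(d-2)`-face of `a` is also a face of `b`) are identified. -/
def LCGluing (r r' : Setoid (K.Cell d)) : Prop :=
  ∃ a b : K.Cell d, IsBoundaryFacet r a ∧ IsBoundaryFacet r b ∧ ¬ r a b ∧
    (∃ e e' : K.Cell d, e.IsFaceOf a ∧ e'.IsFaceOf b ∧ e.face.card + 1 = d ∧ r e e') ∧
    (∃ φ : {v // v ∈ a.face} ≃ {v // v ∈ b.face},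
      r' = r ⊔ Relation.EqvGen.setoid (Identify a b φ)) ∧
    IsPseudomanifold r'

/-- The tree of `d`-simplices dual to `T`: the disjoint `d`-simplices of `K` are glued along the
common `(d-1)`-faces of the pairs of simplices that are adjacent in `T`, and nowhere else. -/
def treeOfSimplices (T : SimpleGraph (K.Simplices d)) : Setoid (K.Cell d) :=
  Relation.EqvGen.setoid fun c c' => T.Adj c.simplex c'.simplex ∧ c.face = c'.face

/-- The gluing that gives back (a copy of) the pure complex `K`: two cells are identified if they
are the same face of `K`. -/
def fullGluing (K : PreAbstractSimplicialComplex V) (d : ℕ) : Setoid (K.Cell d) :=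
  Setoid.ker Cell.face

/-- `K` can be obtained via LC gluings from the tree of `d`-simplices dual to `T`. -/
def LCAlong (K : PreAbstractSimplicialComplex V) (d : ℕ) (T : SimpleGraph (K.Simplices d)) :
    Prop :=
  Relation.ReflTransGen LCGluing (treeOfSimplices T) (K.fullGluing d)

/-- `K` is extensively LC: it can be obtained via LC gluings from the tree of `d`-simplices dual to
any spanning tree of its dual graph. -/
def ExtensivelyLC (K : PreAbstractSimplicialComplex V) (d : ℕ) : Prop :=
  ∀ T : SimpleGraph (K.Simplices d), K.IsDualSpanningTree d T → K.LCAlong d T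

end PreAbstractSimplicialComplex

/-- A triangulated `d`-sphere: a finite simplicial complex whose underlying space is homeomorphic to
the unit sphere of `ℝ^(d+1)`. -/
def Geometry.SimplicialComplex.IsTriangulatedSphere {E : Type*} [NormedAddCommGroup E]
    [NormedSpace ℝ E] (S : Geometry.SimplicialComplex ℝ E) (d : ℕ) : Prop :=
  S.faces.Finite ∧ Nonempty (S.space ≃ₜ Metric.sphere (0 : EuclideanSpace ℝ (Fin (d + 1))) 1)

/-! The argument is combinatorial once a few facts about triangulated spheres are known.
`IsSphereLike` collects them: purity, exactly two tetrahedra at each triangle, connectedness of the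
tetrahedra at a vertex or an edge through triangles at that face, connectedness, and vanishing of
the first integral cohomology.

In a sequence of LC gluings that ends at $S$, each intermediate complex is `triangleGluing K N`,
where the triangles of $N$ are those still to be glued; at the start $N = K^T$. The tetrahedra
around an edge $e$ form a single cycle, so the two copies of $e$ on the sides of an unglued triangle
$t$ coincide exactly when all other triangles at $e$ have been glued, that is, when $e$ is a free
face of $t$ in $N$ (`mem_of_reachable`, `reachable_of_forall_mem`). Thus an LC gluing is the
collapse of a triangle of $N$, and $S$ is reached from $T_N$ exactly when $K^T$ collapses to a
graph. That graph is a tree: $S-\Delta$ collapses to $K^T$ (`collapsesTo_cutComplex`), and collapses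
can neither join components nor kill first cohomology (`collapsible_of_collapsesTo_graph`). This
gives (i) ⇔ (ii), and (iv) ⇒ (ii) is immediate.

For (ii) ⇒ (iii), let $S-\Delta$ collapse to $L$. The tetrahedra left in $L$ can be collapsed away,
leaving a complex $M$ of dimension at most two. All tetrahedra are then connected through removed
triangles, so some spanning tree $T$ crosses only removed triangles, and every triangle of $M$ lies
in $K^T$. Replaying the collapse of $K^T$ on $M$ (`CollapsesTo.exists_graph`) leads to a graph,
which is again a tree.

The topological facts are proved without homology groups. The no-retraction theorem yields a test
for a point $c$ of a compact set $C$ in three-space: if $c$ is interior, the translation $w \mapsto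
w-c$ cannot be extended over $C$ without zeros from a set whose complement in $C$ is an open
neighbourhood of $c$; if $c$ is not interior, any nonvanishing map on $C \setminus \{c\}$ can be
modified near $c$ so as to extend. The test is applied at barycenters of faces, in charts of the
sphere minus a point. Cohomology vanishes because circle-valued maps lift over such a chart. -/

section

open Set Metric MeasureTheory Filter Topology

/-! ### The no-retraction theorem in dimension three, by a volume argument -/

/-- Three-dimensional Euclidean space. -/
abbrev Euc3 : Type := EuclideanSpace ℝ (Fin 3)

/-- The determinant of `1 + t A` in dimension three is a polynomial of degree three in `t`, whose
coefficients depend continuously on `A`. -/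
theorem Euc3.exists_det_one_add_smul :
    ∃ a b : (Euc3 →L[ℝ] Euc3) → ℝ, Continuous a ∧ Continuous b ∧ ∀ A (t : ℝ),
      (1 + t • A).det = 1 + t * a A + t ^ 2 * b A + t ^ 3 * A.det := by
  let e (A : Euc3 →L[ℝ] Euc3) (i j : Fin 3) : ℝ := A (EuclideanSpace.single j 1) i
  have he : ∀ i j, Continuous fun A => e A i j := fun i j => by fun_prop
  have hdet : ∀ A : Euc3 →L[ℝ] Euc3, A.det = (Matrix.of (e A)).det := by
    intro A
    rw [ContinuousLinearMap.det, ← LinearMap.det_toMatrix (PiLp.basisFun 2 ℝ (Fin 3))]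
    congr 1
  refine ⟨fun A => e A 0 0 + e A 1 1 + e A 2 2,
    fun A => e A 0 0 * e A 1 1 - e A 0 1 * e A 1 0 + (e A 0 0 * e A 2 2 - e A 0 2 * e A 2 0) +
      (e A 1 1 * e A 2 2 - e A 1 2 * e A 2 1), by fun_prop, by fun_prop, fun A t => ?_⟩
  have hadd : e (1 + t • A) = fun i j => (if i = j then 1 else 0) + t * e A i j := by
    ext i j
    simp [e, PiLp.single_apply]
  rw [hdet, hdet, hadd, Matrix.det_fin_three, Matrix.det_fin_three]
  simp only [Matrix.of_apply]
  simp
  ring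

/-- The perturbation `t • v` is a strict contraction, which gives injectivity directly; a preimage
of `y` is the Banach fixed point of `x ↦ y - t • v x`. -/
theorem LipschitzWith.bijective_add_smul {F : Type*} [NormedAddCommGroup F] [NormedSpace ℝ F]
    [CompleteSpace F] {v : F → F} {K : NNReal} (hv : LipschitzWith K v) {t : ℝ}
    (ht : 0 ≤ t) (htK : t * K < 1) : Function.Bijective fun x => x + t • v x := by
  have hlip : ∀ x y, ‖t • v x - t • v y‖ ≤ t * K * ‖x - y‖ := fun x y => by
    rw [← smul_sub, norm_smul, Real.norm_of_nonneg ht, mul_assoc]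
    exact mul_le_mul_of_nonneg_left (by simpa [dist_eq_norm] using hv.dist_le_mul x y) ht
  constructor
  · intro x y hxy
    have h1 : x - y = -(t • v x - t • v y) := by
      have : x + t • v x = y + t • v y := hxy
      rw [neg_sub, sub_eq_sub_iff_add_eq_add, this, add_comm]
    have h2 := hlip x y
    rw [← norm_neg (t • v x - _), ← h1] at h2
    have : ‖x - y‖ = 0 := by
      by_contra hne
      have : 0 < ‖x - y‖ := lt_of_le_of_ne (norm_nonneg _) (Ne.symm hne)
      nlinarith
    exact sub_eq_zero.1 (norm_eq_zero.1 this)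
  · intro y
    have hc : ContractingWith (⟨t * K, by positivity⟩ : NNReal) (fun x => y - t • v x) := by
      refine ⟨by exact_mod_cast htK, LipschitzWith.of_dist_le_mul fun a b => ?_⟩
      rw [dist_eq_norm, dist_eq_norm, sub_sub_sub_cancel_left, ← norm_neg, neg_sub]
      exact hlip a b
    refine ⟨hc.fixedPoint _, ?_⟩
    have := hc.fixedPoint_isFixedPt
    have h : y - t • v (hc.fixedPoint _) = hc.fixedPoint _ := this
    simp only
    nth_rewrite 1 [← h]
    simp

/-- A Lipschitz vector field that vanishes outside the unit ball changes the volume of the ball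
by zero. -/
theorem Euc3.integral_det_one_add_eq {v : Euc3 → Euc3} {v' : Euc3 → Euc3 →L[ℝ] Euc3}
    {K : NNReal} (hv : LipschitzWith K v) (hv0 : ∀ x, 1 ≤ ‖x‖ → v x = 0)
    (hv' : ∀ x ∈ ball (0 : Euc3) 1, HasFDerivAt v (v' x) x)
    (hcont : ContinuousOn v' (ball 0 1)) :
    ∫ x in ball (0 : Euc3) 1, (1 + v' x).det = volume.real (ball (0 : Euc3) 1) := by
  obtain ⟨a, b, ha, hb, hdet⟩ := Euc3.exists_det_one_add_smul
  set B := ball (0 : Euc3) 1 with hB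
  have hfin : volume B < ⊤ := measure_ball_lt_top
  have hK : ∀ x ∈ B, v' x ∈ closedBall (0 : Euc3 →L[ℝ] Euc3) K := fun x hx => by
    simpa using (hv' x hx).le_of_lipschitz hv
  have hbound : ∀ c : (Euc3 →L[ℝ] Euc3) → ℝ, Continuous c → ∃ M, 0 ≤ M ∧ ∀ x ∈ B, |c (v' x)| ≤ M := by
    intro c hc
    obtain ⟨M, hM⟩ := (isCompact_closedBall (0 : Euc3 →L[ℝ] Euc3) K).exists_bound_of_continuousOn
      hc.continuousOn
    exact ⟨max M 0, le_max_right _ _, fun x hx => (hM _ (hK x hx)).trans (le_max_left _ _)⟩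
  have hint : ∀ c : (Euc3 →L[ℝ] Euc3) → ℝ, Continuous c → IntegrableOn (fun x => c (v' x)) B := by
    intro c hc
    obtain ⟨M, -, hM⟩ := hbound c hc
    exact IntegrableOn.of_bound hfin
      ((hc.comp_continuousOn hcont).aestronglyMeasurable measurableSet_ball) M
      ((ae_restrict_iff' measurableSet_ball).2 (Eventually.of_forall hM))
  have hcd : Continuous fun A : Euc3 →L[ℝ] Euc3 => A.det := ContinuousLinearMap.continuous_det
  -- The integral is a cubic polynomial in `t`. It suffices to show that it is constant for small `t
  -- > 0`; its value at `t = 1` is then the volume of the ball.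
  have hexp : ∀ t : ℝ, ∫ x in B, (1 + t • v' x).det = volume.real B + t * (∫ x in B, a (v' x)) +
      t ^ 2 * (∫ x in B, b (v' x)) + t ^ 3 * ∫ x in B, (v' x).det := by
    intro t
    simp_rw [hdet]
    have h1 : IntegrableOn (fun _ : Euc3 => (1 : ℝ)) B := integrableOn_const hfin.ne
    have h2 := (hint a ha).const_mul t
    have h3 := (hint b hb).const_mul (t ^ 2)
    have h4 := (hint _ hcd).const_mul (t ^ 3)
    have e1 := integral_add ((h1.add h2).add h3) h4
    have e2 := integral_add (h1.add h2) h3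
    have e3 := integral_add h1 h2
    simp only [Pi.add_apply, integral_const_mul] at e1 e2 e3
    rw [e1, e2, e3]
    simp
  obtain ⟨Ma, hMa0, hMa⟩ := hbound a ha
  obtain ⟨Mb, hMb0, hMb⟩ := hbound b hb
  obtain ⟨Md, hMd0, hMd⟩ := hbound _ hcd
  -- Small enough that, for `0 < t ≤ δ`, the map `x + t • v x` is bijective and its Jacobian is
  -- nonnegative.
  set δ : ℝ := 1 / (1 + K + Ma + Mb + Md) with hδ
  have hδ0 : 0 < δ := by positivity
  have hδ1 : δ * (1 + K + Ma + Mb + Md) = 1 := by rw [hδ]; field_simp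
  have hvol : ∀ t : ℝ, 0 < t → t ≤ δ → ∫ x in B, (1 + t • v' x).det = volume.real B := by
    intro t ht0 htδ
    have ht1 : t * (1 + K + Ma + Mb + Md) ≤ 1 := by
      exact (mul_le_mul_of_nonneg_right htδ (by positivity)).trans hδ1.le
    have htK : t * K < 1 := by
      nlinarith [mul_nonneg ht0.le hMa0, mul_nonneg ht0.le hMb0,
      mul_nonneg ht0.le hMd0]
    have ht1' : t ≤ 1 := by
      nlinarith [mul_nonneg ht0.le hMa0, mul_nonneg ht0.le hMb0,
      mul_nonneg ht0.le hMd0, mul_nonneg ht0.le K.2]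
    have hpos : ∀ x ∈ B, 0 ≤ (1 + t • v' x).det := by
      intro x hx
      rw [hdet]
      have h1 := neg_le_of_abs_le (hMa x hx)
      have h2 := neg_le_of_abs_le (hMb x hx)
      have h3 := neg_le_of_abs_le (hMd x hx)
      have e1 : -(t * Ma) ≤ t * a (v' x) := by nlinarith
      have e2 : -(t * Mb) ≤ t ^ 2 * b (v' x) := by
        have : t ^ 2 ≤ t := by nlinarith
        nlinarith [mul_nonneg (sq_nonneg t) (by linarith : 0 ≤ b (v' x) + Mb)]
      have e3 : -(t * Md) ≤ t ^ 3 * (v' x).det := by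
        have : t ^ 3 ≤ t := by nlinarith [mul_nonneg ht0.le ht0.le]
        nlinarith [mul_nonneg (pow_nonneg ht0.le 3) (by linarith : 0 ≤ (v' x).det + Md)]
      nlinarith [mul_nonneg ht0.le K.2]
    have hbij := hv.bijective_add_smul ht0.le htK
    have hfix : ∀ x, x ∉ B → x + t • v x = x := fun x hx => by
      rw [hv0 x (by simpa [hB] using hx)]; simp
    -- A bijection that fixes every point outside the ball permutes the ball; the change of
    -- variables formula then computes its volume.
    have himg : (fun x => x + t • v x) '' B = B := by
      ext y
      constructor
      · rintro ⟨x, hx, rfl⟩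
        by_contra hy
        have e := hbij.1 (hfix _ hy)
        exact hy (by rw [e]; exact hx)
      · intro hy
        obtain ⟨x, hx⟩ := hbij.2 y
        refine ⟨x, ?_, hx⟩
        by_contra hxB
        have hx' : x + t • v x = y := hx
        rw [hfix x hxB] at hx'
        exact hxB (hx' ▸ hy)
    have hder : ∀ x ∈ B, HasFDerivWithinAt (fun x => x + t • v x) (1 + t • v' x) B x :=
      fun x hx => ((hasFDerivAt_id x).add ((hv' x hx).const_smul t)).hasFDerivWithinAt
    have key := lintegral_abs_det_fderiv_eq_addHaar_image volume measurableSet_ball hder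
      hbij.1.injOn
    rw [himg] at key
    rw [integral_eq_lintegral_of_nonneg_ae
      ((ae_restrict_iff' measurableSet_ball).2 (Eventually.of_forall hpos)), Measure.real, ← key]
    · congr 1
      refine setLIntegral_congr_fun measurableSet_ball fun x hx => ?_
      simp only [abs_of_nonneg (hpos x hx)]
    · exact (hint (fun A => (1 + t • A).det) (hcd.comp (by fun_prop))).aestronglyMeasurable
  -- The cubic minus the volume vanishes at `0`, `δ`, `δ / 2` and `δ / 3`, so all its coefficients
  -- are zero.
  have h1 := hvol δ hδ0 le_rfl
  have h2 := hvol (δ / 2) (by positivity) (by linarith)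
  have h3 := hvol (δ / 3) (by positivity) (by linarith)
  rw [hexp] at h1 h2 h3
  have h := hexp 1
  simp only [one_smul] at h
  rw [h]
  generalize (∫ x in B, a (v' x)) = α at *
  generalize (∫ x in B, b (v' x)) = β at *
  generalize (∫ x in B, (v' x).det) = γ at *
  have hne := hδ0.ne'
  have e1 : α + δ * β + δ ^ 2 * γ = 0 := by
    apply mul_left_cancel₀ hne; linear_combination h1
  have e2 : α + δ / 2 * β + (δ / 2) ^ 2 * γ = 0 := by
    apply mul_left_cancel₀ (by positivity : δ / 2 ≠ 0); linear_combination h2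
  have e3 : α + δ / 3 * β + (δ / 3) ^ 2 * γ = 0 := by
    apply mul_left_cancel₀ (by positivity : δ / 3 ≠ 0); linear_combination h3
  have hγ : γ = 0 := by
    apply mul_left_cancel₀ (by positivity : δ ^ 2 ≠ 0)
    linear_combination 3 * e1 - 12 * e2 + 9 * e3
  subst hγ
  have hβ : β = 0 := by
    apply mul_left_cancel₀ hne
    linear_combination 2 * e1 - 2 * e2
  subst hβ
  linear_combination e1

/-- Differentiating `⟪r, r⟫ = 1` shows that the range of `r'` is orthogonal to the unit vector `r
x`, so `r'` is not surjective. -/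
theorem det_eq_zero_of_hasFDerivAt_of_norm_eq_one {r : Euc3 → Euc3} {r' : Euc3 →L[ℝ] Euc3} {x : Euc3}
    (hr : HasFDerivAt r r' x) (h1 : ∀ᶠ y in 𝓝 x, ‖r y‖ = 1) : r'.det = 0 := by
  by_contra hdet
  have hinner : ∀ h, inner ℝ (r x) (r' h) = 0 := by
    intro h
    have hc : HasFDerivAt (fun y => inner ℝ (r y) (r y)) (0 : Euc3 →L[ℝ] ℝ) x := by
      refine (hasFDerivAt_const (1 : ℝ) x).congr_of_eventuallyEq ?_
      filter_upwards [h1] with y hy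
      rw [real_inner_self_eq_norm_sq, hy, one_pow]
    have := (hr.inner ℝ hr).unique hc
    have := DFunLike.congr_fun this h
    simp [real_inner_comm] at this
    linarith [real_inner_comm (r x) (r' h)]
  have hu : IsUnit (r' : Euc3 →ₗ[ℝ] Euc3) := by
    rw [LinearMap.isUnit_iff_isUnit_det]
    exact isUnit_iff_ne_zero.2 hdet
  obtain ⟨h, hh⟩ := ((Module.End.isUnit_iff _).1 hu).2 (r x)
  have h2 := hinner h
  have h3 : r' h = r x := hh
  rw [h3, real_inner_self_eq_norm_sq, h1.self_of_nhds] at h2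
  norm_num at h2

/-- Normalizing `f` would give a `C¹` retraction `r` of the ball onto the sphere. Its Jacobian
vanishes, whereas the volume argument for the field `r - id` says that it integrates to the volume
of the ball. -/
theorem Euc3.no_contDiff_nonvanishing {f : Euc3 → Euc3} (hf : ContDiff ℝ 1 f) (h0 : ∀ x, f x ≠ 0) :
    ¬ ∀ x, 1 ≤ ‖x‖ → f x = x := by
  intro hid
  let r : Euc3 → Euc3 := fun x => ‖f x‖⁻¹ • f x
  have hr : ContDiff ℝ 1 r := ((hf.norm ℝ h0).inv fun x => norm_ne_zero_iff.2 (h0 x)).smul hf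
  have hr1 : ∀ x, ‖r x‖ = 1 := fun x => by
    simp [r, norm_smul, inv_mul_cancel₀ (norm_ne_zero_iff.2 (h0 x))]
  have hrid : ∀ x, ‖x‖ = 1 → r x = x := fun x hx => by simp [r, hid x hx.ge, hx]
  obtain ⟨K, hK⟩ : ∃ K : NNReal, LipschitzOnWith K (fun x => r x - x) (closedBall 0 1) := by
    have hd : ContDiff ℝ 1 fun x => r x - x := hr.sub contDiff_id
    obtain ⟨M, hM⟩ := (isCompact_closedBall (0 : Euc3) 1).exists_bound_of_continuousOn
      (hd.continuous_fderiv one_ne_zero).continuousOn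
    refine ⟨M.toNNReal, (convex_closedBall _ _).lipschitzOnWith_of_nnnorm_fderiv_le
      (fun x _ => hd.differentiable one_ne_zero x) fun x hx => ?_⟩
    rw [← NNReal.coe_le_coe, coe_nnnorm]
    exact (hM x hx).trans (Real.le_coe_toNNReal M)
  classical
  let v : Euc3 → Euc3 := fun x => if ‖x‖ ≤ 1 then r x - x else 0
  have hv0 : ∀ x, 1 ≤ ‖x‖ → v x = 0 := by
    intro x hx
    rcases hx.eq_or_lt with h | h
    · simp [v, h.ge, hrid x h.symm]
    · simp [v, not_le.2 h]
  have hin : ∀ x y, ‖x‖ ≤ 1 → ‖y‖ ≤ 1 → dist (v x) (v y) ≤ K * dist x y := fun x y hx hy => by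
    simpa [v, hx, hy] using hK.dist_le_mul x (by simpa using hx) y (by simpa using hy)
  -- The segment from `x` to `y` meets the unit sphere, where `v` vanishes.
  have hmix : ∀ x y, ‖x‖ ≤ 1 → 1 ≤ ‖y‖ → dist (v x) (v y) ≤ K * dist x y := by
    intro x y hx hy
    obtain ⟨s, hs, hs1⟩ : ∃ s ∈ Icc (0 : ℝ) 1, ‖AffineMap.lineMap x y s‖ = 1 := by
      have hc : ContinuousOn (fun s : ℝ => ‖AffineMap.lineMap x y s‖) (Icc 0 1) := by
        exact (AffineMap.lineMap_continuous.norm).continuousOn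
      exact intermediate_value_Icc zero_le_one hc ⟨by simpa using hx, by simpa using hy⟩
    have h := hin x _ hx hs1.le
    rw [hv0 _ hs1.ge] at h
    rw [hv0 y hy]
    refine h.trans (mul_le_mul_of_nonneg_left ?_ K.2)
    rw [dist_left_lineMap, Real.norm_of_nonneg hs.1]
    exact mul_le_of_le_one_left dist_nonneg hs.2
  have hv : LipschitzWith K v := LipschitzWith.of_dist_le_mul fun x y => by
    rcases le_total ‖x‖ 1 with hx | hx <;> rcases le_total ‖y‖ 1 with hy | hy
    · exact hin x y hx hy
    · exact hmix x y hx hy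
    · rw [dist_comm, dist_comm x]; exact hmix y x hy hx
    · rw [hv0 x hx, hv0 y hy]; simp; positivity
  have hr' : ∀ x, HasFDerivAt r (fderiv ℝ r x) x := fun x =>
    (hr.differentiable one_ne_zero x).hasFDerivAt
  have hv' : ∀ x ∈ ball (0 : Euc3) 1, HasFDerivAt v (fderiv ℝ r x - 1) x := by
    intro x hx
    refine ((hr' x).sub (hasFDerivAt_id x)).congr_of_eventuallyEq ?_
    filter_upwards [isOpen_ball.mem_nhds hx] with y hy
    simp [v, (mem_ball_zero_iff.1 hy).le]
  have key := Euc3.integral_det_one_add_eq hv hv0 hv'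
    ((hr.continuous_fderiv one_ne_zero).sub continuous_const).continuousOn
  have hz : ∀ x, (1 + (fderiv ℝ r x - 1)).det = 0 := fun x => by
    rw [add_sub_cancel]
    exact det_eq_zero_of_hasFDerivAt_of_norm_eq_one (hr' x) (Eventually.of_forall hr1)
  simp only [hz, integral_zero] at key
  have : 0 < volume.real (ball (0 : Euc3) 1) :=
    ENNReal.toReal_pos (measure_ball_pos _ _ one_pos).ne' measure_ball_lt_top.ne
  exact this.ne key

/-- A continuous self-map of `ℝ³` that agrees with a translation far out has a zero. -/
theorem Euc3.exists_eq_zero {g : Euc3 → Euc3} (hg : Continuous g) (c : Euc3) (R : ℝ)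
    (hid : ∀ x, R ≤ ‖x - c‖ → g x = x - c) : ∃ x, g x = 0 := by
  by_contra! h0
  set ρ := max R 0 + 1 with hρ
  have hρ0 : 0 < ρ := by positivity
  -- After rescaling, `g` becomes `u + id` with `u` zero outside the unit ball. The smooth
  -- approximation of `u` below has support inside that of `u`, and its error is smaller than `‖u x
  -- + x‖`; so adding `id` gives a nonvanishing `C¹` map that is still the identity outside the
  -- ball.
  let u : Euc3 → Euc3 := fun x => ρ⁻¹ • g (c + ρ • x) - x
  have hu : Continuous u := by fun_prop
  have hu0 : ∀ x, 1 ≤ ‖x‖ → u x = 0 := by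
    intro x hx
    have : R ≤ ‖c + ρ • x - c‖ := by
      rw [add_sub_cancel_left, norm_smul, Real.norm_of_nonneg hρ0.le]
      have h1 := le_max_left R 0
      nlinarith [le_max_right R 0]
    simp only [u]
    rw [hid _ this, add_sub_cancel_left, smul_smul, inv_mul_cancel₀ hρ0.ne', one_smul, sub_self]
  obtain ⟨w, hw, hwu, hws⟩ := hu.exists_contDiff_approx 1
    (ε := fun x => ‖u x + x‖) (hu.add continuous_id).norm (fun x => by
      simp only [u, sub_add_cancel, norm_pos_iff]
      exact smul_ne_zero (inv_ne_zero hρ0.ne') (h0 _))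
  refine Euc3.no_contDiff_nonvanishing (f := fun x => w x + x) (hw.add contDiff_id) ?_ ?_
  · intro x hx
    have := hwu x
    rw [eq_neg_of_add_eq_zero_left hx, dist_eq_norm, ← norm_neg] at this
    apply this.ne
    congr 1
    abel
  · intro x hx
    have : w x = 0 := by
      by_contra hne
      exact hws (Function.mem_support.2 hne) (hu0 x hx)
    simp [this]

/-! ### Extending nonvanishing maps across sets of small dimension -/

section Extension

variable {Y : Type*} [TopologicalSpace Y]

theorem ContinuousOn.exists_continuous_extension [NormalSpace Y] {A : Set Y} (hA : IsClosed A)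
    {f : Y → Euc3} (hf : ContinuousOn f A) : ∃ F : Y → Euc3, Continuous F ∧ EqOn F f A := by
  obtain ⟨F, hF⟩ := ContinuousMap.exists_restrict_eq hA ⟨A.domRestrict f, hf.domRestrict⟩
  exact ⟨F, F.continuous, fun x hx => DFunLike.congr_fun hF ⟨x, hx⟩⟩

/-- A set is thin if every map to `ℝ³` can be perturbed slightly so as to avoid the origin
on it. -/
def IsThin (X : Set Y) : Prop :=
  ∀ F : Y → Euc3, Continuous F → ∀ ε > 0, ∃ G : Y → Euc3, Continuous G ∧
    ∀ x ∈ X, ‖G x - F x‖ < ε ∧ G x ≠ 0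

/-- Subtracting from `G` a short vector that it does not attain on `X` removes its zeros there. -/
theorem isThin_of_dense_compl {X : Set Y} (h : ∀ F : Y → Euc3, Continuous F → ∀ ε > 0,
    ∃ G : Y → Euc3, Continuous G ∧ (∀ x ∈ X, ‖G x - F x‖ < ε) ∧ Dense (G '' X)ᶜ) : IsThin X := by
  intro F hF ε hε
  obtain ⟨G, hG, hGF, hd⟩ := h F hF (ε / 2) (half_pos hε)
  obtain ⟨q, hq, hq'⟩ := Metric.dense_iff.1 hd 0 (ε / 2) (half_pos hε)
  refine ⟨fun x => G x - q, hG.sub continuous_const, fun x hx => ⟨?_, fun h0 => ?_⟩⟩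
  · have h1 : ‖q‖ < ε / 2 := by simpa using hq
    calc ‖G x - q - F x‖ = ‖(G x - F x) - q‖ := by congr 1; abel
      _ ≤ ‖G x - F x‖ + ‖q‖ := norm_sub_le _ _
      _ < ε := by linarith [hGF x hx]
  · exact hq' ⟨x, hx, sub_eq_zero.1 h0⟩

/-- A `C¹` approximation maps null sets to null sets, and these have empty interior. -/
theorem isThin_of_volume_eq_zero {X : Set Euc3} (hX : volume X = 0) : IsThin X := by
  refine isThin_of_dense_compl fun F hF ε hε => ?_
  obtain ⟨G, hG, hGF, -⟩ := hF.exists_contDiff_approx 1 (ε := fun _ => ε) continuous_const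
    fun _ => hε
  refine ⟨G, hG.continuous, fun x _ => by simpa [dist_eq_norm] using hGF x, ?_⟩
  have h0 : volume (G '' X) = 0 := addHaar_image_eq_zero_of_differentiableOn_of_addHaar_eq_zero
    volume (hG.differentiable one_ne_zero).differentiableOn hX
  refine (interior_eq_empty_iff_dense_compl).1 ?_
  by_contra hne
  exact (isOpen_interior.measure_pos volume (nonempty_iff_ne_empty.2 hne)).ne'
    (measure_mono_null interior_subset h0)

/-- A compact set is thin if it is covered by finitely many pieces, each of them parametrized by
two coordinates on which a point-separating family of functions depends smoothly. -/
theorem isThin_of_separating {ι : Type*} [Finite ι] {X : Set Y} (hX : IsCompact X)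
    (P : ι → Set Y) (p : ι → Y → ℝ × ℝ) (hP : X ⊆ ⋃ i, P i)
    (hsep : ∀ x y : Y, x ≠ y → ∃ f : Y → ℝ, Continuous f ∧ f x ≠ f y ∧
      ∀ i, ∃ k : ℝ × ℝ → ℝ, ContDiff ℝ 1 k ∧ ∀ z ∈ P i, f z = k (p i z)) : IsThin X := by
  -- The functions that are piecewise `C¹` in the two coordinates form a point-separating
  -- subalgebra, so the Stone–Weierstrass theorem applies to each component of `F`.
  let A : Subalgebra ℝ C(Y, ℝ) :=
    { carrier := {f | ∀ i, ∃ k : ℝ × ℝ → ℝ, ContDiff ℝ 1 k ∧ ∀ z ∈ P i, f z = k (p i z)}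
      mul_mem' := fun {f g} hf hg i => by
        obtain ⟨k, hk, hk'⟩ := hf i
        obtain ⟨l, hl, hl'⟩ := hg i
        exact ⟨fun u => k u * l u, hk.mul hl, fun z hz => by simp [hk' z hz, hl' z hz]⟩
      add_mem' := fun {f g} hf hg i => by
        obtain ⟨k, hk, hk'⟩ := hf i
        obtain ⟨l, hl, hl'⟩ := hg i
        exact ⟨fun u => k u + l u, hk.add hl, fun z hz => by simp [hk' z hz, hl' z hz]⟩
      algebraMap_mem' := fun r i => ⟨fun _ => r, contDiff_const, fun z _ => by simp⟩ }
  have hA : A.SeparatesPoints := by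
    intro x y hxy
    obtain ⟨f, hf, hne, hk⟩ := hsep x y hxy
    exact ⟨f, ⟨⟨f, hf⟩, hk, rfl⟩, hne⟩
  refine isThin_of_dense_compl fun F hF ε hε => ?_
  have key : ∀ j : Fin 3, ∃ g ∈ A, ∀ x ∈ X, ‖(g : Y → ℝ) x - F x j‖ < ε / 2 := fun j =>
    ContinuousMap.exists_mem_subalgebra_near_continuous_of_isCompact_of_separatesPoints hA
      ⟨fun x => F x j, by fun_prop⟩ hX (half_pos hε)
  choose g hg hgF using key
  -- Three components with errors below `ε / 2` give an error below `ε`, since `3 / 4 < 1`. The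
  -- image of `X` lies in finitely many `C¹` images of the plane, so its Hausdorff dimension is at
  -- most two.
  refine ⟨fun x => WithLp.toLp 2 fun j => g j x, by fun_prop, fun x hx => ?_, ?_⟩
  · rw [EuclideanSpace.norm_eq, Real.sqrt_lt' hε]
    have h : ∀ j, ‖(g j : Y → ℝ) x - F x j‖ ^ 2 ≤ (ε / 2) ^ 2 := fun j =>
      pow_le_pow_left₀ (norm_nonneg _) (hgF j x hx).le 2
    simp only [Fin.sum_univ_three, PiLp.sub_apply]
    nlinarith [h 0, h 1, h 2]
  · choose k hk hk' using fun j => hg j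
    refine dense_compl_of_dimH_lt_finrank (lt_of_le_of_lt (dimH_mono
      (t := ⋃ i, range fun u => (WithLp.toLp 2 fun j => k j i u : Euc3)) ?_) ?_)
    · rintro _ ⟨x, hx, rfl⟩
      obtain ⟨i, hi⟩ := mem_iUnion.1 (hP hx)
      refine mem_iUnion.2 ⟨i, p i x, ?_⟩
      ext j
      exact (hk' j i x hi).symm
    · rw [dimH_iUnion]
      have h2 : ∀ i, dimH (range fun u => (WithLp.toLp 2 fun j => k j i u : Euc3)) ≤ (2 : ℕ) := by
        intro i
        have hc : ContDiff ℝ 1 fun u => (WithLp.toLp 2 fun j => k j i u : Euc3) := by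
          rw [contDiff_euclidean]
          exact fun j => hk j i
        simpa using hc.dimH_range_le
      refine (iSup_le h2).trans_lt ?_
      rw [finrank_euclideanSpace_fin]
      norm_num

/-- A nonvanishing map on a closed subset of a thin set extends to a nonvanishing map. -/
theorem IsThin.exists_extension [NormalSpace Y] {X A : Set Y} (hX : IsThin X) (hA : IsCompact A)
    (hA' : IsClosed A) {f : Y → Euc3} (hf : ContinuousOn f A) (hf0 : ∀ x ∈ A, f x ≠ 0) :
    ∃ F : Y → Euc3, Continuous F ∧ EqOn F f A ∧ ∀ x ∈ X, F x ≠ 0 := by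
  obtain ⟨F, hF, hFf⟩ := hf.exists_continuous_extension hA'
  obtain ⟨ε, hε, hεA⟩ := hA.exists_forall_le' (f := fun x => ‖F x‖) hF.norm.continuousOn (a := 0)
    fun x hx => by rw [norm_pos_iff, hFf hx]; exact hf0 x hx
  obtain ⟨G, hG, hGX⟩ := hX F hF (ε / 2) (half_pos hε)
  -- The map wanted interpolates between `F` on `A` and the perturbation `G` where `F` is small.
  -- Elsewhere `‖F‖ > ε / 2` exceeds the distance from `F` to `G`, so the segment between them
  -- avoids the origin.
  obtain ⟨u, hu0, hu1, hu⟩ := exists_continuous_zero_one_of_isClosed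
    (isClosed_le hF.norm (continuous_const (y := ε / 2))) hA' (by
      rw [Set.disjoint_left]
      intro x hx hxA
      have h1 : ‖F x‖ ≤ ε / 2 := hx
      have h2 : ε ≤ ‖F x‖ := hεA x hxA
      linarith)
  refine ⟨fun x => G x + u x • (F x - G x), by fun_prop, fun x hx => ?_, fun x hx h0 => ?_⟩
  · simp [hu1 hx, hFf hx]
  · replace h0 : G x + u x • (F x - G x) = 0 := h0
    by_cases hx2 : ‖F x‖ ≤ ε / 2
    · rw [hu0 hx2] at h0
      exact (hGX x hx).2 (by simpa using h0)
    · have h1 : F x = (1 - u x) • (F x - G x) := by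
        calc F x = F x - (G x + u x • (F x - G x)) := by rw [h0, sub_zero]
          _ = _ := by module
      have h2 : ‖F x‖ ≤ ‖F x - G x‖ := by
        refine (congrArg norm h1).le.trans ?_
        rw [norm_smul, Real.norm_of_nonneg (by linarith [(hu x).2])]
        exact mul_le_of_le_one_left (norm_nonneg _) (by linarith [(hu x).1])
      rw [norm_sub_rev] at h2
      linarith [(hGX x hx).1]

/-- The homotopy extension property for nonvanishing maps. -/
theorem exists_nonvanishing_of_homotopy [CompactSpace Y] [T2Space Y] {C Z : Set Y}
    (hC : IsClosed C) (hZ : IsClosed Z) {g : Y → Euc3} (hg : ContinuousOn g C)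
    (hg0 : ∀ y ∈ C, g y ≠ 0) {H : Y × unitInterval → Euc3} (hH : ContinuousOn H (Z ×ˢ univ))
    (hH0 : ∀ q ∈ Z ×ˢ (univ : Set unitInterval), H q ≠ 0) (hHg : ∀ y ∈ Z, H (y, 0) = g y) :
    ∃ g' : Y → Euc3, Continuous g' ∧ (∀ y ∈ C, g' y ≠ 0) ∧ ∀ y ∈ Z, g' y = H (y, 1) := by
  classical
  let φ : Y × unitInterval → Euc3 := fun q => if q.2 = 0 then g q.1 else H q
  have h1 : EqOn φ (fun q => g q.1) (C ×ˢ {0}) := fun q hq => by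
    have : q.2 = 0 := hq.2
    simp [φ, this]
  have h2 : EqOn φ H (Z ×ˢ univ) := fun q hq => by
    by_cases h : q.2 = 0
    · have : q = (q.1, 0) := Prod.ext rfl h
      rw [this, hHg _ hq.1]
      simp [φ]
    · simp [φ, h]
  have hc1 : IsClosed (C ×ˢ ({0} : Set unitInterval)) := hC.prod isClosed_singleton
  have hc2 : IsClosed (Z ×ˢ (univ : Set unitInterval)) := hZ.prod isClosed_univ
  have hφ : ContinuousOn φ (C ×ˢ {0} ∪ Z ×ˢ univ) := by
    refine ContinuousOn.union_of_isClosed (ContinuousOn.congr ?_ h1) (hH.congr h2) hc1 hc2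
    exact hg.comp continuous_fst.continuousOn fun q hq => hq.1
  obtain ⟨F, hF, hFφ⟩ := hφ.exists_continuous_extension (hc1.union hc2)
  -- The points over which the extended homotopy has a zero: a closed set, by compactness, that
  -- misses `Z`. Stopping the homotopy at a time that is `0` on this set and `1` on `Z` avoids the
  -- zeros.
  let bad : Set Y := Prod.fst '' {q : Y × unitInterval | F q = 0}
  have hbad : IsClosed bad :=
    ((isClosed_singleton (x := (0 : Euc3))).preimage hF).isCompact.image continuous_fst |>.isClosed
  obtain ⟨u, hu0, hu1, hu⟩ := exists_continuous_zero_one_of_isClosed hbad hZ (by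
    rw [Set.disjoint_left]
    rintro _ ⟨q, hq, rfl⟩ hqZ
    have hqZ' : q ∈ Z ×ˢ (univ : Set unitInterval) := ⟨hqZ, trivial⟩
    exact hH0 q hqZ' (by rw [← h2 hqZ', ← hFφ (Or.inr hqZ')]; exact hq))
  let w : Y → unitInterval := fun y => ⟨u y, hu y⟩
  have hw : Continuous w := u.continuous.subtype_mk _
  refine ⟨fun y => F (y, w y), hF.comp (continuous_id.prodMk hw), fun y hy h0 => ?_,
    fun y hy => ?_⟩
  · have hb : y ∈ bad := ⟨(y, w y), h0, rfl⟩
    have hw0 : w y = 0 := Subtype.ext (hu0 hb)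
    have hm : (y, w y) ∈ C ×ˢ ({0} : Set unitInterval) := ⟨hy, hw0⟩
    have h0' : F (y, w y) = 0 := h0
    rw [hFφ (Or.inl hm), h1 hm] at h0'
    exact hg0 y hy h0'
  · have hw1 : w y = 1 := Subtype.ext (hu1 hy)
    have hm : (y, w y) ∈ Z ×ˢ (univ : Set unitInterval) := ⟨hy, trivial⟩
    simp only
    rw [hFφ (Or.inr hm), h2 hm, hw1]

/-- Nonvanishing maps on two closed sets can be glued without changing them on `L`, where they
agree, if the product of the intersection with the unit interval is thin. -/
theorem exists_nonvanishing_union [CompactSpace Y] [T2Space Y] {C₁ C₂ L : Set Y}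
    (h₁ : IsClosed C₁) (h₂ : IsClosed C₂) (hL : IsClosed L)
    (hthin : IsThin ((C₁ ∩ C₂) ×ˢ (univ : Set unitInterval))) {g₁ g₂ : Y → Euc3}
    (hg₁ : ContinuousOn g₁ C₁) (hg₂ : ContinuousOn g₂ C₂) (h₁0 : ∀ y ∈ C₁, g₁ y ≠ 0)
    (h₂0 : ∀ y ∈ C₂, g₂ y ≠ 0) (hag : ∀ y ∈ C₁ ∩ C₂, y ∈ L → g₁ y = g₂ y) :
    ∃ g : Y → Euc3, ContinuousOn g (C₁ ∪ C₂) ∧ (∀ y ∈ C₁ ∪ C₂, g y ≠ 0) ∧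
      (∀ y ∈ C₁, y ∈ L → g y = g₁ y) ∧ ∀ y ∈ C₂, g y = g₂ y := by
  classical
  have hX : IsClosed (C₁ ∩ C₂) := h₁.inter h₂
  -- Thinness provides a nonvanishing homotopy over `C₁ ∩ C₂` from `g₁` to `g₂` that is constant
  -- over `L`. Homotopy extension then replaces `g₁` by a map that agrees with `g₂` on the overlap.
  let A₀ : Set (Y × unitInterval) := (C₁ ∩ C₂ ∩ L) ×ˢ univ ∪ (C₁ ∩ C₂) ×ˢ {0}
  let A₁ : Set (Y × unitInterval) := (C₁ ∩ C₂) ×ˢ {1}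
  have hA₀ : IsClosed A₀ :=
    ((hX.inter hL).prod isClosed_univ).union (hX.prod isClosed_singleton)
  have hA₁ : IsClosed A₁ := hX.prod isClosed_singleton
  let φ : Y × unitInterval → Euc3 := fun q => if q.2 = 1 then g₂ q.1 else g₁ q.1
  have e1 : EqOn φ (fun q => g₂ q.1) A₁ := fun q hq => by
    have : q.2 = 1 := hq.2
    simp [φ, this]
  have e0 : EqOn φ (fun q => g₁ q.1) A₀ := fun q hq => by
    by_cases h : q.2 = 1
    · rcases hq with hq | hq
      · simp [φ, h, hag q.1 hq.1.1 hq.1.2]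
      · exact absurd (h.symm.trans hq.2) one_ne_zero
    · simp [φ, h]
  have m0 : ∀ q ∈ A₀, q.1 ∈ C₁ := by
    rintro q (hq | hq)
    exacts [hq.1.1.1, hq.1.1]
  have hφ : ContinuousOn φ (A₀ ∪ A₁) := by
    refine ContinuousOn.union_of_isClosed (ContinuousOn.congr ?_ e0) (ContinuousOn.congr ?_ e1)
      hA₀ hA₁
    · exact hg₁.comp continuous_fst.continuousOn m0
    · exact hg₂.comp continuous_fst.continuousOn fun q hq => hq.1.2
  obtain ⟨H, hH, hHφ, hH0⟩ := hthin.exists_extension (hA₀.union hA₁).isCompact (hA₀.union hA₁) hφ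
    (by
      rintro q (hq | hq)
      · rw [e0 hq]; exact h₁0 _ (m0 q hq)
      · rw [e1 hq]; exact h₂0 _ hq.1.2)
  let Z₁ : Set Y := C₁ ∩ L
  let J : Y × unitInterval → Euc3 := fun q => if q.1 ∈ C₂ then H q else g₁ q.1
  have j1 : EqOn J H ((C₁ ∩ C₂) ×ˢ univ) := fun q hq => by simp [J, hq.1.2]
  have j2 : EqOn J (fun q => g₁ q.1) (Z₁ ×ˢ univ) := fun q hq => by
    by_cases h : q.1 ∈ C₂
    · have hm : q ∈ A₀ := Or.inl ⟨⟨⟨hq.1.1, h⟩, hq.1.2⟩, trivial⟩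
      simp only [J, h, if_true]
      rw [hHφ (Or.inl hm), e0 hm]
    · simp [J, h]
  obtain ⟨g', hg', hg'0, hg'1⟩ := exists_nonvanishing_of_homotopy (Z := Z₁ ∪ C₁ ∩ C₂) (H := J) h₁
    ((h₁.inter hL).union hX) hg₁ h₁0
    (by
      rw [union_prod]
      refine ContinuousOn.union_of_isClosed (ContinuousOn.congr ?_ j2)
        (hH.continuousOn.congr j1) ((h₁.inter hL).prod isClosed_univ) (hX.prod isClosed_univ)
      exact hg₁.comp continuous_fst.continuousOn fun q hq => hq.1.1)
    (by
      rw [union_prod]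
      rintro q (hq | hq)
      · rw [j2 hq]; exact h₁0 _ hq.1.1
      · rw [j1 hq]; exact hH0 q hq)
    (by
      rintro y (hy | hy)
      · exact j2 (x := (y, 0)) ⟨hy, trivial⟩
      · have hm : (y, (0 : unitInterval)) ∈ A₀ := Or.inr ⟨hy, rfl⟩
        rw [j1 (x := (y, 0)) ⟨hy, trivial⟩, hHφ (Or.inl hm), e0 hm])
  have hag' : ∀ y ∈ C₁ ∩ C₂, g' y = g₂ y := fun y hy => by
    have hm : (y, (1 : unitInterval)) ∈ A₁ := ⟨hy, rfl⟩
    rw [hg'1 y (Or.inr hy), j1 (x := (y, 1)) ⟨hy, trivial⟩, hHφ (Or.inr hm), e1 hm]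
  let g : Y → Euc3 := fun y => if y ∈ C₂ then g₂ y else g' y
  have k2 : EqOn g g₂ C₂ := fun y hy => by simp [g, hy]
  have k1 : EqOn g g' C₁ := fun y hy => by
    by_cases h : y ∈ C₂
    · simp [g, h, hag' y ⟨hy, h⟩]
    · simp [g, h]
  refine ⟨g, ContinuousOn.union_of_isClosed (hg'.continuousOn.congr k1) (hg₂.congr k2) h₁ h₂,
    ?_, fun y hy hyL => ?_, k2⟩
  · rintro y (hy | hy)
    · rw [k1 hy]; exact hg'0 y hy
    · rw [k2 hy]; exact h₂0 y hy
  · rw [k1 hy, hg'1 y (Or.inl ⟨hy, hyL⟩)]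
    exact j2 (x := (y, 1)) ⟨⟨hy, hyL⟩, trivial⟩

end Extension

/-! ### Detecting interior points by extension of nonvanishing maps -/

/-- On a compact set `C` with interior point `c`, the map `w ↦ w - c` on the frontier does not
extend to a nonvanishing map. -/
theorem Euc3.not_extends_of_mem_interior {C L : Set Euc3} (hC : IsCompact C) (hL : IsOpen (C \ L))
    {c : Euc3} (hc : c ∈ C \ L) {g : Euc3 → Euc3} (hg : ContinuousOn g C)
    (hgL : ∀ w ∈ C, w ∈ L → g w = w - c) : ∃ w ∈ C, g w = 0 := by
  classical
  by_contra! h0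
  -- Continued by the translation outside `C`, a nonvanishing `g` would contradict the theorem on
  -- zeros.
  let G : Euc3 → Euc3 := fun w => if w ∈ C then g w else w - c
  have e1 : EqOn G g C := fun w hw => by simp [G, hw]
  have e2 : EqOn G (fun w => w - c) (C \ L)ᶜ := fun w hw => by
    by_cases h : w ∈ C
    · simp only [G, h, if_true]
      exact hgL w h (by_contra fun hL => hw ⟨h, hL⟩)
    · simp [G, h]
  have hG : Continuous G := by
    have hU : C ∪ (C \ L)ᶜ = univ := by
      ext w; simp only [mem_union, mem_compl_iff, Set.mem_sdiff, mem_univ, iff_true]; tauto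
    rw [← continuousOn_univ, ← hU]
    exact ContinuousOn.union_of_isClosed (hg.congr e1)
      ((continuous_id.sub continuous_const).continuousOn.congr e2) hC.isClosed hL.isClosed_compl
  obtain ⟨R, hR⟩ := hC.isBounded.subset_ball c
  obtain ⟨x, hx⟩ := Euc3.exists_eq_zero hG c R fun w hw => e2 fun hwC => by
    have := hR hwC.1
    rw [mem_ball, dist_eq_norm] at this
    exact absurd hw (not_le.2 this)
  by_cases hxC : x ∈ C
  · exact h0 x hxC (by rw [← e1 hxC]; exact hx)
  · rw [e2 (fun h => hxC h.1)] at hx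
    exact hxC (sub_eq_zero.1 hx ▸ hc.1)

/-- A nonvanishing map on `C \ {c}`, where `c` is a frontier point of `C`, can be changed near `c`
so as to extend to a nonvanishing map on `C`. -/
theorem Euc3.exists_extension_of_notMem_interior {C L : Set Euc3} (hC : IsCompact C) {c : Euc3}
    (hc : c ∉ interior C) (hL : IsClosed L) (hcL : c ∉ L) {f : Euc3 → Euc3}
    (hf : ContinuousOn f (C \ {c})) (hf0 : ∀ w ∈ C \ {c}, f w ≠ 0) :
    ∃ g : Euc3 → Euc3, ContinuousOn g C ∧ (∀ w ∈ C, g w ≠ 0) ∧ ∀ w ∈ L, g w = f w := by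
  classical
  obtain ⟨η, hη, hηL⟩ := Metric.isOpen_iff.1 hL.isOpen_compl c hcL
  set δ := η / 2 with hδ
  have hδ0 : 0 < δ := half_pos hη
  -- Inside the small sphere around `p`, which encloses `c`, the map is replaced by values on that
  -- sphere through radial projection from `p`; this is continuous on `C` because `p ∉ C`. As `δ = η
  -- / 2`, the modified region stays within `η` of `c`, away from `L`.
  obtain ⟨p, hp, hpC⟩ : ∃ p ∈ ball c δ, p ∉ C := by
    by_contra! h
    exact hc (mem_interior.2 ⟨ball c δ, h, isOpen_ball, mem_ball_self hδ0⟩)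
  have hcp : ‖c - p‖ < δ := by rw [mem_ball, dist_comm, dist_eq_norm] at hp; exact hp
  have hthin : IsThin (sphere p δ) := isThin_of_volume_eq_zero (Measure.addHaar_sphere _ _ _)
  have hsub : C ∩ sphere p δ ⊆ C \ {c} := fun w hw => ⟨hw.1, fun h => by
    have h1 : ‖w - p‖ = δ := by simpa [dist_eq_norm] using hw.2
    rw [mem_singleton_iff.1 h] at h1
    exact hcp.ne h1⟩
  have hA : IsCompact (C ∩ sphere p δ) := hC.inter_right isClosed_sphere
  obtain ⟨F, hF, hFf, hF0⟩ := hthin.exists_extension hA hA.isClosed (hf.mono hsub)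
    fun w hw => hf0 w (hsub hw)
  let ρ : Euc3 → Euc3 := fun w => p + (δ / ‖w - p‖) • (w - p)
  have hne : ∀ w ∈ C, ‖w - p‖ ≠ 0 := fun w hw h =>
    hpC (sub_eq_zero.1 (norm_eq_zero.1 h) ▸ hw)
  have hρ : ContinuousOn ρ C := by
    refine continuousOn_const.add (ContinuousOn.smul (ContinuousOn.div continuousOn_const
      (by fun_prop) hne) (by fun_prop))
  have hρs : ∀ w ∈ C, ρ w ∈ sphere p δ := fun w hw => by
    simp only [ρ, mem_sphere, dist_eq_norm, add_sub_cancel_left, norm_smul, norm_div, norm_norm]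
    rw [div_mul_cancel₀ _ (hne w hw), Real.norm_of_nonneg hδ0.le]
  let g : Euc3 → Euc3 := fun w => if ‖w - p‖ ≤ δ then F (ρ w) else f w
  have e1 : EqOn g (fun w => F (ρ w)) (C ∩ closedBall p δ) := fun w hw => by
    have : ‖w - p‖ ≤ δ := by simpa [dist_eq_norm] using hw.2
    simp [g, this]
  have e2 : EqOn g f (C ∩ {w | δ ≤ ‖w - p‖}) := fun w hw => by
    have h : δ ≤ ‖w - p‖ := hw.2
    rcases h.eq_or_lt with h | h
    · have hw1 : ρ w = w := by
        simp only [ρ]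
        rw [← h, div_self hδ0.ne', one_smul, add_sub_cancel]
      simp only [g, h.ge, if_true, hw1]
      exact hFf ⟨hw.1, by simp [h]⟩
    · simp [g, not_le.2 h]
  have hcov : C = (C ∩ closedBall p δ) ∪ (C ∩ {w | δ ≤ ‖w - p‖}) := by
    ext w
    simp only [mem_union, mem_inter_iff, mem_closedBall, dist_eq_norm, mem_ofPred_eq]
    have := le_total ‖w - p‖ δ
    tauto
  have hmem : ∀ w ∈ C ∩ {w | δ ≤ ‖w - p‖}, w ∈ C \ {c} := fun w hw => ⟨hw.1, fun h => by
    have h1 : δ ≤ ‖w - p‖ := hw.2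
    rw [mem_singleton_iff.1 h] at h1
    exact h1.not_gt hcp⟩
  refine ⟨g, ?_, fun w hw => ?_, fun w hw => ?_⟩
  · rw [hcov]
    refine ContinuousOn.union_of_isClosed (ContinuousOn.congr ?_ e1)
      ((hf.mono hmem).congr e2) (hC.isClosed.inter isClosed_closedBall)
      (hC.isClosed.inter (isClosed_le continuous_const (by fun_prop)))
    exact hF.comp_continuousOn (hρ.mono inter_subset_left)
  · rw [hcov] at hw
    rcases hw with hw | hw
    · rw [e1 hw]; exact hF0 _ (hρs w hw.1)
    · rw [e2 hw]; exact hf0 w (hmem w hw)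
  · have h1 : ¬ dist w c < η := fun h => hηL h hw
    have h2 : dist w c ≤ ‖w - p‖ + ‖c - p‖ := by
      rw [dist_eq_norm, norm_sub_rev c p]
      calc ‖w - c‖ = ‖(w - p) + (p - c)‖ := by congr 1; abel
        _ ≤ _ := norm_add_le _ _
    have h3 : ¬ ‖w - p‖ ≤ δ := by
      intro h3
      apply h1
      linarith
    simp [g, h3]

theorem isClosed_setOf_forall {Y : Type*} [TopologicalSpace Y] {ι : Sort*} {P : ι → Y → Prop}
    (h : ∀ i, IsClosed {y | P i y}) : IsClosed {y | ∀ i, P i y} := by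
  convert isClosed_iInter h
  ext
  simp

/-! ### Spaces that become Euclidean when a point is removed -/

/-- Removing any point from `Y` leaves a copy of `ℝ³`. -/
def IsPuncturedEuclidean (Y : Type*) [TopologicalSpace Y] : Prop :=
  ∀ z : Y, ∃ j : OpenPartialHomeomorph Y Euc3, j.source = {z}ᶜ ∧ j.target = univ

/-- The charts are stereographic projections. -/
theorem isPuncturedEuclidean_of_homeomorph {Y : Type*} [TopologicalSpace Y]
    (h : Y ≃ₜ sphere (0 : EuclideanSpace ℝ (Fin 4)) 1) : IsPuncturedEuclidean Y := by
  have : Fact (Module.finrank ℝ (EuclideanSpace ℝ (Fin 4)) = 3 + 1) := ⟨by simp⟩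
  intro z
  refine ⟨h.toOpenPartialHomeomorph.trans (stereographic' 3 (h z)), ?_, ?_⟩
  · ext y
    simp
  · ext y
    simp

section Chart

variable {Y : Type*} [TopologicalSpace Y] {z x : Y} {j : OpenPartialHomeomorph Y Euc3}

theorem exists_eq_zero_of_eqOn_chart (hj : j.source = {z}ᶜ) {C L : Set Y} (hC : IsCompact C)
    (hz : z ∉ C) (hL : IsOpen (C \ L)) (hx : x ∈ C \ L) {g : Y → Euc3} (hg : ContinuousOn g C)
    (hgL : ∀ y ∈ C, y ∈ L → g y = j y - j x) : ∃ y ∈ C, g y = 0 := by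
  have hCs : C ⊆ j.source := fun y hy => by
    rw [hj]; exact fun h => hz (mem_singleton_iff.1 h ▸ hy)
  have hinj := j.injOn
  have hCL : j '' C \ j '' (C ∩ L) = j '' (C \ L) := by
    ext w
    constructor
    · rintro ⟨⟨y, hy, rfl⟩, hw⟩
      exact ⟨y, ⟨hy, fun h => hw ⟨y, ⟨hy, h⟩, rfl⟩⟩, rfl⟩
    · rintro ⟨y, hy, rfl⟩
      refine ⟨⟨y, hy.1, rfl⟩, ?_⟩
      rintro ⟨y', hy', he⟩
      exact hy.2 (hinj (hCs hy'.1) (hCs hy.1) he ▸ hy'.2)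
  obtain ⟨w, ⟨y, hy, rfl⟩, hw⟩ := Euc3.not_extends_of_mem_interior (C := j '' C)
    (L := j '' (C ∩ L)) (c := j x) (g := fun w => g (j.symm w))
    (hC.image_of_continuousOn (j.continuousOn.mono hCs))
    (by rw [hCL]; exact j.isOpen_image_of_subset_source hL (sdiff_subset.trans hCs))
    (by rw [hCL]; exact ⟨x, hx, rfl⟩)
    (by
      refine hg.comp (j.continuousOn_symm.mono ?_) ?_
      · rintro _ ⟨y, hy, rfl⟩; exact j.map_source (hCs hy)
      · rintro _ ⟨y, hy, rfl⟩; rwa [j.left_inv (hCs hy)])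
    (by
      rintro _ - ⟨y, hy, rfl⟩
      rw [j.left_inv (hCs hy.1)]
      exact hgL y hy.1 hy.2)
  exact ⟨y, hy, by simpa only [j.left_inv (hCs hy)] using hw⟩

/-- The chart `j` carries `C` homeomorphically to a compact subset of three-space; as its source is
open, a point interior to the image would already be interior to `C`. -/
theorem exists_extension_of_notMem_interior_chart (hj : j.source = {z}ᶜ) {C L : Set Y}
    (hC : IsCompact C) (hz : z ∉ C) (hxC : x ∈ C) (hx : x ∉ interior C) (hLC : L ⊆ C)
    (hL : IsCompact L) (hxL : x ∉ L) {f : Y → Euc3} (hf : ContinuousOn f (C \ {x}))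
    (hf0 : ∀ y ∈ C \ {x}, f y ≠ 0) :
    ∃ g : Y → Euc3, ContinuousOn g C ∧ (∀ y ∈ C, g y ≠ 0) ∧ ∀ y ∈ L, g y = f y := by
  have hCs : C ⊆ j.source := fun y hy => by
    rw [hj]; exact fun h => hz (mem_singleton_iff.1 h ▸ hy)
  have hinj := j.injOn
  have hmem : ∀ w ∈ j '' C \ {j x}, j.symm w ∈ C \ {x} := by
    rintro _ ⟨⟨y, hy, rfl⟩, hne⟩
    rw [j.left_inv (hCs hy)]
    exact ⟨hy, fun h => hne (by rw [mem_singleton_iff.1 h]; rfl)⟩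
  obtain ⟨g, hg, hg0, hgL⟩ := Euc3.exists_extension_of_notMem_interior (C := j '' C) (L := j '' L)
    (c := j x) (f := fun w => f (j.symm w))
    (hC.image_of_continuousOn (j.continuousOn.mono hCs))
    (by
      intro h
      refine hx (mem_interior.2 ⟨j.source ∩ j ⁻¹' interior (j '' C), ?_,
        j.isOpen_inter_preimage isOpen_interior, hCs hxC, h⟩)
      rintro y ⟨hy, hyi⟩
      obtain ⟨y', hy', he⟩ := interior_subset hyi
      exact hinj (hCs hy') hy he ▸ hy')
    (hL.image_of_continuousOn (j.continuousOn.mono (hLC.trans hCs))).isClosed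
    (by
      rintro ⟨y, hy, he⟩
      exact hxL (hinj (hCs (hLC hy)) (hCs hxC) he ▸ hy))
    (by
      refine hf.comp (j.continuousOn_symm.mono ?_) hmem
      rintro _ ⟨⟨y, hy, rfl⟩, -⟩; exact j.map_source (hCs hy))
    (fun w hw => hf0 _ (hmem w hw))
  refine ⟨fun y => g (j y), hg.comp (j.continuousOn.mono hCs) (mapsTo_image _ _),
    fun y hy => hg0 _ ⟨y, hy, rfl⟩, fun y hy => ?_⟩
  simp only
  rw [hgL _ ⟨y, hy, rfl⟩, j.left_inv (hCs (hLC hy))]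

end Chart

namespace PreAbstractSimplicialComplex

/-! ### The geometric realization in barycentric coordinates -/

variable {V : Type*} {K : PreAbstractSimplicialComplex V}

/-- The geometric realization of `K`, in barycentric coordinates. -/
def realization (K : PreAbstractSimplicialComplex V) : Set (V → ℝ) :=
  {y | (∀ v, 0 ≤ y v) ∧ ∃ σ ∈ K.faces, (∀ v ∉ σ, y v = 0) ∧ ∑ v ∈ σ, y v = 1}

theorem nonempty_of_mem_faces {σ : Finset V} (hσ : σ ∈ K.faces) : σ.Nonempty :=
  (K.isRelLowerSet_faces hσ).1

theorem mem_faces_of_subset {σ τ : Finset V} (hσ : σ ∈ K.faces) (h : τ ⊆ σ) (hτ : τ.Nonempty) :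
    τ ∈ K.faces :=
  (K.isRelLowerSet_faces hσ).2 h hτ

/-- Each closed simplex is closed in the cube `[0, 1]^V`, which is compact for any `V` by
Tychonoff's theorem. -/
theorem isCompact_realization (hfin : K.faces.Finite) : IsCompact K.realization := by
  have h : K.realization = ⋃ σ ∈ K.faces, {y | (∀ v, 0 ≤ y v) ∧ (∀ v ∉ σ, y v = 0) ∧
      ∑ v ∈ σ, y v = 1} := by
    ext y
    simp [realization]
    tauto
  rw [h]
  refine hfin.isCompact_biUnion fun σ _ => ?_
  refine (isCompact_univ_pi fun _ : V => isCompact_Icc (a := (0 : ℝ)) (b := 1)).of_isClosed_subset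
    ?_ ?_
  · refine IsClosed.inter ?_ (IsClosed.inter ?_ ?_)
    · exact isClosed_setOf_forall fun v => isClosed_le continuous_const (continuous_apply v)
    · exact isClosed_setOf_forall fun v => isClosed_setOf_forall fun _ =>
        isClosed_eq (continuous_apply v) continuous_const
    · exact isClosed_eq (by fun_prop) continuous_const
  · rintro y ⟨h0, hσ, h1⟩ v -
    refine ⟨h0 v, ?_⟩
    by_cases hv : v ∈ σ
    · rw [← h1]
      exact Finset.single_le_sum (fun u _ => h0 u) hv
    · rw [hσ v hv]; exact zero_le_one

theorem exists_support (y : K.realization) :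
    ∃ σ ∈ K.faces, (∀ v, v ∈ σ ↔ y.1 v ≠ 0) ∧ ∑ v ∈ σ, y.1 v = 1 := by
  classical
  obtain ⟨h0, σ, hσ, hoff, hsum⟩ := y.2
  have hs : ∑ v ∈ σ.filter (fun v => y.1 v ≠ 0), y.1 v = 1 := by
    rw [Finset.sum_filter_ne_zero, hsum]
  refine ⟨σ.filter fun v => y.1 v ≠ 0, mem_faces_of_subset hσ (Finset.filter_subset _ _) ?_,
    fun v => ?_, hs⟩
  · by_contra hne
    rw [Finset.not_nonempty_iff_eq_empty.1 hne] at hs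
    simp at hs
  · rw [Finset.mem_filter, and_iff_right_iff_imp]
    exact fun h => by_contra fun hv => h (hoff v hv)

theorem mem_realization_of_support {y : K.realization} {u : V → ℝ} (h0 : ∀ v, 0 ≤ u v)
    (hu : ∀ v, y.1 v = 0 → u v = 0) (h1 : ∀ σ : Finset V, (∀ v, v ∈ σ ↔ y.1 v ≠ 0) →
      ∑ v ∈ σ, y.1 v = 1 → ∑ v ∈ σ, u v = 1) : u ∈ K.realization := by
  obtain ⟨σ, hσ, hs, hsum⟩ := exists_support y
  exact ⟨h0, σ, hσ, fun v hv => hu v (not_not.1 fun h => hv ((hs v).2 h)), h1 σ hs hsum⟩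

theorem sum_eq_one_of_subset {y : K.realization} {σ : Finset V} (h : ∀ v, y.1 v ≠ 0 → v ∈ σ) :
    ∑ v ∈ σ, y.1 v = 1 := by
  obtain ⟨τ, -, hs, hsum⟩ := exists_support y
  rw [← hsum]
  refine (Finset.sum_subset (fun v hv => h v ((hs v).1 hv)) fun v _ hv => ?_).symm
  exact not_not.1 fun h => hv ((hs v).2 h)

/-- The point `x₀` is only a default value where `Φ` leaves the realization; it lets maps given by
coordinate formulas on `S` be used as total functions. -/
theorem exists_continuousOn_lift {X : Type*} [TopologicalSpace X] {S : Set X} {Φ : X → V → ℝ}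
    (hΦ : ContinuousOn Φ S) (hS : ∀ y ∈ S, Φ y ∈ K.realization) (x₀ : K.realization) :
    ∃ r : X → K.realization, ContinuousOn r S ∧ ∀ y ∈ S, (r y).1 = Φ y := by
  classical
  let r : X → K.realization := fun y => if h : Φ y ∈ K.realization then ⟨Φ y, h⟩ else x₀
  have hr : ∀ y ∈ S, (r y).1 = Φ y := fun y hy => by simp [r, hS y hy]
  exact ⟨r, Topology.IsInducing.subtypeVal.continuousOn_iff.2 (hΦ.congr hr), hr⟩

/-- The barycenter of a face. -/
noncomputable def barycenter {σ : Finset V} (hσ : σ ∈ K.faces) : K.realization := by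
  classical
  exact ⟨fun v => if v ∈ σ then (σ.card : ℝ)⁻¹ else 0,
    fun v => by dsimp only; split_ifs <;> positivity, σ, hσ, fun v hv => if_neg hv, by
      have : (σ.card : ℝ) ≠ 0 := Nat.cast_ne_zero.2 (nonempty_of_mem_faces hσ).card_pos.ne'
      rw [Finset.sum_congr rfl fun v hv => if_pos hv]
      simp [this]⟩

theorem barycenter_of_mem {σ : Finset V} (hσ : σ ∈ K.faces) {v : V} (hv : v ∈ σ) :
    (barycenter hσ).1 v = (σ.card : ℝ)⁻¹ := if_pos hv

theorem barycenter_of_notMem {σ : Finset V} (hσ : σ ∈ K.faces) {v : V} (hv : v ∉ σ) :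
    (barycenter hσ).1 v = 0 := if_neg hv

/-- A closed neighbourhood of the barycenter of `σ` in the open star of `σ`. -/
def starNhd (K : PreAbstractSimplicialComplex V) (σ : Finset V) : Set K.realization :=
  {y | ∀ v ∈ σ, (2 * σ.card : ℝ)⁻¹ ≤ y.1 v}

/-- The frontier of the neighbourhood `starNhd`. -/
def starBdry (K : PreAbstractSimplicialComplex V) (σ : Finset V) : Set K.realization :=
  {y | y ∈ K.starNhd σ ∧ ∃ v ∈ σ, y.1 v = (2 * σ.card : ℝ)⁻¹}

theorem continuous_coord (v : V) : Continuous fun y : K.realization => y.1 v :=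
  (continuous_apply v).comp continuous_subtype_val

theorem isClosed_starNhd (σ : Finset V) : IsClosed (K.starNhd σ) :=
  isClosed_setOf_forall fun v => isClosed_setOf_forall fun _ =>
    isClosed_le continuous_const (continuous_coord v)

theorem isClosed_starBdry (σ : Finset V) : IsClosed (K.starBdry σ) := by
  refine (isClosed_starNhd σ).inter ?_
  have : {y : K.realization | ∃ v ∈ σ, y.1 v = (2 * σ.card : ℝ)⁻¹} =
      ⋃ v ∈ σ, {y : K.realization | y.1 v = (2 * σ.card : ℝ)⁻¹} := by
    ext y; simp
  rw [show (fun y : K.realization => ∃ v ∈ σ, y.1 v = (2 * σ.card : ℝ)⁻¹) =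
    {y : K.realization | ∃ v ∈ σ, y.1 v = (2 * σ.card : ℝ)⁻¹} from rfl, this]
  exact σ.finite_toSet.isClosed_biUnion fun v _ =>
    isClosed_eq (continuous_coord v) continuous_const

theorem isOpen_starNhd_diff (σ : Finset V) : IsOpen (K.starNhd σ \ K.starBdry σ) := by
  have : K.starNhd σ \ K.starBdry σ =
      ⋂ v ∈ σ, {y : K.realization | (2 * σ.card : ℝ)⁻¹ < y.1 v} := by
    ext y
    simp only [starBdry, starNhd, Set.mem_sdiff, mem_ofPred_eq, mem_iInter, not_and, not_exists]
    constructor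
    · exact fun h v hv => lt_of_le_of_ne (h.1 v hv) (Ne.symm (h.2 h.1 v hv))
    · exact fun h => ⟨fun v hv => (h v hv).le, fun _ v hv => (h v hv).ne'⟩
  rw [this]
  exact isOpen_biInter_finset fun v _ => isOpen_lt continuous_const (continuous_coord v)

/-- The coordinates of the barycenter are twice the threshold in `starNhd`. -/
theorem barycenter_mem_starNhd_diff {σ : Finset V} (hσ : σ ∈ K.faces) :
    barycenter hσ ∈ K.starNhd σ \ K.starBdry σ := by
  have hk : (0 : ℝ) < σ.card := Nat.cast_pos.2 (nonempty_of_mem_faces hσ).card_pos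
  have h : (2 * σ.card : ℝ)⁻¹ < (σ.card : ℝ)⁻¹ := by
    rw [mul_inv]
    have := inv_pos.2 hk
    linarith
  refine ⟨fun v hv => by rw [barycenter_of_mem hσ hv]; exact h.le, ?_⟩
  rintro ⟨-, v, hv, he⟩
  rw [barycenter_of_mem hσ hv] at he
  exact h.ne' he

theorem pos_of_mem_starNhd {σ : Finset V} {y : K.realization} (hy : y ∈ K.starNhd σ) {v : V}
    (hv : v ∈ σ) : 0 < y.1 v := by
  have hk : (0 : ℝ) < σ.card := Nat.cast_pos.2 (Finset.card_pos.2 ⟨v, hv⟩)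
  exact lt_of_lt_of_le (by positivity) (hy v hv)

/-- The coordinates on `σ` sum to at most one, so the lower bounds are equalities and nothing is
left for the other vertices. -/
theorem eq_barycenter {σ : Finset V} (hσ : σ ∈ K.faces) {y : K.realization}
    (hy : ∀ v ∈ σ, (σ.card : ℝ)⁻¹ ≤ y.1 v) : y = barycenter hσ := by
  classical
  have hk : (0 : ℝ) < σ.card := Nat.cast_pos.2 (nonempty_of_mem_faces hσ).card_pos
  obtain ⟨τ, -, hs, hsum⟩ := exists_support y
  have hst : σ ⊆ τ := fun v hv => (hs v).2 (lt_of_lt_of_le (inv_pos.2 hk) (hy v hv)).ne'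
  have h1 : ∑ v ∈ σ, y.1 v = 1 - ∑ v ∈ τ \ σ, y.1 v := by
    rw [← hsum, ← Finset.sum_sdiff hst]; ring
  have h2 : ∑ v ∈ σ, (y.1 v - (σ.card : ℝ)⁻¹) = - ∑ v ∈ τ \ σ, y.1 v := by
    rw [Finset.sum_sub_distrib, h1]
    simp [hk.ne']
  have h3 : 0 ≤ ∑ v ∈ σ, (y.1 v - (σ.card : ℝ)⁻¹) :=
    Finset.sum_nonneg fun v hv => sub_nonneg.2 (hy v hv)
  have h4 : 0 ≤ ∑ v ∈ τ \ σ, y.1 v := Finset.sum_nonneg fun v _ => y.2.1 v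
  have h5 : ∑ v ∈ τ \ σ, y.1 v = 0 := by linarith
  have h6 : ∑ v ∈ σ, (y.1 v - (σ.card : ℝ)⁻¹) = 0 := by linarith
  rw [Finset.sum_eq_zero_iff_of_nonneg fun v _ => y.2.1 v] at h5
  rw [Finset.sum_eq_zero_iff_of_nonneg fun v hv => sub_nonneg.2 (hy v hv)] at h6
  ext v
  by_cases hv : v ∈ σ
  · rw [barycenter_of_mem hσ hv]
    linarith [h6 v hv]
  · rw [barycenter_of_notMem hσ hv]
    by_cases hvt : v ∈ τ
    · exact h5 v (Finset.mem_sdiff.2 ⟨hvt, hv⟩)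
    · exact not_not.1 fun h => hvt ((hs v).2 h)

/-- The radial retraction of the punctured star neighbourhood onto its frontier. -/
theorem exists_radial_retraction {σ : Finset V} (hσ : σ ∈ K.faces) :
    ∃ r : K.realization → K.realization,
      ContinuousOn r (K.starNhd σ \ {barycenter hσ}) ∧
      ∀ y ∈ K.starNhd σ \ {barycenter hσ}, r y ∈ K.starBdry σ ∧
        (∀ v, y.1 v = 0 → (r y).1 v = 0) ∧ (y ∈ K.starBdry σ → r y = y) := by
  classical
  have hne := nonempty_of_mem_faces hσ
  have hk : (0 : ℝ) < σ.card := Nat.cast_pos.2 hne.card_pos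
  set κ : ℝ := (σ.card : ℝ)⁻¹ with hκ
  have hκ0 : 0 < κ := inv_pos.2 hk
  have hc : (2 * σ.card : ℝ)⁻¹ = κ / 2 := by rw [mul_inv, ← hκ]; ring
  let m : K.realization → ℝ := fun y => σ.inf' hne fun v => y.1 v
  have hm : Continuous m := Continuous.finset_inf'_apply hne fun v _ => continuous_coord v
  have hmC : ∀ y ∈ K.starNhd σ, κ / 2 ≤ m y := fun y hy =>
    Finset.le_inf' hne _ fun v hv => by rw [← hc]; exact hy v hv
  have hmv : ∀ y : K.realization, ∀ v ∈ σ, m y ≤ y.1 v := fun y v hv => Finset.inf'_le _ hv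
  have hma : ∀ y : K.realization, ∃ v ∈ σ, m y = y.1 v := fun y =>
    Finset.exists_mem_eq_inf' hne fun v => y.1 v
  have hmx : ∀ y ∈ K.starNhd σ \ {barycenter hσ}, m y < κ := by
    intro y hy
    by_contra h
    exact hy.2 (eq_barycenter hσ fun v hv => (not_lt.1 h).trans (hmv y v hv))
  -- The factor by which `y` is pushed away from the barycenter: it brings the least coordinate on
  -- `σ` down to exactly `κ / 2`.
  let s : K.realization → ℝ := fun y => (κ / 2) / (κ - m y)
  have hs1 : ∀ y ∈ K.starNhd σ \ {barycenter hσ}, 1 ≤ s y := fun y hy => by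
    rw [one_le_div (sub_pos.2 (hmx y hy))]
    linarith [hmC y hy.1]
  have hsm : ∀ y ∈ K.starNhd σ \ {barycenter hσ}, s y * (κ - m y) = κ / 2 := fun y hy =>
    div_mul_cancel₀ _ (sub_pos.2 (hmx y hy)).ne'
  let Φ : K.realization → V → ℝ := fun y v =>
    (barycenter hσ).1 v + s y * (y.1 v - (barycenter hσ).1 v)
  have hΦσ : ∀ y, ∀ v ∈ σ, Φ y v = κ - s y * (κ - y.1 v) := fun y v hv => by
    simp only [Φ, barycenter_of_mem hσ hv, ← hκ]; ring
  have hΦn : ∀ y, ∀ v ∉ σ, Φ y v = s y * y.1 v := fun y v hv => by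
    simp only [Φ, barycenter_of_notMem hσ hv]; ring
  have hge : ∀ y ∈ K.starNhd σ \ {barycenter hσ}, ∀ v ∈ σ, κ / 2 ≤ Φ y v := by
    intro y hy v hv
    rw [hΦσ y v hv]
    have h1 : s y * (κ - y.1 v) ≤ s y * (κ - m y) :=
      mul_le_mul_of_nonneg_left (by linarith [hmv y v hv]) (by linarith [hs1 y hy])
    linarith [hsm y hy]
  have hsupp : ∀ y ∈ K.starNhd σ \ {barycenter hσ}, ∀ v, y.1 v = 0 → Φ y v = 0 := by
    intro y hy v hv
    have hvσ : v ∉ σ := fun h => (pos_of_mem_starNhd hy.1 h).ne' hv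
    rw [hΦn y v hvσ, hv, mul_zero]
  have hmem : ∀ y ∈ K.starNhd σ \ {barycenter hσ}, Φ y ∈ K.realization := by
    intro y hy
    refine mem_realization_of_support (y := y) (fun v => ?_) (hsupp y hy) fun τ hτ hsum => ?_
    · by_cases hv : v ∈ σ
      · exact (by positivity : (0 : ℝ) ≤ κ / 2).trans (hge y hy v hv)
      · rw [hΦn y v hv]
        exact mul_nonneg (by linarith [hs1 y hy]) (y.2.1 v)
    · have hb : ∑ v ∈ τ, (barycenter hσ).1 v = 1 := by
        refine sum_eq_one_of_subset fun v hv => ?_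
        have hvσ : v ∈ σ := by_contra fun h => hv (barycenter_of_notMem hσ h)
        exact (hτ v).2 (pos_of_mem_starNhd hy.1 hvσ).ne'
      simp only [Φ]
      rw [Finset.sum_add_distrib, ← Finset.mul_sum, Finset.sum_sub_distrib, hsum, hb]
      ring
  have hcont : ContinuousOn Φ (K.starNhd σ \ {barycenter hσ}) := by
    have hs : ContinuousOn s (K.starNhd σ \ {barycenter hσ}) :=
      continuousOn_const.div (continuousOn_const.sub hm.continuousOn)
        fun y hy => (sub_pos.2 (hmx y hy)).ne'
    refine continuousOn_pi.2 fun v => ?_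
    exact continuousOn_const.add (hs.mul ((continuous_coord v).continuousOn.sub continuousOn_const))
  obtain ⟨r, hr, hrΦ⟩ := exists_continuousOn_lift hcont hmem (barycenter hσ)
  refine ⟨r, hr, fun y hy => ⟨⟨fun v hv => ?_, ?_⟩, fun v hv => ?_, fun hyL => ?_⟩⟩
  · rw [hrΦ y hy, hc]; exact hge y hy v hv
  · obtain ⟨v, hv, he⟩ := hma y
    refine ⟨v, hv, ?_⟩
    rw [hrΦ y hy, hΦσ y v hv, ← he, hsm y hy, hc]
    ring
  · rw [hrΦ y hy]; exact hsupp y hy v hv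
  · obtain ⟨v, hv, he⟩ := hyL.2
    have hmy : m y = κ / 2 := le_antisymm ((hmv y v hv).trans (by rw [he, hc])) (hmC y hy.1)
    have hsy : s y = 1 := by
      have := hsm y hy
      rw [hmy] at this
      have h2 : κ - κ / 2 = κ / 2 := by ring
      rw [h2] at this
      exact mul_right_cancel₀ (by positivity : κ / 2 ≠ 0) (this.trans (one_mul _).symm)
    apply Subtype.ext
    rw [hrΦ y hy]
    ext v
    simp only [Φ, hsy]
    ring

/-- If the barycenter of `σ` is not interior to a union `C` of pieces of the star neighbourhood,
then nonvanishing maps extend from the frontier part of `C` to `C`. -/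
theorem exists_extension_of_barycenter_notMem_interior {σ : Finset V} (hσ : σ ∈ K.faces)
    (hfin : K.faces.Finite) (hK : IsPuncturedEuclidean K.realization) {C : Set K.realization}
    (hC : IsClosed C) (hCσ : C ⊆ K.starNhd σ) {z : K.realization} (hz : z ∉ C)
    (hCs : ∀ y ∈ C, ∀ y' ∈ K.starNhd σ, (∀ v, y.1 v = 0 → y'.1 v = 0) → y' ∈ C)
    (hxC : barycenter hσ ∈ C) (hx : barycenter hσ ∉ interior C) {f : K.realization → Euc3}
    (hf : ContinuousOn f (C ∩ K.starBdry σ)) (hf0 : ∀ y ∈ C ∩ K.starBdry σ, f y ≠ 0) :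
    ∃ g : K.realization → Euc3, ContinuousOn g C ∧ (∀ y ∈ C, g y ≠ 0) ∧
      ∀ y ∈ C ∩ K.starBdry σ, g y = f y := by
  have : CompactSpace K.realization := isCompact_iff_compactSpace.1 (isCompact_realization hfin)
  obtain ⟨j, hj, -⟩ := hK z
  obtain ⟨r, hr, hrp⟩ := exists_radial_retraction hσ
  have hsub : C \ {barycenter hσ} ⊆ K.starNhd σ \ {barycenter hσ} := sdiff_subset_sdiff_left hCσ
  have hmaps : ∀ y ∈ C \ {barycenter hσ}, r y ∈ C ∩ K.starBdry σ := fun y hy =>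
    ⟨hCs y hy.1 _ (hrp y (hsub hy)).1.1 (hrp y (hsub hy)).2.1, (hrp y (hsub hy)).1⟩
  have hL : IsClosed (C ∩ K.starBdry σ) := hC.inter (isClosed_starBdry σ)
  -- Composed with the radial retraction, `f` becomes a nonvanishing map on `C` minus the
  -- barycenter. The retraction preserves `C` because it does not enlarge supports.
  obtain ⟨g, hg, hg0, hgL⟩ := exists_extension_of_notMem_interior_chart hj hC.isCompact hz hxC hx
    inter_subset_left hL.isCompact (fun h => (barycenter_mem_starNhd_diff hσ).2 h.2)
    (f := fun y => f (r y)) (hf.comp (hr.mono hsub) hmaps) fun y hy => hf0 _ (hmaps y hy)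
  refine ⟨g, hg, hg0, fun y hy => ?_⟩
  rw [hgL y hy]
  have hyx : y ≠ barycenter hσ := fun h => (barycenter_mem_starNhd_diff hσ).2 (h ▸ hy.2)
  rw [(hrp y (hsub ⟨hy.1, hyx⟩)).2.2 hy.2]

end PreAbstractSimplicialComplex

/-! ### Points near a barycenter, and thin pieces of the realization -/

namespace PreAbstractSimplicialComplex

variable {V : Type*} {K : PreAbstractSimplicialComplex V}

theorem singleton_mem_faces {σ : Finset V} (hσ : σ ∈ K.faces) {v : V} (hv : v ∈ σ) :
    {v} ∈ K.faces :=
  mem_faces_of_subset hσ (Finset.singleton_subset_iff.2 hv) (Finset.singleton_nonempty v)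

/-- This supplies the point to be removed for a chart around the star. Were there none, the
coordinates in `σ` would be positive at every vertex of `K`, so `K` would have just one vertex. -/
theorem exists_notMem_starNhd [Nontrivial K.realization] {σ : Finset V} (hσ : σ ∈ K.faces) :
    ∃ z, z ∉ K.starNhd σ := by
  by_contra! hall
  have hvert : ∀ u, {u} ∈ K.faces → ∀ v ∈ σ, v = u := by
    intro u hu v hv
    by_contra hne
    have := pos_of_mem_starNhd (hall (barycenter hu)) hv
    rw [barycenter_of_notMem hu (by simpa using hne)] at this
    exact lt_irrefl _ this
  obtain ⟨y, hy⟩ := exists_ne (barycenter hσ)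
  obtain ⟨τ, hτ, hs, hsum⟩ := exists_support y
  refine hy (eq_barycenter hσ fun v hv => ?_)
  have hτv : τ = {v} := Finset.eq_singleton_iff_nonempty_unique_mem.2
    ⟨nonempty_of_mem_faces hτ, fun u hu => (hvert u (singleton_mem_faces hτ hu) v hv).symm⟩
  rw [hτv, Finset.sum_singleton] at hsum
  rw [hsum]
  exact inv_le_one_of_one_le₀ (Nat.one_le_cast.2 (Finset.card_pos.2 ⟨v, hv⟩))

/-- Arbitrarily close to the barycenter of a face `σ` there are interior points of each face that
contains `σ`. -/
theorem exists_mem_of_barycenter_mem_interior {σ ρ : Finset V} (hσ : σ ∈ K.faces) (hρ : ρ ∈ K.faces)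
    (h : σ ⊆ ρ) {C : Set K.realization} (hx : barycenter hσ ∈ interior C) :
    ∃ y ∈ C, ∀ v, v ∈ ρ ↔ y.1 v ≠ 0 := by
  classical
  have hk : (0 : ℝ) < ρ.card := Nat.cast_pos.2 (nonempty_of_mem_faces hρ).card_pos
  let Φ : ℝ → V → ℝ := fun s v => (1 - s) * (barycenter hσ).1 v + s * (barycenter hρ).1 v
  have hoff : ∀ s, ∀ v ∉ ρ, Φ s v = 0 := fun s v hv => by
    simp only [Φ, barycenter_of_notMem hρ hv, barycenter_of_notMem hσ fun h' => hv (h h')]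
    ring
  have hΦ : ∀ s ∈ Icc (0 : ℝ) 1, Φ s ∈ K.realization := by
    intro s hs
    refine ⟨fun v => add_nonneg (mul_nonneg (by linarith [hs.2]) ((barycenter hσ).2.1 v))
      (mul_nonneg hs.1 ((barycenter hρ).2.1 v)), ρ, hρ, hoff s, ?_⟩
    have h1 : ∑ v ∈ ρ, (barycenter hσ).1 v = 1 := sum_eq_one_of_subset fun v hv =>
      h (by_contra fun hv' => hv (barycenter_of_notMem hσ hv'))
    have h2 : ∑ v ∈ ρ, (barycenter hρ).1 v = 1 := sum_eq_one_of_subset fun v hv =>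
      (by_contra fun hv' => hv (barycenter_of_notMem hρ hv'))
    simp only [Φ]
    rw [Finset.sum_add_distrib, ← Finset.mul_sum, ← Finset.mul_sum, h1, h2]
    ring
  obtain ⟨r, hr, hrΦ⟩ := exists_continuousOn_lift (S := Icc (0 : ℝ) 1) (Φ := Φ)
    (continuousOn_pi.2 fun v => by fun_prop) hΦ (barycenter hσ)
  have hr0 : r 0 = barycenter hσ := by
    apply Subtype.ext
    rw [hrΦ 0 (by simp)]
    ext v
    simp [Φ]
  have hev : ∀ᶠ s in 𝓝[Icc (0 : ℝ) 1] 0, r s ∈ C := by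
    have := hr 0 (by simp)
    refine this.eventually_mem ?_
    rw [hr0]
    exact mem_interior_iff_mem_nhds.1 hx
  have hev' : ∀ᶠ s in 𝓝[>] (0 : ℝ), r s ∈ C ∧ s ∈ Ioc (0 : ℝ) 1 := by
    have h1 : 𝓝[Ioc (0 : ℝ) 1] 0 = 𝓝[>] 0 := nhdsWithin_Ioc_eq_nhdsGT one_pos
    rw [← h1]
    exact (hev.filter_mono (nhdsWithin_mono _ Ioc_subset_Icc_self)).and self_mem_nhdsWithin
  obtain ⟨s, hsC, hs⟩ := hev'.exists
  refine ⟨r s, hsC, fun v => ?_⟩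
  rw [hrΦ s ⟨hs.1.le, hs.2⟩]
  constructor
  · intro hv
    have h1 : 0 < s * (barycenter hρ).1 v := by
      rw [barycenter_of_mem hρ hv]
      exact mul_pos hs.1 (inv_pos.2 hk)
    exact (add_pos_of_nonneg_of_pos
      (mul_nonneg (by linarith [hs.2]) ((barycenter hσ).2.1 v)) h1).ne'
  · exact fun hv => by_contra fun hv' => hv (hoff s v hv')

/-- The barycentric coordinates on a triangle depend smoothly on two of them. -/
theorem exists_contDiff_coord {σ : Finset V} {a b d : V} (hd : d ∈ σ)
    (hσ : ∀ v ∈ σ, v ≠ d → v = a ∨ v = b) (v : V) :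
    ∃ k : ℝ × ℝ → ℝ, ContDiff ℝ 1 k ∧ ∀ y : K.realization, (∀ u ∉ σ, y.1 u = 0) →
      y.1 v = k (y.1 a, y.1 b) := by
  classical
  let ℓ : V → ℝ × ℝ → ℝ := fun u q => if u = a then q.1 else q.2
  have hℓ : ∀ u, ContDiff ℝ 1 (ℓ u) := fun u => by
    by_cases h : u = a
    · simpa [ℓ, h] using contDiff_fst
    · simpa [ℓ, h] using contDiff_snd
  have hℓy : ∀ u ∈ σ, u ≠ d → ∀ y : K.realization, y.1 u = ℓ u (y.1 a, y.1 b) := by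
    intro u hu hud y
    by_cases h : u = a
    · simp [ℓ, h]
    · have hub := (hσ u hu hud).resolve_left h
      simp only [ℓ, if_neg h, ← hub]
  by_cases hv : v ∈ σ
  · by_cases hvd : v = d
    · refine ⟨fun q => 1 - ∑ u ∈ σ.erase d, ℓ u q, contDiff_const.sub
        (ContDiff.sum fun u _ => hℓ u), fun y hy => ?_⟩
      have hsum : ∑ u ∈ σ, y.1 u = 1 :=
        sum_eq_one_of_subset fun u hu => by_contra fun h => hu (hy u h)
      rw [← Finset.add_sum_erase _ _ hd] at hsum
      dsimp only
      rw [hvd, Finset.sum_congr rfl fun u hu =>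
        (hℓy u (Finset.mem_of_mem_erase hu) (Finset.ne_of_mem_erase hu) y).symm]
      linarith
    · exact ⟨ℓ v, hℓ v, fun y _ => hℓy v hv hvd y⟩
  · exact ⟨fun _ => 0, contDiff_const, fun y hy => hy v hv⟩

/-- A point of a triangle is determined by two of its barycentric coordinates. -/
theorem isThin_of_card_le_three {σ : Finset V} (hσ : σ.Nonempty) (hcard : σ.card ≤ 3)
    {X : Set K.realization} (hX : IsCompact X) (hXσ : ∀ y ∈ X, ∀ v ∉ σ, y.1 v = 0) : IsThin X := by
  classical
  obtain ⟨d, hd⟩ := hσ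
  have hab : ∃ a b, ∀ v ∈ σ, v ≠ d → v = a ∨ v = b := by
    have h2 : (σ.erase d).card ≤ 2 := by rw [Finset.card_erase_of_mem hd]; omega
    obtain ⟨a, b, hab⟩ : ∃ a b, σ.erase d ⊆ {a, b} := by
      rcases Nat.lt_or_ge (σ.erase d).card 2 with h | h
      · rcases Finset.eq_empty_or_nonempty (σ.erase d) with h0 | ⟨a, ha⟩
        · exact ⟨d, d, by simp [h0]⟩
        · have h0 : 0 < (σ.erase d).card := Finset.card_pos.2 ⟨a, ha⟩
          obtain ⟨e, he⟩ := Finset.card_eq_one.1 (by omega : (σ.erase d).card = 1)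
          exact ⟨e, e, by simp [he]⟩
      · obtain ⟨a, b, -, hab⟩ := Finset.card_eq_two.1 (le_antisymm h2 h)
        exact ⟨a, b, hab.le⟩
    exact ⟨a, b, fun v hv hvd => by simpa using hab (Finset.mem_erase.2 ⟨hvd, hv⟩)⟩
  obtain ⟨a, b, hab⟩ := hab
  refine isThin_of_separating hX (fun _ : Unit => {y | ∀ v ∉ σ, y.1 v = 0})
    (fun _ y => (y.1 a, y.1 b)) (fun y hy => mem_iUnion.2 ⟨(), hXσ y hy⟩) fun x y hxy => ?_
  obtain ⟨v, hv⟩ := Function.ne_iff.1 fun h => hxy (Subtype.ext h)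
  obtain ⟨k, hk, hk'⟩ := exists_contDiff_coord (K := K) hd hab v
  exact ⟨fun y => y.1 v, continuous_coord v, hv, fun _ => ⟨k, hk, hk'⟩⟩

/-- One barycentric coordinate on an edge and the parameter of the interval make up the two
coordinates. -/
theorem isThin_prod_of_card_le_two (hfin : K.faces.Finite) {X : Set K.realization}
    (hX : IsCompact X) (hX2 : ∀ y ∈ X, ∃ σ ∈ K.faces, σ.card ≤ 2 ∧ ∀ v ∉ σ, y.1 v = 0) :
    IsThin (X ×ˢ (univ : Set unitInterval)) := by
  classical
  let ι := {σ : Finset V // σ ∈ K.faces ∧ σ.card ≤ 2}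
  have : Finite ι := (hfin.subset fun σ (hσ : σ ∈ K.faces ∧ σ.card ≤ 2) => hσ.1).to_subtype
  have hda : ∀ i : ι, ∃ d a, d ∈ i.1 ∧ ∀ v ∈ i.1, v ≠ d → v = a ∨ v = a := by
    rintro ⟨σ, hσ, h2⟩
    obtain ⟨d, hd⟩ := nonempty_of_mem_faces hσ
    have h1 : (σ.erase d).card ≤ 1 := by rw [Finset.card_erase_of_mem hd]; omega
    rcases Finset.eq_empty_or_nonempty (σ.erase d) with h0 | ⟨a, ha⟩
    · refine ⟨d, d, hd, fun v hv hvd => ?_⟩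
      have := Finset.mem_erase.2 ⟨hvd, hv⟩
      simp [h0] at this
    · refine ⟨d, a, hd, fun v hv hvd => Or.inl ?_⟩
      exact Finset.card_le_one.1 h1 v (Finset.mem_erase.2 ⟨hvd, hv⟩) a ha
  choose d a hd ha using hda
  refine isThin_of_separating (hX.prod isCompact_univ)
    (fun i : ι => {q : K.realization × unitInterval | ∀ v ∉ i.1, q.1.1 v = 0})
    (fun i q => (q.1.1 (a i), (q.2 : ℝ))) (fun q hq => ?_) fun x y hxy => ?_
  · obtain ⟨σ, hσ, h2, h⟩ := hX2 q.1 hq.1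
    exact mem_iUnion.2 ⟨⟨σ, hσ, h2⟩, h⟩
  · by_cases h1 : x.1 = y.1
    · have h2 : (x.2 : ℝ) ≠ y.2 := fun h => hxy (Prod.ext h1 (Subtype.ext h))
      exact ⟨fun q => q.2, by fun_prop, h2, fun i => ⟨Prod.snd, contDiff_snd, fun z _ => rfl⟩⟩
    · obtain ⟨v, hv⟩ := Function.ne_iff.1 fun h => h1 (Subtype.ext h)
      refine ⟨fun q => q.1.1 v, (continuous_coord v).comp continuous_fst, hv, fun i => ?_⟩
      obtain ⟨k, hk, hk'⟩ := exists_contDiff_coord (K := K) (hd i) (ha i) v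
      refine ⟨fun u => k (u.1, u.1), hk.comp (contDiff_fst.prodMk contDiff_fst), fun z hz => ?_⟩
      exact hk' z.1 hz

/-! ### Purity and links of triangles -/

/-- The maximal faces have at least four vertices. -/
theorem four_le_card_of_maximal (hfin : K.faces.Finite)
    (hK : IsPuncturedEuclidean K.realization) [Nontrivial K.realization] {σ : Finset V} (hσ : σ ∈ K.faces)
    (hmax : ∀ τ ∈ K.faces, σ ⊆ τ → τ = σ) : 4 ≤ σ.card := by
  by_contra! hcard
  have : CompactSpace K.realization := isCompact_iff_compactSpace.1 (isCompact_realization hfin)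
  obtain ⟨z, hz⟩ := exists_notMem_starNhd hσ
  obtain ⟨j, hj, -⟩ := hK z
  have hCs : K.starNhd σ ⊆ j.source := fun y hy => by
    rw [hj]; exact fun h => hz (mem_singleton_iff.1 h ▸ hy)
  have hx := barycenter_mem_starNhd_diff hσ
  -- The star of a maximal face is the face itself. If that has dimension at most two, the
  -- translation extends from the frontier without zeros, although the barycenter is interior.
  have hthin : IsThin (K.starNhd σ) := by
    refine isThin_of_card_le_three (nonempty_of_mem_faces hσ) (by omega)
      (isClosed_starNhd σ).isCompact fun y hy v hv => ?_
    obtain ⟨τ, hτ, hs, -⟩ := exists_support y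
    have := hmax τ hτ fun u hu => (hs u).2 (pos_of_mem_starNhd hy hu).ne'
    exact not_not.1 fun h => hv (this ▸ (hs v).2 h)
  have hLC : K.starBdry σ ⊆ K.starNhd σ := fun y hy => hy.1
  obtain ⟨F, hF, hFL, hF0⟩ := hthin.exists_extension (isClosed_starBdry σ).isCompact
    (isClosed_starBdry σ) (f := fun y => j y - j (barycenter hσ))
    ((j.continuousOn.mono (hLC.trans hCs)).sub continuousOn_const)
    (fun y hy h => hx.2 (j.injOn (hCs hy.1) (hCs hx.1) (sub_eq_zero.1 h) ▸ hy))
  obtain ⟨y, hy, hy0⟩ := exists_eq_zero_of_eqOn_chart hj (isClosed_starNhd σ).isCompact hz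
    (isOpen_starNhd_diff σ) hx hF.continuousOn fun y _ hyL => hFL hyL
  exact hF0 y hy hy0

/-- No face is contained in exactly one larger face that has one more vertex. -/
theorem exists_ne_insert [DecidableEq V] (hfin : K.faces.Finite)
    (hK : IsPuncturedEuclidean K.realization) [Nontrivial K.realization] {t : Finset V} (ht : t ∈ K.faces) {a : V} (ha : a ∉ t)
    (hat : insert a t ∈ K.faces) : ∃ ρ ∈ K.faces, t ⊆ ρ ∧ ρ ≠ t ∧ ρ ≠ insert a t := by
  by_contra! hall
  have : CompactSpace K.realization := isCompact_iff_compactSpace.1 (isCompact_realization hfin)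
  obtain ⟨z, hz⟩ := exists_notMem_starNhd ht
  obtain ⟨j, hj, -⟩ := hK z
  have hCs : K.starNhd t ⊆ j.source := fun y hy => by
    rw [hj]; exact fun h => hz (mem_singleton_iff.1 h ▸ hy)
  have hx := barycenter_mem_starNhd_diff ht
  have hne := nonempty_of_mem_faces ht
  have hoff : ∀ y ∈ K.starNhd t, ∀ v ∉ insert a t, y.1 v = 0 := by
    intro y hy v hv
    obtain ⟨τ, hτ, hs, -⟩ := exists_support y
    by_contra h
    have hvτ := (hs v).2 h
    have hτt : τ ≠ t := fun he => hv (Finset.mem_insert_of_mem (he ▸ hvτ))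
    have := hall τ hτ (fun u hu => (hs u).2 (pos_of_mem_starNhd hy hu).ne') hτt
    exact hv (this ▸ hvτ)
  let c : ℝ := (2 * t.card : ℝ)⁻¹
  let m : K.realization → ℝ := fun y => t.inf' hne fun v => y.1 v
  have hm : Continuous m := Continuous.finset_inf'_apply hne fun v _ => continuous_coord v
  have hmC : ∀ y ∈ K.starNhd t, c ≤ m y := fun y hy => Finset.le_inf' hne _ fun v hv => hy v hv
  have hmv : ∀ y : K.realization, ∀ v ∈ t, m y ≤ y.1 v := fun y v hv => Finset.inf'_le _ hv
  -- With a single coface, the star is a half-ball with `t` on its flat side. Moving weight evenly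
  -- from the vertices of `t` to `a` retracts it onto the frontier, and this retraction extends the
  -- translation without zeros.
  let Φ : K.realization → V → ℝ := fun y v =>
    if v ∈ t then y.1 v - (m y - c) else if v = a then y.1 v + t.card * (m y - c) else y.1 v
  have hΦt : ∀ y, ∀ v ∈ t, Φ y v = y.1 v - (m y - c) := fun y v hv => by simp [Φ, hv]
  have hΦa : ∀ y, Φ y a = y.1 a + t.card * (m y - c) := fun y => by simp [Φ, ha]
  have hΦn : ∀ y, ∀ v ∉ insert a t, Φ y v = y.1 v := fun y v hv => by
    rw [Finset.mem_insert, not_or] at hv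
    simp [Φ, hv.1, hv.2]
  have hc0 : 0 ≤ c := by positivity
  have hge : ∀ y, ∀ v ∈ t, c ≤ Φ y v := fun y v hv => by
    rw [hΦt y v hv]; linarith [hmv y v hv]
  have hmem : ∀ y ∈ K.starNhd t, Φ y ∈ K.realization := by
    intro y hy
    refine ⟨fun v => ?_, insert a t, hat, fun v hv => by rw [hΦn y v hv, hoff y hy v hv], ?_⟩
    · by_cases hv : v ∈ t
      · exact hc0.trans (hge y v hv)
      · by_cases hva : v = a
        · rw [hva, hΦa]
          exact add_nonneg (y.2.1 a) (mul_nonneg (Nat.cast_nonneg _) (by linarith [hmC y hy]))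
        · rw [hΦn y v (by simp [hv, hva])]; exact y.2.1 v
    · have h1 : ∑ v ∈ insert a t, y.1 v = 1 :=
        sum_eq_one_of_subset fun v hv => by_contra fun h => hv (hoff y hy v h)
      rw [Finset.sum_insert ha] at h1 ⊢
      rw [hΦa, Finset.sum_congr rfl (hΦt y), Finset.sum_sub_distrib, Finset.sum_const,
        nsmul_eq_mul]
      linarith
  have hcont : ContinuousOn Φ (K.starNhd t) := by
    refine continuousOn_pi.2 fun v => Continuous.continuousOn ?_
    have := continuous_coord (K := K) v
    by_cases hv : v ∈ t
    · simp only [Φ, hv, if_true]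
      exact this.sub (hm.sub continuous_const)
    · by_cases hva : v = a
      · subst hva
        simp only [Φ, hv, if_false, if_true]
        exact this.add (continuous_const.mul (hm.sub continuous_const))
      · simpa only [Φ, hv, hva, if_false] using this
  obtain ⟨r, hr, hrΦ⟩ := exists_continuousOn_lift hcont hmem z
  have hrL : ∀ y ∈ K.starNhd t, r y ∈ K.starBdry t := by
    intro y hy
    obtain ⟨v, hv, he⟩ := Finset.exists_mem_eq_inf' hne fun v => y.1 v
    refine ⟨fun v hv => by rw [hrΦ y hy]; exact hge y v hv, v, hv, ?_⟩
    have he' : m y = y.1 v := he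
    rw [hrΦ y hy, hΦt y v hv, he']
    ring
  have hrid : ∀ y ∈ K.starBdry t, r y = y := by
    intro y hy
    obtain ⟨v, hv, he⟩ := hy.2
    have hmy : m y = c := le_antisymm ((hmv y v hv).trans he.le) (hmC y hy.1)
    apply Subtype.ext
    rw [hrΦ y hy.1]
    ext v
    simp [Φ, hmy]
  obtain ⟨y, hy, hy0⟩ := exists_eq_zero_of_eqOn_chart hj (isClosed_starNhd t).isCompact hz
    (isOpen_starNhd_diff t) hx (g := fun y => j (r y) - j (barycenter ht))
    (((j.continuousOn.mono hCs).comp hr fun y hy => (hrL y hy).1).sub continuousOn_const)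
    fun y _ hyL => by simp only [hrid y hyL]
  have := j.injOn (hCs (hrL y hy).1) (hCs hx.1) (sub_eq_zero.1 hy0)
  exact hx.2 (this ▸ hrL y hy)

/-- At most two faces properly contain a triangle that lies in two tetrahedra. -/
theorem eq_of_triangle_subset [DecidableEq V] (hfin : K.faces.Finite)
    (hK : IsPuncturedEuclidean K.realization) [Nontrivial K.realization] {t : Finset V} (ht : t ∈ K.faces) (ht3 : t.card = 3)
    {a b : V} (ha : a ∉ t) (hb : b ∉ t) (hab : a ≠ b) (hat : insert a t ∈ K.faces)
    (hbt : insert b t ∈ K.faces) {ρ : Finset V} (hρ : ρ ∈ K.faces) (htρ : t ⊆ ρ) (hρt : ρ ≠ t) :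
    ρ = insert a t ∨ ρ = insert b t := by
  by_contra! hρab
  have : CompactSpace K.realization := isCompact_iff_compactSpace.1 (isCompact_realization hfin)
  obtain ⟨z, hz⟩ := exists_notMem_starNhd ht
  obtain ⟨p, q, r, hpq, hpr, hqr, hpqr⟩ := Finset.card_eq_three.1 ht3
  have hpt : p ∈ t := by simp [hpqr]
  have hqt : q ∈ t := by simp [hpqr]
  have hrt : r ∈ t := by simp [hpqr]
  have hap : a ≠ p := fun h => ha (h ▸ hpt)
  have haq : a ≠ q := fun h => ha (h ▸ hqt)
  have har : a ≠ r := fun h => ha (h ▸ hrt)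
  have hbp : b ≠ p := fun h => hb (h ▸ hpt)
  have hbq : b ≠ q := fun h => hb (h ▸ hqt)
  have hbr : b ≠ r := fun h => hb (h ▸ hrt)
  have hk : (2 * t.card : ℝ)⁻¹ = 1 / 6 := by rw [ht3]; norm_num
  -- The part of the star in the two given tetrahedra. A further coface has points near the
  -- barycenter outside `C`, so the barycenter is not interior and nonvanishing maps extend over
  -- `C`. Yet `C` contains the image of a double pyramid in three-space, where the extension of `f`
  -- is excluded.
  let C : Set K.realization := {y | y ∈ K.starNhd t ∧
    ((∀ v ∉ insert a t, y.1 v = 0) ∨ ∀ v ∉ insert b t, y.1 v = 0)}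
  have hsupp : ∀ s : Finset V, IsClosed {y : K.realization | ∀ v ∉ s, y.1 v = 0} := fun s =>
    isClosed_setOf_forall fun v => isClosed_setOf_forall fun _ =>
      isClosed_eq (continuous_coord v) continuous_const
  have hC : IsClosed C := (isClosed_starNhd t).inter ((hsupp _).union (hsupp _))
  have hxC : barycenter ht ∈ C := ⟨(barycenter_mem_starNhd_diff ht).1, Or.inl fun v hv =>
    barycenter_of_notMem ht fun h => hv (Finset.mem_insert_of_mem h)⟩
  have hx : barycenter ht ∉ interior C := by
    intro hx
    obtain ⟨y, hyC, hs⟩ := exists_mem_of_barycenter_mem_interior ht hρ htρ hx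
    have key : ∀ d, (∀ v ∉ insert d t, y.1 v = 0) → ρ = insert d t := by
      intro d h
      have h1 : ρ ⊆ insert d t := fun v hv => by_contra fun h' => (hs v).1 hv (h v h')
      refine h1.antisymm (Finset.insert_subset ?_ htρ)
      by_contra hd
      refine hρt (Finset.Subset.antisymm (fun v hv => ?_) htρ)
      exact (Finset.mem_insert.1 (h1 hv)).resolve_left fun h => hd (h ▸ hv)
    exact hyC.2.elim (fun h => hρab.1 (key a h)) fun h => hρab.2 (key b h)
  let f : K.realization → Euc3 := fun y => !₂[y.1 p, y.1 q, y.1 a - y.1 b] - !₂[1 / 3, 1 / 3, 0]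
  have hf : Continuous f := by
    refine Continuous.sub ?_ continuous_const
    refine (PiLp.continuous_toLp 2 _).comp (continuous_pi fun i => ?_)
    fin_cases i
    exacts [continuous_coord p, continuous_coord q, (continuous_coord a).sub (continuous_coord b)]
  obtain ⟨g, hg, hg0, hgL⟩ := exists_extension_of_barycenter_notMem_interior ht hfin hK hC
    (fun y hy => hy.1) (fun h => hz h.1)
    (fun y hy y' hy' hyy' => ⟨hy', hy.2.imp (fun h v hv => hyy' v (h v hv))
      fun h v hv => hyy' v (h v hv)⟩) hxC hx hf.continuousOn (by
      rintro y ⟨hyC, hyL⟩ h0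
      have e0 : y.1 p = 1 / 3 := sub_eq_zero.1 (congrArg (fun w : Euc3 => w 0) h0)
      have e1 : y.1 q = 1 / 3 := sub_eq_zero.1 (congrArg (fun w : Euc3 => w 1) h0)
      have e2 : y.1 a - y.1 b = 0 := sub_eq_zero.1 (congrArg (fun w : Euc3 => w 2) h0)
      have hboth : y.1 a = 0 ∧ ∀ v ∉ t, y.1 v = 0 := by
        rcases hyC.2 with h | h
        · have hb0 : y.1 b = 0 := h b (by simp [hb, hab.symm])
          have ha0 : y.1 a = 0 := by linarith
          refine ⟨ha0, fun v hv => ?_⟩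
          by_cases hva : v = a
          · rw [hva, ha0]
          · exact h v (by simp [hv, hva])
        · have ha0 : y.1 a = 0 := h a (by simp [ha, hab])
          have hb0 : y.1 b = 0 := by linarith
          refine ⟨ha0, fun v hv => ?_⟩
          by_cases hvb : v = b
          · rw [hvb, hb0]
          · exact h v (by simp [hv, hvb])
      have hsum : ∑ v ∈ t, y.1 v = 1 :=
        sum_eq_one_of_subset fun v hv => by_contra fun h => hv (hboth.2 v h)
      rw [hpqr, Finset.sum_insert (by simp [hpq, hpr]), Finset.sum_insert (by simp [hqr]),
        Finset.sum_singleton] at hsum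
      obtain ⟨v, hv, he⟩ := hyL.2
      rw [hk] at he
      rw [hpqr] at hv
      simp only [Finset.mem_insert, Finset.mem_singleton] at hv
      rcases hv with rfl | rfl | rfl <;> linarith)
  -- The parametrization undone by `f`, up to translation by the barycenter: the sign of `w 2`
  -- selects the tetrahedron, and the coordinate at `r` makes the sum equal to one.
  let Ψ : Euc3 → V → ℝ := fun w v => if v = p then w 0 else if v = q then w 1 else
    if v = r then 1 - w 0 - w 1 - |w 2| else if v = a then max (w 2) 0 else
    if v = b then max (-w 2) 0 else 0
  have Ψp : ∀ w, Ψ w p = w 0 := fun w => by simp [Ψ]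
  have Ψq : ∀ w, Ψ w q = w 1 := fun w => by simp [Ψ, hpq.symm]
  have Ψr : ∀ w, Ψ w r = 1 - w 0 - w 1 - |w 2| := fun w => by simp [Ψ, hpr.symm, hqr.symm]
  have Ψa : ∀ w, Ψ w a = max (w 2) 0 := fun w => by simp [Ψ, hap, haq, har]
  have Ψb : ∀ w, Ψ w b = max (-w 2) 0 := fun w => by simp [Ψ, hbp, hbq, hbr, hab.symm]
  have Ψn : ∀ w, ∀ v ∉ t, v ≠ a → v ≠ b → Ψ w v = 0 := fun w v hv hva hvb => by
    rw [hpqr] at hv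
    simp only [Finset.mem_insert, Finset.mem_singleton, not_or] at hv
    simp [Ψ, hv, hva, hvb]
  have hΨc : Continuous Ψ := by
    refine continuous_pi fun v => ?_
    simp only [Ψ]
    split_ifs <;> fun_prop
  let D : Set Euc3 := {w | 1 / 6 ≤ w 0 ∧ 1 / 6 ≤ w 1 ∧ 1 / 6 ≤ 1 - w 0 - w 1 - |w 2|}
  let L : Set Euc3 := {w | w 0 = 1 / 6 ∨ w 1 = 1 / 6 ∨ 1 - w 0 - w 1 - |w 2| = 1 / 6}
  have hside : ∀ w, (∀ v ∉ insert a t, Ψ w v = 0) ∨ ∀ v ∉ insert b t, Ψ w v = 0 := by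
    intro w
    rcases le_total 0 (w 2) with h | h
    · left
      intro v hv
      rw [Finset.mem_insert, not_or] at hv
      by_cases hvb : v = b
      · rw [hvb, Ψb]; exact max_eq_right (by linarith)
      · exact Ψn w v hv.2 hv.1 hvb
    · right
      intro v hv
      rw [Finset.mem_insert, not_or] at hv
      by_cases hva : v = a
      · rw [hva, Ψa]; exact max_eq_right h
      · exact Ψn w v hv.2 hva hv.1
  have hΨt : ∀ w, ∑ v ∈ t, Ψ w v = 1 - |w 2| := by
    intro w
    rw [hpqr, Finset.sum_insert (by simp [hpq, hpr]), Finset.sum_insert (by simp [hqr]),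
      Finset.sum_singleton, Ψp, Ψq, Ψr]
    ring
  have hΨD : ∀ w ∈ D, ∀ v ∈ t, 1 / 6 ≤ Ψ w v := by
    rintro w ⟨h0, h1, h2⟩ v hv
    rw [hpqr] at hv
    simp only [Finset.mem_insert, Finset.mem_singleton] at hv
    rcases hv with rfl | rfl | rfl
    · rwa [Ψp]
    · rwa [Ψq]
    · rwa [Ψr]
  have hΨmem : ∀ w ∈ D, Ψ w ∈ K.realization := by
    intro w hw
    have h0 : ∀ v, 0 ≤ Ψ w v := by
      intro v
      by_cases hv : v ∈ t
      · linarith [hΨD w hw v hv]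
      · by_cases hva : v = a
        · rw [hva, Ψa]; exact le_max_right _ _
        · by_cases hvb : v = b
          · rw [hvb, Ψb]; exact le_max_right _ _
          · rw [Ψn w v hv hva hvb]
    refine ⟨h0, ?_⟩
    rcases le_total 0 (w 2) with h | h
    · refine ⟨insert a t, hat, fun v hv => ?_, ?_⟩
      · rw [Finset.mem_insert, not_or] at hv
        by_cases hvb : v = b
        · rw [hvb, Ψb]; exact max_eq_right (by linarith)
        · exact Ψn w v hv.2 hv.1 hvb
      · rw [Finset.sum_insert ha, hΨt, Ψa, max_eq_left h, abs_of_nonneg h]; ring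
    · refine ⟨insert b t, hbt, fun v hv => ?_, ?_⟩
      · rw [Finset.mem_insert, not_or] at hv
        by_cases hva : v = a
        · rw [hva, Ψa]; exact max_eq_right h
        · exact Ψn w v hv.2 hva hv.1
      · rw [Finset.sum_insert hb, hΨt, Ψb, max_eq_left (by linarith), abs_of_nonpos h]; ring
  obtain ⟨s, hs, hsΨ⟩ := exists_continuousOn_lift hΨc.continuousOn hΨmem z
  have hsC : ∀ w ∈ D, s w ∈ C := fun w hw => by
    refine ⟨fun v hv => ?_, ?_⟩
    · rw [hsΨ w hw, hk]; exact hΨD w hw v hv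
    · rw [hsΨ w hw]; exact hside w
  have he : ∀ i, Continuous fun w : Euc3 => w i := fun i => by fun_prop
  have he3 : Continuous fun w : Euc3 => 1 - w 0 - w 1 - |w 2| := by fun_prop
  have hDc : IsCompact D := by
    refine (isCompact_closedBall (0 : Euc3) 2).of_isClosed_subset ?_ fun w hw => ?_
    · refine IsClosed.inter ?_ (IsClosed.inter ?_ ?_)
      · exact isClosed_le continuous_const (he 0)
      · exact isClosed_le continuous_const (he 1)
      · exact isClosed_le continuous_const he3
    · obtain ⟨h0, h1, h2⟩ := hw
      have h3 := abs_nonneg (w 2)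
      rw [mem_closedBall_zero_iff, EuclideanSpace.norm_eq, Real.sqrt_le_left (by norm_num),
        Fin.sum_univ_three]
      simp only [Real.norm_eq_abs, sq_abs]
      rw [← sq_abs (w 2)]
      nlinarith
  have hDL : IsOpen (D \ L) := by
    have : D \ L = {w | 1 / 6 < w 0 ∧ 1 / 6 < w 1 ∧ 1 / 6 < 1 - w 0 - w 1 - |w 2|} := by
      ext w
      simp only [D, L, Set.mem_sdiff, mem_ofPred_eq, not_or]
      constructor
      · rintro ⟨⟨h0, h1, h2⟩, n0, n1, n2⟩
        exact ⟨lt_of_le_of_ne h0 (Ne.symm n0), lt_of_le_of_ne h1 (Ne.symm n1),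
          lt_of_le_of_ne h2 (Ne.symm n2)⟩
      · rintro ⟨h0, h1, h2⟩
        exact ⟨⟨h0.le, h1.le, h2.le⟩, h0.ne', h1.ne', h2.ne'⟩
    rw [this]
    refine IsOpen.inter ?_ (IsOpen.inter ?_ ?_)
    · exact isOpen_lt continuous_const (he 0)
    · exact isOpen_lt continuous_const (he 1)
    · exact isOpen_lt continuous_const he3
  obtain ⟨w, hw, hw0⟩ := Euc3.not_extends_of_mem_interior hDc hDL (c := !₂[1 / 3, 1 / 3, 0])
    (by rw [Set.mem_sdiff]; simp [D, L]; norm_num) (g := fun w => g (s w)) (hg.comp hs hsC)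
    (by
      intro w hw hwL
      have hsL : s w ∈ C ∩ K.starBdry t := by
        refine ⟨hsC w hw, (hsC w hw).1, ?_⟩
        rw [hsΨ w hw, hk]
        rcases hwL with h | h | h
        · exact ⟨p, hpt, by rw [Ψp, h]⟩
        · exact ⟨q, hqt, by rw [Ψq, h]⟩
        · exact ⟨r, hrt, by rw [Ψr, h]⟩
      rw [hgL _ hsL]
      simp only [f]
      rw [hsΨ w hw, Ψp, Ψq, Ψa, Ψb]
      congr 1
      ext i
      fin_cases i
      · simp
      · simp
      · simp only [Fin.reduceFinMk, Matrix.cons_val]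
        rcases le_total 0 (w 2) with h | h
        · rw [max_eq_left h, max_eq_right (by linarith)]; ring
        · rw [max_eq_right h, max_eq_left (by linarith)]; ring)
  exact hg0 _ (hsC w hw) hw0

end PreAbstractSimplicialComplex

/-! ### Combinatorial consequences of the topology -/

namespace PreAbstractSimplicialComplex

variable {V : Type*} {K : PreAbstractSimplicialComplex V}

/-- The combinatorial properties of triangulated `3`-spheres on which the collapsing arguments
rest. -/
structure IsSphereLike (K : PreAbstractSimplicialComplex V) : Prop where
  finite : K.faces.Finite
  nonempty : K.faces.Nonempty
  exists_tetrahedron : ∀ σ ∈ K.faces, ∃ F ∈ K.faces, F.card = 4 ∧ σ ⊆ F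
  triangle : ∀ t ∈ K.faces, t.card = 3 → ∃ F G, F ∈ K.faces ∧ G ∈ K.faces ∧ F.card = 4 ∧
    G.card = 4 ∧ F ≠ G ∧ t ⊆ F ∧ t ⊆ G ∧ ∀ H ∈ K.faces, t ⊂ H → H = F ∨ H = G
  star_connected : ∀ ρ ∈ K.faces, ρ.card ≤ 2 → ∀ P : Finset V → Prop,
    (∀ F ∈ K.faces, ∀ G ∈ K.faces, F.card = 4 → G.card = 4 → ∀ t : Finset V, t.card = 3 → ρ ⊆ t →
      t ⊆ F → t ⊆ G → P F → P G) →
    ∀ F ∈ K.faces, ∀ G ∈ K.faces, F.card = 4 → G.card = 4 → ρ ⊆ F → ρ ⊆ G → P F → P G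
  connected : ∀ P : V → Prop, (∀ σ ∈ K.faces, ∀ a ∈ σ, ∀ b ∈ σ, P a → P b) →
    ∀ a b, {a} ∈ K.faces → {b} ∈ K.faces → P a → P b
  cocycle : ∀ c : V → V → ℤ, (∀ σ ∈ K.faces, ∀ a ∈ σ, ∀ b ∈ σ, ∀ d ∈ σ, c a b + c b d = c a d) →
    ∃ φ : V → ℤ, ∀ σ ∈ K.faces, ∀ a ∈ σ, ∀ b ∈ σ, c a b = φ b - φ a

/-- A face with five vertices would properly contain a triangle that lies in two of its tetrahedra,
and would thus be a third coface of that triangle. -/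
theorem exists_tetrahedron_of_realization (hfin : K.faces.Finite)
    (hK : IsPuncturedEuclidean K.realization) [Nontrivial K.realization] {σ : Finset V}
    (hσ : σ ∈ K.faces) : ∃ F ∈ K.faces, F.card = 4 ∧ σ ⊆ F := by
  classical
  obtain ⟨τ, hστ, hτ⟩ := hfin.exists_le_maximal hσ
  have h4 := four_le_card_of_maximal hfin hK hτ.prop fun ρ hρ h =>
    (hτ.eq_of_le hρ h).symm
  refine ⟨τ, hτ.prop, le_antisymm ?_ h4, hστ⟩
  by_contra! h5
  obtain ⟨t, ht, ht3⟩ := Finset.exists_subset_card_eq (show 3 ≤ τ.card by omega)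
  have hd : (τ \ t).card = τ.card - 3 := by rw [Finset.card_sdiff_of_subset ht, ht3]
  obtain ⟨a, ha, b, hb, hab⟩ := Finset.one_lt_card.1 (show 1 < (τ \ t).card by omega)
  rw [Finset.mem_sdiff] at ha hb
  have hmem : ∀ d ∈ τ, insert d t ∈ K.faces := fun d hd =>
    mem_faces_of_subset hτ.prop (Finset.insert_subset hd ht) (Finset.insert_nonempty _ _)
  have htK : t ∈ K.faces := mem_faces_of_subset hτ.prop ht (Finset.card_pos.1 (by omega))
  have hτt : τ ≠ t := fun h => by rw [h] at h4; omega
  rcases eq_of_triangle_subset hfin hK htK ht3 ha.2 hb.2 hab (hmem a ha.1) (hmem b hb.1) hτ.prop ht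
    hτt with h | h
  · rw [h, Finset.card_insert_of_notMem ha.2] at h5; omega
  · rw [h, Finset.card_insert_of_notMem hb.2] at h5; omega

theorem exists_two_tetrahedra_of_realization (hfin : K.faces.Finite)
    (hK : IsPuncturedEuclidean K.realization) [Nontrivial K.realization] {t : Finset V}
    (ht : t ∈ K.faces) (ht3 : t.card = 3) : ∃ F G, F ∈ K.faces ∧ G ∈ K.faces ∧ F.card = 4 ∧
    G.card = 4 ∧ F ≠ G ∧ t ⊆ F ∧ t ⊆ G ∧ ∀ H ∈ K.faces, t ⊂ H → H = F ∨ H = G := by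
  classical
  have hcof : ∀ H ∈ K.faces, t ⊆ H → H ≠ t → ∃ a ∉ t, H = insert a t := by
    intro H hH htH hne
    obtain ⟨F, hF, hF4, hHF⟩ := exists_tetrahedron_of_realization hfin hK hH
    have hlt := Finset.card_lt_card (htH.ssubset_of_ne hne.symm)
    have hle := Finset.card_le_card hHF
    obtain ⟨a, ha, h⟩ := Finset.exists_eq_insert_iff.2 ⟨htH, by omega⟩
    exact ⟨a, ha, h.symm⟩
  obtain ⟨F, hF, hF4, htF⟩ := exists_tetrahedron_of_realization hfin hK ht
  obtain ⟨a, ha, rfl⟩ := hcof F hF htF fun h => by rw [h] at hF4; omega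
  obtain ⟨G, hG, htG, hGt, hGF⟩ := exists_ne_insert hfin hK ht ha hF
  obtain ⟨b, hb, rfl⟩ := hcof G hG htG hGt
  refine ⟨_, _, hF, hG, hF4, by rw [Finset.card_insert_of_notMem hb, ht3], hGF.symm, htF, htG,
    fun H hH htH => ?_⟩
  exact eq_of_triangle_subset hfin hK ht ht3 ha hb (fun h => hGF (by rw [h])) hF hG hH htH.1
    htH.ne'

/-- The tetrahedra at a vertex or an edge are connected through triangles at this face. -/
theorem star_connected_of_realization (hfin : K.faces.Finite)
    (hK : IsPuncturedEuclidean K.realization) [Nontrivial K.realization] {σ : Finset V}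
    (hσ : σ ∈ K.faces) (hσ2 : σ.card ≤ 2) (P : Finset V → Prop)
    (hP : ∀ F ∈ K.faces, ∀ G ∈ K.faces, F.card = 4 → G.card = 4 → ∀ t : Finset V, t.card = 3 →
      σ ⊆ t → t ⊆ F → t ⊆ G → P F → P G) {F G : Finset V} (hF : F ∈ K.faces) (hG : G ∈ K.faces)
    (hF4 : F.card = 4) (hG4 : G.card = 4) (hσF : σ ⊆ F) (hσG : σ ⊆ G) (hPF : P F) : P G := by
  classical
  by_contra hPG
  have : CompactSpace K.realization := isCompact_iff_compactSpace.1 (isCompact_realization hfin)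
  obtain ⟨z, hz⟩ := exists_notMem_starNhd hσ
  obtain ⟨j, hj, -⟩ := hK z
  have hCs : K.starNhd σ ⊆ j.source := fun y hy => by
    rw [hj]; exact fun h => hz (mem_singleton_iff.1 h ▸ hy)
  have hx := barycenter_mem_starNhd_diff hσ
  -- If `P` separated the tetrahedra at `σ`, the star would split into two closed parts. Neither has
  -- the barycenter in its interior, so the translation extends over each; the extensions can be
  -- glued because the parts meet in dimension at most one.
  let part : (Finset V → Prop) → Set K.realization := fun Q =>
    {y | y ∈ K.starNhd σ ∧ ∃ H ∈ {H | H ∈ K.faces ∧ H.card = 4 ∧ σ ⊆ H ∧ Q H},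
      ∀ v ∉ H, y.1 v = 0}
  have hclosed : ∀ Q, IsClosed (part Q) := by
    intro Q
    have : part Q = K.starNhd σ ∩ ⋃ H ∈ {H | H ∈ K.faces ∧ H.card = 4 ∧ σ ⊆ H ∧ Q H},
        {y : K.realization | ∀ v ∉ H, y.1 v = 0} := by
      ext y
      simp only [part, mem_inter_iff, mem_iUnion, mem_ofPred_eq, exists_prop]
    rw [this]
    refine (isClosed_starNhd σ).inter ((hfin.subset fun H hH => hH.1).isClosed_biUnion fun H _ => ?_)
    exact isClosed_setOf_forall fun v => isClosed_setOf_forall fun _ =>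
      isClosed_eq (continuous_coord v) continuous_const
  have hsub : ∀ Q, part Q ⊆ K.starNhd σ := fun Q y hy => hy.1
  let f : K.realization → Euc3 := fun y => j y - j (barycenter hσ)
  have hLC : K.starBdry σ ⊆ K.starNhd σ := fun y hy => hy.1
  have hf : ContinuousOn f (K.starBdry σ) :=
    (j.continuousOn.mono (hLC.trans hCs)).sub continuousOn_const
  have hf0 : ∀ y ∈ K.starBdry σ, f y ≠ 0 := fun y hy h =>
    hx.2 (j.injOn (hCs hy.1) (hCs hx.1) (sub_eq_zero.1 h) ▸ hy)
  have hext : ∀ Q : Finset V → Prop, ∀ A ∈ K.faces, A.card = 4 → σ ⊆ A → Q A →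
      ∀ B ∈ K.faces, B.card = 4 → σ ⊆ B → ¬ Q B →
      ∃ g : K.realization → Euc3, ContinuousOn g (part Q) ∧ (∀ y ∈ part Q, g y ≠ 0) ∧
        ∀ y ∈ part Q ∩ K.starBdry σ, g y = f y := by
    intro Q A hA hA4 hσA hQA B hB hB4 hσB hQB
    refine exists_extension_of_barycenter_notMem_interior hσ hfin hK (hclosed Q) (hsub Q)
      (fun h => hz h.1) ?_ ?_ ?_ (hf.mono inter_subset_right) fun y hy => hf0 y hy.2
    · rintro y ⟨-, H, hH, hyH⟩ y' hy' hyy'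
      exact ⟨hy', H, hH, fun v hv => hyy' v (hyH v hv)⟩
    · exact ⟨hx.1, A, ⟨hA, hA4, hσA, hQA⟩, fun v hv =>
        barycenter_of_notMem hσ fun h => hv (hσA h)⟩
    · intro hint
      obtain ⟨y, ⟨-, H, ⟨hH, hH4, -, hQH⟩, hyH⟩, hs⟩ :=
        exists_mem_of_barycenter_mem_interior hσ hB hσB hint
      have hBH : B ⊆ H := fun v hv => by_contra fun h => (hs v).1 hv (hyH v h)
      exact hQB (Finset.eq_of_subset_of_card_le hBH (by omega) ▸ hQH)
  obtain ⟨g₁, hg₁, h₁0, h₁L⟩ := hext P F hF hF4 hσF hPF G hG hG4 hσG hPG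
  obtain ⟨g₂, hg₂, h₂0, h₂L⟩ := hext (fun H => ¬ P H) G hG hG4 hσG hPG F hF hF4 hσF
    (not_not.2 hPF)
  have hthin : IsThin ((part P ∩ part fun H => ¬ P H) ×ˢ (univ : Set unitInterval)) := by
    refine isThin_prod_of_card_le_two hfin ((hclosed _).inter (hclosed _)).isCompact ?_
    rintro y ⟨⟨hy, A, ⟨hA, hA4, hσA, hPA⟩, hyA⟩, -, B, ⟨hB, hB4, hσB, hPB⟩, hyB⟩
    obtain ⟨τ, hτ, hs, -⟩ := exists_support y
    refine ⟨τ, hτ, ?_, fun v hv => not_not.1 fun h => hv ((hs v).2 h)⟩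
    by_contra! h3
    -- A support with three vertices would force a common triangle of `A` and `B` that contains `σ`,
    -- through which `P` would pass from `A` to `B`.
    have hτAB : τ ⊆ A ∩ B := fun v hv => Finset.mem_inter.2
      ⟨by_contra fun h => (hs v).1 hv (hyA v h), by_contra fun h => (hs v).1 hv (hyB v h)⟩
    obtain ⟨t, hσt, htAB, ht3⟩ := Finset.exists_subsuperset_card_eq (Finset.subset_inter hσA hσB)
      (show σ.card ≤ 3 by omega) (h3.trans_le (Finset.card_le_card hτAB))
    exact hPB (hP A hA B hB hA4 hB4 t ht3 hσt (htAB.trans Finset.inter_subset_left)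
      (htAB.trans Finset.inter_subset_right) hPA)
  obtain ⟨g, hg, hg0, hgL, hg2⟩ := exists_nonvanishing_union (hclosed _) (hclosed _)
    (isClosed_starBdry σ) hthin hg₁ hg₂ h₁0 h₂0
    fun y hy hyL => by rw [h₁L y ⟨hy.1, hyL⟩, h₂L y ⟨hy.2, hyL⟩]
  have hcover : part P ∪ part (fun H => ¬ P H) = K.starNhd σ := by
    refine Subset.antisymm (union_subset (hsub _) (hsub _)) fun y hy => ?_
    obtain ⟨τ, hτ, hs, -⟩ := exists_support y
    obtain ⟨H, hH, hH4, hτH⟩ := exists_tetrahedron_of_realization hfin hK hτ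
    have hσH : σ ⊆ H := fun v hv => hτH ((hs v).2 (pos_of_mem_starNhd hy hv).ne')
    have hyH : ∀ v ∉ H, y.1 v = 0 := fun v hv => not_not.1 fun h => hv (hτH ((hs v).2 h))
    by_cases hPH : P H
    · exact Or.inl ⟨hy, H, ⟨hH, hH4, hσH, hPH⟩, hyH⟩
    · exact Or.inr ⟨hy, H, ⟨hH, hH4, hσH, hPH⟩, hyH⟩
  rw [hcover] at hg hg0
  obtain ⟨y, hy, hy0⟩ := exists_eq_zero_of_eqOn_chart hj (isClosed_starNhd σ).isCompact hz
    (isOpen_starNhd_diff σ) hx hg fun y hy hyL => by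
      rw [← hcover] at hy
      rcases hy with hy | hy
      · rw [hgL y hy hyL, h₁L y ⟨hy, hyL⟩]
      · rw [hg2 y hy, h₂L y ⟨hy, hyL⟩]
  exact hg0 y hy hy0

/-- Since `P` is constant on faces, the points supported on vertices with `P` form a clopen set. -/
theorem connected_of_realization [PreconnectedSpace K.realization] (P : V → Prop)
    (hP : ∀ σ ∈ K.faces, ∀ a ∈ σ, ∀ b ∈ σ, P a → P b) {a b : V} (ha : {a} ∈ K.faces)
    (hb : {b} ∈ K.faces) (hPa : P a) : P b := by
  have hz : ∀ Q : V → Prop, IsClosed {y : K.realization | ∀ v, Q v → y.1 v = 0} := fun Q =>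
    isClosed_setOf_forall fun v => isClosed_setOf_forall fun _ =>
      isClosed_eq (continuous_coord v) continuous_const
  have hcompl : {y : K.realization | ∀ v, ¬ P v → y.1 v = 0}ᶜ =
      {y : K.realization | ∀ v, P v → y.1 v = 0} := by
    ext y
    obtain ⟨τ, hτ, hs, -⟩ := exists_support y
    simp only [mem_compl_iff, mem_ofPred_eq]
    constructor
    · intro h v hv
      by_contra hne
      exact h fun u hu => by_contra fun hu0 =>
        hu (hP τ hτ v ((hs v).2 hne) u ((hs u).2 hu0) hv)
    · intro h h'
      obtain ⟨v, hv⟩ := nonempty_of_mem_faces hτ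
      by_cases hPv : P v
      · exact (hs v).1 hv (h v hPv)
      · exact (hs v).1 hv (h' v hPv)
  have hclopen : IsClopen {y : K.realization | ∀ v, ¬ P v → y.1 v = 0} :=
    ⟨hz _, by rw [← isClosed_compl_iff, hcompl]; exact hz _⟩
  rcases isClopen_iff.1 hclopen with h | h
  · have : barycenter ha ∈ {y : K.realization | ∀ v, ¬ P v → y.1 v = 0} := fun v hv =>
      barycenter_of_notMem ha fun h => hv (Finset.mem_singleton.1 h ▸ hPa)
    rw [h] at this
    exact this.elim
  · by_contra hPb
    have : barycenter hb ∈ {y : K.realization | ∀ v, ¬ P v → y.1 v = 0} := h ▸ mem_univ _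
    have h0 := this b hPb
    rw [barycenter_of_mem hb (Finset.mem_singleton_self b)] at h0
    simp at h0

/-- Simplicial `1`-cocycles are coboundaries. -/
theorem exists_coboundary_of_realization (hfin : K.faces.Finite)
    (hK : IsPuncturedEuclidean K.realization) {ρ : Finset V} (hρ : ρ ∈ K.faces) (hρ3 : 3 ≤ ρ.card)
    (c : V → V → ℤ)
    (hc : ∀ σ ∈ K.faces, ∀ a ∈ σ, ∀ b ∈ σ, ∀ d ∈ σ, c a b + c b d = c a d) :
    ∃ φ : V → ℤ, ∀ σ ∈ K.faces, ∀ a ∈ σ, ∀ b ∈ σ, c a b = φ b - φ a := by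
  classical
  let I : Finset V := hfin.toFinset.biUnion id
  have hI : ∀ σ ∈ K.faces, σ ⊆ I := fun σ hσ v hv =>
    Finset.mem_biUnion.2 ⟨σ, hfin.mem_toFinset.2 hσ, hv⟩
  have hsumI : ∀ y : K.realization, ∑ v ∈ I, y.1 v = 1 := fun y => by
    obtain ⟨τ, hτ, hs, -⟩ := exists_support y
    exact sum_eq_one_of_subset fun v hv => hI τ hτ ((hs v).2 hv)
  have hc0 : ∀ a, {a} ∈ K.faces → c a a = 0 := fun a ha => by
    have := hc {a} ha a (by simp) a (by simp) a (by simp)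
    omega
  -- On a common star, `F a` and `F b` differ by the integer `c a b`, so the functions `exp (2πi F
  -- a)` fit together to a map from the whole realization to the circle.
  let F : V → K.realization → ℝ := fun a y => ∑ w ∈ I, y.1 w * c a w
  have hFc : ∀ a, Continuous (F a) := fun a =>
    continuous_finsetSum _ fun w _ => (continuous_coord w).mul continuous_const
  have hFF : ∀ y : K.realization, ∀ a b, y.1 a ≠ 0 → y.1 b ≠ 0 → F a y = F b y + c a b := by
    intro y a b ha hb
    obtain ⟨τ, hτ, hs, -⟩ := exists_support y
    have h1 : (c a b : ℝ) = ∑ w ∈ I, y.1 w * c a b := by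
      rw [← Finset.sum_mul, hsumI, one_mul]
    rw [h1, ← Finset.sum_add_distrib]
    refine Finset.sum_congr rfl fun w _ => ?_
    by_cases hw : y.1 w = 0
    · simp [hw]
    · have := hc τ hτ a ((hs a).2 ha) b ((hs b).2 hb) w ((hs w).2 hw)
      rw [← this]
      push_cast
      ring
  have hsupp : ∀ y : K.realization, ∃ a, y.1 a ≠ 0 := fun y => by
    obtain ⟨τ, hτ, hs, -⟩ := exists_support y
    obtain ⟨a, ha⟩ := nonempty_of_mem_faces hτ
    exact ⟨a, (hs a).1 ha⟩
  choose s hs using hsupp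
  let g : K.realization → Circle := fun y => Circle.exp (2 * Real.pi * F (s y) y)
  have hg : ∀ y : K.realization, ∀ a, y.1 a ≠ 0 → g y = Circle.exp (2 * Real.pi * F a y) := by
    intro y a ha
    simp only [g]
    rw [hFF y _ a (hs y) ha, mul_add, Circle.exp_add, Circle.exp_two_pi_mul_int, mul_one]
  have hgc : Continuous g := by
    refine continuous_iff_continuousAt.2 fun y => ?_
    have h1 : ContinuousAt (fun y => Circle.exp (2 * Real.pi * F (s y) y)) y → ContinuousAt g y :=
      fun h => h
    have h2 : Continuous fun y' => Circle.exp (2 * Real.pi * F (s y) y') :=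
      Circle.exp.continuous.comp (continuous_const.mul (hFc _))
    refine h2.continuousAt.congr ?_
    filter_upwards [(continuous_coord (s y)).continuousAt.eventually_ne (hs y)] with y' hy'
    exact (hg y' _ hy').symm
  -- Off the barycenter of `ρ` the space is Euclidean, so the circle-valued map lifts to the reals.
  -- No edge passes through this point, as `ρ` has at least three vertices.
  obtain ⟨j, hj, hjt⟩ := hK (barycenter hρ)
  let h : C(Euc3, Circle) := ⟨fun w => g (j.symm w), hgc.comp (by
    rw [← continuousOn_univ, ← hjt]; exact j.continuousOn_symm)⟩
  obtain ⟨e₀, he₀⟩ := Circle.exp_surjective (h 0)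
  obtain ⟨θ, ⟨-, hθ⟩, -⟩ := Circle.isCoveringMap_exp.existsUnique_continuousMap_lifts h 0 e₀ he₀
  let ϑ : K.realization → ℝ := fun y => θ (j y)
  have hϑc : ContinuousOn ϑ {barycenter hρ}ᶜ := by
    rw [← hj]; exact θ.continuous.comp_continuousOn j.continuousOn
  have hϑ : ∀ y, y ≠ barycenter hρ → Circle.exp (ϑ y) = g y := fun y hy => by
    have := congrFun hθ (j y)
    have hy' : y ∈ j.source := by rw [hj]; exact hy
    simpa [h, j.left_inv hy'] using this
  have hsmall : ∀ y : K.realization, ∀ a b, (∀ v, v ≠ a → v ≠ b → y.1 v = 0) →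
      y ≠ barycenter hρ := by
    rintro y a b hy rfl
    have hk : (0 : ℝ) < ρ.card := by exact_mod_cast (by omega : 0 < ρ.card)
    have hsub : ρ ⊆ {a, b} := fun v hv => by
      by_contra hv'
      simp only [Finset.mem_insert, Finset.mem_singleton, not_or] at hv'
      have := hy v hv'.1 hv'.2
      rw [barycenter_of_mem hρ hv] at this
      exact (inv_pos.2 hk).ne' this
    have := (Finset.card_le_card hsub).trans Finset.card_le_two
    omega
  have hvert : ∀ a, ∀ ha : {a} ∈ K.faces, ∃ n : ℤ, ϑ (barycenter ha) = n * (2 * Real.pi) := by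
    intro a ha
    have hne : (barycenter ha).1 a ≠ 0 := by
      rw [barycenter_of_mem ha (Finset.mem_singleton_self a)]; simp
    have h0 : F a (barycenter ha) = 0 := by
      refine Finset.sum_eq_zero fun w _ => ?_
      by_cases hw : w = a
      · rw [hw, hc0 a ha]; simp
      · rw [barycenter_of_notMem ha (by simpa using hw), zero_mul]
    rw [← Circle.exp_eq_one, hϑ _ (hsmall _ a a fun v hv _ =>
      barycenter_of_notMem ha (by simpa using hv)), hg _ a hne, h0]
    simp
  choose! n hn using hvert
  refine ⟨n, fun σ hσ a ha b hb => ?_⟩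
  have ha' := singleton_mem_faces hσ ha
  have hb' := singleton_mem_faces hσ hb
  let Φ : unitInterval → V → ℝ := fun u v =>
    (1 - (u : ℝ)) * (barycenter ha').1 v + (u : ℝ) * (barycenter hb').1 v
  have hoff : ∀ u v, v ≠ a → v ≠ b → Φ u v = 0 := fun u v hva hvb => by
    simp only [Φ, barycenter_of_notMem ha' (show v ∉ {a} by simpa using hva),
      barycenter_of_notMem hb' (show v ∉ {b} by simpa using hvb)]
    ring
  have hΦ : ∀ u ∈ (univ : Set unitInterval), Φ u ∈ K.realization := by
    intro u _
    refine ⟨fun v => add_nonneg (mul_nonneg (by linarith [u.2.2]) ((barycenter ha').2.1 v))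
      (mul_nonneg u.2.1 ((barycenter hb').2.1 v)), σ, hσ, fun v hv => hoff u v
        (fun h => hv (h ▸ ha)) (fun h => hv (h ▸ hb)), ?_⟩
    have h1 : ∑ v ∈ σ, (barycenter ha').1 v = 1 := sum_eq_one_of_subset fun v hv => by
      have : v ∈ ({a} : Finset V) := by_contra fun hv' => hv (barycenter_of_notMem ha' hv')
      exact Finset.mem_singleton.1 this ▸ ha
    have h2 : ∑ v ∈ σ, (barycenter hb').1 v = 1 := sum_eq_one_of_subset fun v hv => by
      have : v ∈ ({b} : Finset V) := by_contra fun hv' => hv (barycenter_of_notMem hb' hv')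
      exact Finset.mem_singleton.1 this ▸ hb
    simp only [Φ]
    rw [Finset.sum_add_distrib, ← Finset.mul_sum, ← Finset.mul_sum, h1, h2]
    ring
  obtain ⟨r, hr, hrΦ⟩ := exists_continuousOn_lift (S := (univ : Set unitInterval)) (Φ := Φ)
    (continuousOn_pi.2 fun v => by fun_prop) hΦ (barycenter ha')
  have hrΦ' : ∀ u, (r u).1 = Φ u := fun u => hrΦ u trivial
  have hrne : ∀ u, r u ≠ barycenter hρ := fun u => hsmall _ a b fun v hva hvb => by
    rw [hrΦ']; exact hoff u v hva hvb
  -- Along the edge from `a` to `b` this compares the lift with the affine one. The difference lies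
  -- in a fibre of the covering, hence is constant; its endpoints give the coboundary formula.
  let q : unitInterval → ℝ := fun u => ϑ (r u) - 2 * Real.pi * (u * c a b)
  have hq : Continuous q := by
    refine Continuous.sub ?_ (by fun_prop)
    exact hϑc.comp_continuous (continuousOn_univ.1 hr) hrne
  have hqa : ∀ u, q u = ϑ (r u) - 2 * Real.pi * (u * c a b) := fun u => rfl
  have hr0 : r 0 = barycenter ha' := by
    apply Subtype.ext
    rw [hrΦ']
    ext v
    simp [Φ]
  have hr1 : r 1 = barycenter hb' := by
    apply Subtype.ext
    rw [hrΦ']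
    ext v
    simp [Φ]
  have hexp : ∀ u, Circle.exp (q u) = 1 := by
    intro u
    by_cases hu : u = 1
    · rw [hqa, hu, hr1, hn b hb', Set.Icc.coe_one, one_mul, Circle.exp_sub,
        Circle.exp_two_pi_mul_int, Circle.exp_int_mul_two_pi, div_one]
    · have hu1 : (u : ℝ) < 1 := lt_of_le_of_ne u.2.2 fun h => hu (Subtype.ext h)
      have hne : (r u).1 a ≠ 0 := by
        rw [hrΦ']
        have h1 : 0 < (1 - (u : ℝ)) * (barycenter ha').1 a := by
          rw [barycenter_of_mem ha' (Finset.mem_singleton_self a), Finset.card_singleton,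
            Nat.cast_one, inv_one, mul_one]
          linarith
        exact (add_pos_of_pos_of_nonneg h1 (mul_nonneg u.2.1 ((barycenter hb').2.1 a))).ne'
      have hF : F a (r u) = u * c a b := by
        have hab : ∀ w ∈ I, (r u).1 w * (c a w : ℝ) =
            if w = b then (u : ℝ) * c a b else 0 := by
          intro w _
          by_cases hwa : w = a
          · by_cases hwb : w = b
            · have : a = b := hwa ▸ hwb
              rw [hwa, hc0 a ha', if_pos this, ← this, hc0 a ha']; simp
            · rw [if_neg hwb, hwa, hc0 a ha']; simp
          · by_cases hwb : w = b
            · have hba : b ∉ ({a} : Finset V) := by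
                rw [Finset.mem_singleton]; exact fun h => hwa (hwb.trans h)
              rw [if_pos hwb, hwb, hrΦ']
              simp only [Φ, barycenter_of_notMem ha' hba,
                barycenter_of_mem hb' (Finset.mem_singleton_self b)]
              simp
            · rw [if_neg hwb, hrΦ', hoff u w hwa hwb, zero_mul]
        simp only [F]
        rw [Finset.sum_congr rfl hab, Finset.sum_ite_eq' I b, if_pos (hI σ hσ hb)]
      rw [hqa, Circle.exp_sub, hϑ _ (hrne u), hg _ a hne, hF, div_self']
  have hconst := Circle.isCoveringMap_exp.const_of_comp hq (fun u u' => by rw [hexp, hexp]) 1 0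
  rw [hqa, hqa, hr0, hr1, hn a ha', hn b hb', Set.Icc.coe_one, Set.Icc.coe_zero] at hconst
  have hπ : (2 * Real.pi) ≠ 0 := by positivity
  have : (c a b : ℝ) = n b - n a := by
    apply mul_left_cancel₀ hπ
    linear_combination -hconst
  exact_mod_cast this

end PreAbstractSimplicialComplex

/-! ### From geometric simplicial complexes to barycentric coordinates -/

namespace Geometry.SimplicialComplex

variable {E : Type*} [NormedAddCommGroup E] [NormedSpace ℝ E]

/-- The underlying space of a finite simplicial complex is homeomorphic to its realization in
barycentric coordinates. -/
theorem nonempty_realization_homeomorph (S : Geometry.SimplicialComplex ℝ E)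
    (hfin : S.faces.Finite) :
    Nonempty (S.toPreAbstractSimplicialComplex.realization ≃ₜ S.space) := by
  classical
  have : CompactSpace S.toPreAbstractSimplicialComplex.realization :=
    isCompact_iff_compactSpace.1 (PreAbstractSimplicialComplex.isCompact_realization hfin)
  let I : Finset E := hfin.toFinset.biUnion id
  have hI : ∀ σ ∈ S.faces, σ ⊆ I := fun σ hσ v hv =>
    Finset.mem_biUnion.2 ⟨σ, hfin.mem_toFinset.2 hσ, hv⟩
  let Ψ : (E → ℝ) → E := fun y => ∑ v ∈ I, y v • v
  have hΨσ : ∀ σ ∈ S.faces, ∀ y : E → ℝ, (∀ v ∉ σ, y v = 0) → Ψ y = ∑ v ∈ σ, y v • v := by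
    intro σ hσ y hy
    refine (Finset.sum_subset (hI σ hσ) fun v _ hv => ?_).symm
    rw [hy v hv, zero_smul]
  have hΨS : ∀ y ∈ S.toPreAbstractSimplicialComplex.realization, Ψ y ∈ S.space := by
    rintro y ⟨h0, σ, hσ, hoff, hsum⟩
    rw [mem_space_iff]
    refine ⟨σ, hσ, ?_⟩
    rw [hΨσ σ hσ y hoff, Finset.convexHull_eq]
    exact ⟨y, fun v _ => h0 v, hsum, by rw [Finset.centerMass_eq_of_sum_1 _ _ hsum]; rfl⟩
  let ψ : S.toPreAbstractSimplicialComplex.realization → S.space := fun y => ⟨Ψ y.1, hΨS y.1 y.2⟩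
  have hψc : Continuous ψ := by
    refine Continuous.subtype_mk ?_ _
    exact continuous_finsetSum _ fun v _ =>
      (PreAbstractSimplicialComplex.continuous_coord v).smul continuous_const
  have hlift : ∀ σ ∈ S.faces, ∀ x ∈ convexHull ℝ (σ : Set E),
      ∃ y : S.toPreAbstractSimplicialComplex.realization, (∀ v ∉ σ, y.1 v = 0) ∧ Ψ y.1 = x := by
    intro σ hσ x hx
    rw [Finset.convexHull_eq] at hx
    obtain ⟨w, hw0, hw1, hwx⟩ := hx
    let y : E → ℝ := fun v => if v ∈ σ then w v else 0
    have hoff : ∀ v ∉ σ, y v = 0 := fun v hv => by simp [y, hv]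
    have hon : ∀ v ∈ σ, y v = w v := fun v hv => by simp [y, hv]
    refine ⟨⟨y, fun v => ?_, σ, hσ, hoff, ?_⟩, hoff, ?_⟩
    · by_cases hv : v ∈ σ
      · rw [hon v hv]; exact hw0 v hv
      · rw [hoff v hv]
    · rw [Finset.sum_congr rfl hon, hw1]
    · change Ψ y = x
      rw [hΨσ σ hσ y hoff, ← hwx, Finset.centerMass_eq_of_sum_1 _ _ hw1]
      exact Finset.sum_congr rfl fun v hv => by rw [hon v hv]; rfl
  have huniq : ∀ σ ∈ S.faces, ∀ y y' : S.toPreAbstractSimplicialComplex.realization,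
      (∀ v ∉ σ, y.1 v = 0) → (∀ v ∉ σ, y'.1 v = 0) → Ψ y.1 = Ψ y'.1 → y = y' := by
    intro σ hσ y y' hy hy' he
    have hs : ∀ y : S.toPreAbstractSimplicialComplex.realization, (∀ v ∉ σ, y.1 v = 0) →
        ∑ v ∈ σ, y.1 v = 1 := fun y hy =>
      PreAbstractSimplicialComplex.sum_eq_one_of_subset fun v hv => by_contra fun h => hv (hy v h)
    have hind := affineIndependent_iff.1 (S.indep hσ) Finset.univ
      (fun v => y.1 v.1 - y'.1 v.1) (by
        rw [Finset.sum_sub_distrib]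
        have h1 := Finset.sum_coe_sort σ y.1
        have h2 := Finset.sum_coe_sort σ y'.1
        rw [h1, h2, hs y hy, hs y' hy', sub_self]) (by
        simp only [sub_smul]
        rw [Finset.sum_sub_distrib]
        have h1 := Finset.sum_coe_sort σ fun v => y.1 v • v
        have h2 := Finset.sum_coe_sort σ fun v => y'.1 v • v
        rw [h1, h2, ← hΨσ σ hσ _ hy, ← hΨσ σ hσ _ hy', he, sub_self])
    ext v
    by_cases hv : v ∈ σ
    · exact sub_eq_zero.1 (hind ⟨v, hv⟩ (Finset.mem_univ _))
    · rw [hy v hv, hy' v hv]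
  have hψb : Function.Bijective ψ := by
    constructor
    · intro y y' he
      have he' : Ψ y.1 = Ψ y'.1 := congrArg Subtype.val he
      obtain ⟨h0, σ, hσ, hoff, hsum⟩ := y.2
      obtain ⟨h0', τ, hτ, hoff', hsum'⟩ := y'.2
      -- Two points with the same image are compared with a point of the common face, where affine
      -- independence makes barycentric coordinates unique.
      have hx : Ψ y.1 ∈ convexHull ℝ ((σ : Set E) ∩ τ) := by
        refine S.inter_subset_convexHull hσ hτ ⟨?_, ?_⟩
        · rw [hΨσ σ hσ _ hoff, Finset.convexHull_eq]
          exact ⟨y.1, fun v _ => h0 v, hsum, by rw [Finset.centerMass_eq_of_sum_1 _ _ hsum]; rfl⟩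
        · rw [he', hΨσ τ hτ _ hoff', Finset.convexHull_eq]
          exact ⟨y'.1, fun v _ => h0' v, hsum', by
            rw [Finset.centerMass_eq_of_sum_1 _ _ hsum']; rfl⟩
      rw [← Finset.coe_inter] at hx
      have hne : (σ ∩ τ).Nonempty := by
        rw [← Finset.coe_nonempty, ← convexHull_nonempty_iff (𝕜 := ℝ)]
        exact ⟨_, hx⟩
      obtain ⟨u, hu, huΨ⟩ := hlift (σ ∩ τ) (S.down_closed hσ Finset.inter_subset_left hne) _ hx
      have hu1 : ∀ v ∉ σ, u.1 v = 0 := fun v hv => hu v fun h => hv (Finset.mem_inter.1 h).1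
      have hu2 : ∀ v ∉ τ, u.1 v = 0 := fun v hv => hu v fun h => hv (Finset.mem_inter.1 h).2
      rw [huniq σ hσ y u hoff hu1 huΨ.symm, huniq τ hτ y' u hoff' hu2 (he'.symm.trans huΨ.symm)]
    · rintro ⟨x, hx⟩
      obtain ⟨σ, hσ, hxσ⟩ := mem_space_iff.1 hx
      obtain ⟨y, -, hy⟩ := hlift σ hσ x hxσ
      exact ⟨y, Subtype.ext hy⟩
  exact ⟨hψc.homeoOfEquivCompactToT2 (f := Equiv.ofBijective ψ hψb)⟩

theorem IsTriangulatedSphere.isSphereLike {S : Geometry.SimplicialComplex ℝ E}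
    (hS : S.IsTriangulatedSphere 3) : S.toPreAbstractSimplicialComplex.IsSphereLike := by
  obtain ⟨hfin, ⟨h⟩⟩ := hS
  obtain ⟨e⟩ := S.nonempty_realization_homeomorph hfin
  let H : S.toPreAbstractSimplicialComplex.realization ≃ₜ
    sphere (0 : EuclideanSpace ℝ (Fin 4)) 1 := e.trans h
  have hrank : 1 < Module.rank ℝ (EuclideanSpace ℝ (Fin 4)) := by
    rw [← Module.finrank_eq_rank, finrank_euclideanSpace_fin]
    norm_num
  have hK := isPuncturedEuclidean_of_homeomorph H
  have hnt : Nontrivial (sphere (0 : EuclideanSpace ℝ (Fin 4)) 1) := by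
    let p : sphere (0 : EuclideanSpace ℝ (Fin 4)) 1 := ⟨EuclideanSpace.single 0 1, by simp⟩
    exact ⟨p, -p, (ne_neg_of_mem_unit_sphere ℝ p)⟩
  have : Nontrivial S.toPreAbstractSimplicialComplex.realization := H.toEquiv.nontrivial
  have : PreconnectedSpace (sphere (0 : EuclideanSpace ℝ (Fin 4)) 1) :=
    Subtype.preconnectedSpace (isPreconnected_sphere hrank 0 1)
  have : PreconnectedSpace S.toPreAbstractSimplicialComplex.realization :=
    H.symm.surjective.denseRange.preconnectedSpace H.symm.continuous
  have hne : S.faces.Nonempty := by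
    obtain ⟨y, -⟩ := exists_pair_ne S.toPreAbstractSimplicialComplex.realization
    obtain ⟨-, σ, hσ, -⟩ := y.2
    exact ⟨σ, hσ⟩
  refine ⟨hfin, hne, fun σ hσ =>
    PreAbstractSimplicialComplex.exists_tetrahedron_of_realization hfin hK hσ,
    fun t ht ht3 => PreAbstractSimplicialComplex.exists_two_tetrahedra_of_realization hfin hK ht ht3,
    fun ρ hρ hρ2 P hP F hF G hG hF4 hG4 hρF hρG hPF =>
      PreAbstractSimplicialComplex.star_connected_of_realization hfin hK hρ hρ2 P hP hF hG hF4 hG4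
        hρF hρG hPF,
    fun P hP a b ha hb hPa =>
      PreAbstractSimplicialComplex.connected_of_realization P hP ha hb hPa, fun c hc => ?_⟩
  obtain ⟨σ, hσ⟩ := hne
  obtain ⟨F, hF, hF4, -⟩ :=
    PreAbstractSimplicialComplex.exists_tetrahedron_of_realization hfin hK hσ
  exact PreAbstractSimplicialComplex.exists_coboundary_of_realization hfin hK hF (by omega) c hc

end Geometry.SimplicialComplex

namespace PreAbstractSimplicialComplex

variable {V : Type*} {K L M N : PreAbstractSimplicialComplex V} {σ τ : Finset V}

/-! ### Elementary collapses -/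

theorem ext_faces (h : K.faces = L.faces) : K = L := by
  cases K; cases L; cases h; rfl

/-- Adding to `σ` one vertex of `τ` already gives a coface, so by uniqueness it gives `τ`. -/
theorem IsFreePair.exists_eq_insert [DecidableEq V] (h : K.IsFreePair σ τ) :
    ∃ w ∉ σ, τ = insert w σ := by
  obtain ⟨hσ, hτ, hlt, huniq⟩ := h
  obtain ⟨w, hw, hwσ⟩ := Finset.exists_of_ssubset hlt
  refine ⟨w, hwσ, (huniq _ ?_ (Finset.ssubset_insert hwσ)).symm⟩
  exact mem_faces_of_subset hτ (Finset.insert_subset hw hlt.subset) (Finset.insert_nonempty _ _)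

theorem IsFreePair.card_eq (h : K.IsFreePair σ τ) : τ.card = σ.card + 1 := by
  classical
  obtain ⟨w, hw, rfl⟩ := h.exists_eq_insert
  exact Finset.card_insert_of_notMem hw

theorem IsFreePair.exists_elementaryCollapse (h : K.IsFreePair σ τ) :
    ∃ L, ElementaryCollapse K L ∧ L.faces = K.faces \ {σ, τ} := by
  refine ⟨⟨K.faces \ {σ, τ}, ?_⟩, ⟨σ, τ, h, rfl⟩, rfl⟩
  rintro ρ ⟨hρ, hne⟩
  simp only [mem_insert_iff, mem_singleton_iff, not_or] at hne
  refine ⟨nonempty_of_mem_faces hρ, fun ρ' hle hρ' => ⟨mem_faces_of_subset hρ hle hρ', ?_⟩⟩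
  simp only [mem_insert_iff, mem_singleton_iff, not_or]
  refine ⟨?_, ?_⟩
  · rintro rfl
    exact hne.2 (h.2.2.2 ρ hρ (lt_of_le_of_ne hle (Ne.symm hne.1)))
  · rintro rfl
    exact hne.2 (h.2.2.2 ρ hρ (h.2.2.1.trans_subset hle))

theorem ElementaryCollapse.faces_subset (h : ElementaryCollapse K L) : L.faces ⊆ K.faces := by
  obtain ⟨σ, τ, -, hL⟩ := h
  rw [hL]
  exact sdiff_subset

theorem CollapsesTo.faces_subset (h : K.CollapsesTo L) : L.faces ⊆ K.faces := by
  induction h with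
  | refl => exact Subset.rfl
  | tail _ h ih => exact h.faces_subset.trans ih

theorem ElementaryCollapse.exists_mem (h : ElementaryCollapse K L) : L.faces.Nonempty := by
  classical
  obtain ⟨σ, τ, h, hL⟩ := h
  obtain ⟨w, hw, hτ⟩ := h.exists_eq_insert
  have hσ := nonempty_of_mem_faces h.1
  refine ⟨{w}, hL ▸ ⟨singleton_mem_faces h.2.1 (hτ ▸ Finset.mem_insert_self _ _), ?_⟩⟩
  simp only [mem_insert_iff, mem_singleton_iff, not_or]
  refine ⟨?_, fun hwτ => ?_⟩
  · rintro rfl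
    exact hw (Finset.mem_singleton_self _)
  · have h1 := h.card_eq
    rw [← hwτ, Finset.card_singleton] at h1
    have := hσ.card_pos
    omega

theorem CollapsesTo.nonempty (h : K.CollapsesTo L) (hK : K.faces.Nonempty) : L.faces.Nonempty := by
  induction h with
  | refl => exact hK
  | tail _ h _ => exact h.exists_mem

theorem CollapsesTo.collapsible (h : K.CollapsesTo L) (hL : L.Collapsible) : K.Collapsible := by
  obtain ⟨M, v, hM, hv⟩ := hL
  exact ⟨M, v, Relation.ReflTransGen.trans h hM, hv⟩

/-- In an elementary collapse of `σ ⊂ insert d σ`, any face of what remains spans a face with `d`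
if it lies in `insert d σ`. -/
theorem IsFreePair.insert_mem [DecidableEq V] {d : V} (h : K.IsFreePair σ (insert d σ)) (hd : d ∉ σ)
    (hL : L.faces = K.faces \ {σ, insert d σ}) {ρ : Finset V} (hρ : ρ ∈ L.faces)
    (hsub : ρ ⊆ insert d σ) : insert d ρ ∈ L.faces := by
  rw [hL]
  refine ⟨mem_faces_of_subset h.2.1 (Finset.insert_subset (Finset.mem_insert_self _ _) hsub)
    (Finset.insert_nonempty _ _), ?_⟩
  simp only [mem_insert_iff, mem_singleton_iff, not_or]
  refine ⟨fun he => hd (he ▸ Finset.mem_insert_self _ _), fun he => ?_⟩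
  have hσρ : σ ⊆ ρ := by
    intro x hx
    have hx' : x ∈ insert d ρ := he ▸ Finset.mem_insert_of_mem hx
    exact (Finset.mem_insert.1 hx').resolve_left fun h' => hd (h' ▸ hx)
  have : σ ∈ L.faces := mem_faces_of_subset hρ hσρ (nonempty_of_mem_faces h.1)
  rw [hL] at this
  exact this.2 (by simp)

/-! ### Connectedness and first cohomology under collapses -/

/-- `P` is constant on each face of `K`. -/
def IsLocallyConst (K : PreAbstractSimplicialComplex V) (P : V → Prop) : Prop :=
  ∀ σ ∈ K.faces, ∀ a ∈ σ, ∀ b ∈ σ, P a → P b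

/-- `c` is a simplicial `1`-cocycle of `K`. -/
def IsCocycle (K : PreAbstractSimplicialComplex V) (c : V → V → ℤ) : Prop :=
  ∀ σ ∈ K.faces, ∀ a ∈ σ, ∀ b ∈ σ, ∀ d ∈ σ, c a b + c b d = c a d

/-- Let `d` be the vertex of the collapsed face opposite to the free face. All its vertices receive
the value at `d`; this changes nothing in `L`, where the surviving ones are still joined to `d`. -/
theorem ElementaryCollapse.exists_isLocallyConst (h : ElementaryCollapse K L) {P : V → Prop}
    (hP : L.IsLocallyConst P) :
    ∃ P' : V → Prop, K.IsLocallyConst P' ∧ ∀ a, {a} ∈ L.faces → (P' a ↔ P a) := by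
  classical
  obtain ⟨σ, τ, h, hL⟩ := h
  obtain ⟨d, hd, rfl⟩ := h.exists_eq_insert
  have hagree : ∀ a, {a} ∈ L.faces → ((if a ∈ insert d σ then P d else P a) ↔ P a) := by
    intro a ha
    split_ifs with hmem
    · have hda := h.insert_mem hd hL ha (Finset.singleton_subset_iff.2 hmem)
      exact ⟨hP _ hda d (by simp) a (by simp), hP _ hda a (by simp) d (by simp)⟩
    · rfl
  refine ⟨fun a => if a ∈ insert d σ then P d else P a, ?_, hagree⟩
  intro ρ hρ a ha b hb
  by_cases hρL : ρ ∈ L.faces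
  · have ha' := hagree a (singleton_mem_faces hρL ha)
    have hb' := hagree b (singleton_mem_faces hρL hb)
    exact fun h1 => hb'.2 (hP ρ hρL a ha b hb (ha'.1 h1))
  · have hsub : ρ ⊆ insert d σ := by
      rw [hL] at hρL
      by_contra hne
      refine hρL ⟨hρ, ?_⟩
      rintro (rfl | rfl)
      · exact hne (Finset.subset_insert _ _)
      · exact hne Finset.Subset.rfl
    simp only [if_pos (hsub ha), if_pos (hsub hb)]
    exact id

theorem CollapsesTo.exists_isLocallyConst (h : K.CollapsesTo L) {P : V → Prop}
    (hP : L.IsLocallyConst P) :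
    ∃ P' : V → Prop, K.IsLocallyConst P' ∧ ∀ a, {a} ∈ L.faces → (P' a ↔ P a) := by
  induction h using Relation.ReflTransGen.head_induction_on with
  | refl => exact ⟨P, hP, fun _ _ => Iff.rfl⟩
  | @head K M h hML ih =>
    obtain ⟨P₁, hP₁, h₁⟩ := ih
    obtain ⟨P₂, hP₂, h₂⟩ := h.exists_isLocallyConst hP₁
    exact ⟨P₂, hP₂, fun a ha => (h₂ a (CollapsesTo.faces_subset hML ha)).trans (h₁ a ha)⟩

/-- On the collapsed face the cocycle is redefined as the coboundary of `c d`, where `d` is opposite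
to the free face. On surviving edges this is the old value, since they span a face of `L` with `d`.
-/
theorem ElementaryCollapse.exists_isCocycle [DecidableEq V] (h : ElementaryCollapse K L)
    {c : V → V → ℤ} (hc : L.IsCocycle c) :
    ∃ c' : V → V → ℤ, K.IsCocycle c' ∧ ∀ a b, {a, b} ∈ L.faces → c' a b = c a b := by
  obtain ⟨σ, τ, h, hL⟩ := h
  obtain ⟨d, hd, rfl⟩ := h.exists_eq_insert
  have hagree : ∀ a b, {a, b} ∈ L.faces →
      (if a ∈ insert d σ ∧ b ∈ insert d σ then c d b - c d a else c a b) = c a b := by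
    intro a b hab
    split_ifs with hmem
    · have hda := h.insert_mem hd hL hab
        (Finset.insert_subset hmem.1 (Finset.singleton_subset_iff.2 hmem.2))
      have := hc _ hda d (by simp) a (by simp) b (by simp)
      linarith
    · rfl
  refine ⟨fun a b => if a ∈ insert d σ ∧ b ∈ insert d σ then c d b - c d a else c a b, ?_, hagree⟩
  intro ρ hρ a ha b hb e he
  by_cases hρL : ρ ∈ L.faces
  · have hpair : ∀ x ∈ ρ, ∀ y ∈ ρ, {x, y} ∈ L.faces := fun x hx y hy =>
      mem_faces_of_subset hρL (Finset.insert_subset hx (Finset.singleton_subset_iff.2 hy))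
        (Finset.insert_nonempty _ _)
    simp only [hagree a b (hpair a ha b hb), hagree b e (hpair b hb e he),
      hagree a e (hpair a ha e he)]
    exact hc ρ hρL a ha b hb e he
  · have hsub : ρ ⊆ insert d σ := by
      rw [hL] at hρL
      by_contra hne
      refine hρL ⟨hρ, ?_⟩
      rintro (rfl | rfl)
      · exact hne (Finset.subset_insert _ _)
      · exact hne Finset.Subset.rfl
    simp only [hsub ha, hsub hb, hsub he, and_self, if_true]
    ring

theorem CollapsesTo.exists_isCocycle [DecidableEq V] (h : K.CollapsesTo L) {c : V → V → ℤ}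
    (hc : L.IsCocycle c) :
    ∃ c' : V → V → ℤ, K.IsCocycle c' ∧ ∀ a b, {a, b} ∈ L.faces → c' a b = c a b := by
  induction h using Relation.ReflTransGen.head_induction_on with
  | refl => exact ⟨c, hc, fun _ _ _ => rfl⟩
  | @head K M h hML ih =>
    obtain ⟨c₁, hc₁, h₁⟩ := ih
    obtain ⟨c₂, hc₂, h₂⟩ := h.exists_isCocycle hc₁
    exact ⟨c₂, hc₂, fun a b hab => (h₂ a b (CollapsesTo.faces_subset hML hab)).trans (h₁ a b hab)⟩

/-- A connected finite graph all of whose `1`-cocycles are coboundaries is a tree, so it is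
collapsible. -/
theorem collapsible_of_graph [DecidableEq V] (hfin : L.faces.Finite) (hne : L.faces.Nonempty)
    (h2 : ∀ σ ∈ L.faces, σ.card ≤ 2)
    (hconn : ∀ P : V → Prop, L.IsLocallyConst P → ∀ a b, {a} ∈ L.faces → {b} ∈ L.faces → P a → P b)
    (hcoc : ∀ c, L.IsCocycle c → ∃ φ : V → ℤ, ∀ a b, {a, b} ∈ L.faces → c a b = φ b - φ a) :
    L.Collapsible := by
  -- A connected collapsible subgraph `P` is enlarged by one leaf at a time; the induction is on the
  -- number of missing faces.
  have key : ∀ n : ℕ, ∀ P : PreAbstractSimplicialComplex V, P.faces ⊆ L.faces → P.Collapsible →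
      (∃ v, {v} ∈ P.faces ∧ ∀ Q : V → Prop, P.IsLocallyConst Q → Q v → ∀ a, {a} ∈ P.faces → Q a) →
      (L.faces \ P.faces).ncard = n → L.Collapsible := by
    intro n
    induction n using Nat.strong_induction_on with
    | _ n ih =>
    intro P hPL hPc ⟨v, hv, hQ⟩ hn
    by_cases hleaf : ∃ a b, {a, b} ∈ L.faces ∧ {a} ∈ P.faces ∧ {b} ∉ P.faces
    · obtain ⟨a, b, hab, ha, hb⟩ := hleaf
      have hne : a ≠ b := by rintro rfl; exact hb ha
      have hbP : ∀ σ ∈ P.faces, b ∉ σ := fun σ hσ hbσ => hb (singleton_mem_faces hσ hbσ)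
      let P' : PreAbstractSimplicialComplex V := ⟨P.faces ∪ {{b}, {a, b}}, by
        rintro σ (hσ | rfl | rfl)
        · exact ⟨nonempty_of_mem_faces hσ, fun τ hτ hne =>
            Or.inl (mem_faces_of_subset hσ hτ hne)⟩
        · refine ⟨Finset.singleton_nonempty _, fun τ hτ hne => Or.inr (Or.inl ?_)⟩
          exact (Finset.Nonempty.subset_singleton_iff hne).1 hτ
        · refine ⟨Finset.insert_nonempty _ _, fun τ hτ hne => ?_⟩
          by_cases hbτ : b ∈ τ
          · by_cases haτ : a ∈ τ
            · exact Or.inr (Or.inr (Finset.Subset.antisymm hτ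
                (Finset.insert_subset haτ (Finset.singleton_subset_iff.2 hbτ))))
            · refine Or.inr (Or.inl ((Finset.Nonempty.subset_singleton_iff hne).1 ?_))
              exact (Finset.subset_insert_iff_of_notMem haτ).1 hτ
          · refine Or.inl ?_
            have : τ ⊆ {a} := by
              intro x hx
              have := hτ hx
              simp only [Finset.mem_insert, Finset.mem_singleton] at this ⊢
              exact this.resolve_right fun h => hbτ (h ▸ hx)
            rwa [(Finset.Nonempty.subset_singleton_iff hne).1 this]⟩
      have hcol : ElementaryCollapse P' P := by
        refine ⟨{b}, {a, b}, ⟨Or.inr (Or.inl rfl), Or.inr (Or.inr rfl), ?_, ?_⟩, ?_⟩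
        · exact Finset.ssubset_insert (by simpa using hne)
        · rintro ρ (hρ | rfl | rfl) hlt
          · exact absurd (hlt.subset (Finset.mem_singleton_self b)) (hbP ρ hρ)
          · exact absurd rfl hlt.ne
          · rfl
        · ext σ
          constructor
          · intro hσ
            refine ⟨Or.inl hσ, ?_⟩
            rintro (rfl | rfl)
            · exact hbP _ hσ (by simp)
            · exact hbP _ hσ (by simp)
          · rintro ⟨hσ | hσ, hσ'⟩
            · exact hσ
            · exact absurd hσ hσ'
      have hbL : {b} ∈ L.faces := singleton_mem_faces hab (by simp)
      refine ih ((L.faces \ P'.faces).ncard) ?_ P' ?_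
        (CollapsesTo.collapsible (Relation.ReflTransGen.single hcol) hPc) ⟨v, Or.inl hv, ?_⟩ rfl
      · rw [← hn]
        refine Set.ncard_lt_ncard ⟨sdiff_subset_sdiff_right subset_union_left, fun hsub => ?_⟩
          (hfin.subset sdiff_subset)
        exact (hsub ⟨hbL, hb⟩).2 (Or.inr (Or.inl rfl))
      · rintro σ (hσ | rfl | rfl)
        · exact hPL hσ
        · exact hbL
        · exact hab
      · intro Q hQloc hQv x hx
        have hold : ∀ x, {x} ∈ P.faces → Q x :=
          hQ Q (fun σ hσ => hQloc σ (Or.inl hσ)) hQv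
        rcases hx with hx | hx | hx
        · exact hold x hx
        · rw [Finset.singleton_injective hx]
          exact hQloc {a, b} (Or.inr (Or.inr rfl)) a (by simp) b (by simp) (hold a ha)
        · have := congrArg Finset.card hx
          rw [Finset.card_singleton, Finset.card_pair hne] at this
          omega
    · push Not at hleaf
      have hvert : ∀ x, {x} ∈ L.faces → {x} ∈ P.faces := by
        refine fun x hx => hconn (fun x => {x} ∈ P.faces) ?_ v x (hPL hv) hx hv
        intro σ hσ a ha b hb haP
        exact hleaf a b (mem_faces_of_subset hσ
          (Finset.insert_subset ha (Finset.singleton_subset_iff.2 hb))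
          (Finset.insert_nonempty _ _)) haP
      suffices h : P.faces = L.faces by rwa [← ext_faces h]
      refine hPL.antisymm fun e he => ?_
      by_contra heP
      have hcard := h2 e he
      have hpos := (nonempty_of_mem_faces he).card_pos
      have hcard2 : e.card = 2 := by
        by_contra h
        obtain ⟨x, rfl⟩ := Finset.card_eq_one.1 (show e.card = 1 by omega)
        exact heP (hvert x he)
      obtain ⟨a, b, hab, rfl⟩ := Finset.card_eq_two.1 hcard2
      -- With all vertices in `P`, a missing edge carries a cocycle that vanishes on `P`. A
      -- potential for it is constant on the connected graph `P`, so the cocycle would vanish on the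
      -- missing edge too.
      let c : V → V → ℤ := fun x y =>
        if x = a ∧ y = b then 1 else if x = b ∧ y = a then -1 else 0
      have hcc : ∀ x, c x x = 0 := by
        intro x
        simp only [c]
        rw [if_neg fun h => hab (h.1.symm.trans h.2), if_neg fun h => hab (h.2.symm.trans h.1)]
      have hcs : ∀ x y, c x y + c y x = 0 := by
        intro x y
        simp only [c]
        by_cases h1 : x = a ∧ y = b
        · rw [if_pos h1, if_neg fun h => hab (h1.1.symm.trans h.2), if_pos h1.symm]
          norm_num
        · rw [if_neg h1]
          by_cases h2 : x = b ∧ y = a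
          · rw [if_pos h2, if_pos h2.symm]
            norm_num
          · rw [if_neg h2, if_neg fun h => h2 h.symm, if_neg fun h => h1 h.symm]
            norm_num
      have hc : L.IsCocycle c := by
        intro σ hσ x hx y hy z hz
        have hσ2 := h2 σ hσ
        by_cases hxy : x = y
        · rw [hxy, hcc, zero_add]
        by_cases hyz : y = z
        · rw [hyz, hcc, add_zero]
        have hxz : x = z := by
          by_contra hxz
          have : ({x, y, z} : Finset V) ⊆ σ := by
            simp [Finset.insert_subset_iff, hx, hy, hz]
          have := Finset.card_le_card this
          rw [Finset.card_eq_three.2 ⟨x, y, z, hxy, hxz, hyz, rfl⟩] at this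
          omega
        rw [hxz, hcc, hcs]
      obtain ⟨φ, hφ⟩ := hcoc c hc
      have hφP : ∀ x, {x} ∈ P.faces → φ x = φ v := by
        refine hQ (fun x => φ x = φ v) ?_ rfl
        intro σ hσ x hx y hy hxv
        have hxy : {x, y} ∈ P.faces := mem_faces_of_subset hσ
          (Finset.insert_subset hx (Finset.singleton_subset_iff.2 hy)) (Finset.insert_nonempty _ _)
        have hzero : c x y = 0 := by
          simp only [c]
          rw [if_neg, if_neg]
          · rintro ⟨rfl, rfl⟩
            exact heP (Finset.pair_comm x y ▸ hxy)
          · rintro ⟨rfl, rfl⟩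
            exact heP hxy
        have := hφ x y (hPL hxy)
        rw [hzero] at this
        show φ y = φ v
        linarith
      have h1 : c a b = 1 := by simp [c]
      have h2 := hφ a b he
      rw [h1, hφP a (hvert a (singleton_mem_faces he (by simp))),
        hφP b (hvert b (singleton_mem_faces he (by simp)))] at h2
      omega
  obtain ⟨σ, hσ⟩ := hne
  obtain ⟨v, hv⟩ := nonempty_of_mem_faces hσ
  let P : PreAbstractSimplicialComplex V := ⟨{{v}}, by
    rintro σ rfl
    exact ⟨Finset.singleton_nonempty _, fun τ hτ hne =>
      (Finset.Nonempty.subset_singleton_iff hne).1 hτ⟩⟩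
  refine key _ P ?_ ⟨P, v, Relation.ReflTransGen.refl, rfl⟩ ⟨v, rfl, ?_⟩ rfl
  · rintro σ rfl
    exact singleton_mem_faces hσ hv
  · intro Q _ hQv a ha
    rwa [Finset.singleton_injective ha]

/-- If a two-dimensional complex `N` collapses to a complex without triangles, then so does every
two-dimensional complex all of whose triangles are triangles of `N`. -/
theorem CollapsesTo.exists_graph (h : N.CollapsesTo L) (hN : ∀ σ ∈ N.faces, σ.card ≤ 3)
    (hL : ∀ σ ∈ L.faces, σ.card ≤ 2) (hM : ∀ σ ∈ M.faces, σ.card ≤ 3)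
    (hMN : ∀ t ∈ M.faces, t.card = 3 → t ∈ N.faces) :
    ∃ G, M.CollapsesTo G ∧ ∀ σ ∈ G.faces, σ.card ≤ 2 := by
  induction h using Relation.ReflTransGen.head_induction_on generalizing M with
  | refl =>
    refine ⟨M, Relation.ReflTransGen.refl, fun σ hσ => ?_⟩
    have h3 := hM σ hσ
    by_contra h2
    have := hL σ (hMN σ hσ (by omega))
    omega
  | @head N N' h hN' ih =>
    obtain ⟨σ, τ, hfree, hN'f⟩ := h
    have hcard := hfree.card_eq
    have hτ3 := hN τ hfree.2.1
    have hN'3 : ∀ σ ∈ N'.faces, σ.card ≤ 3 := fun σ hσ => hN σ (by rw [hN'f] at hσ; exact hσ.1)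
    -- Collapses of triangles present in `M` are repeated there, since a triangle of `M` at the free
    -- edge is also one of `N`. All other collapses are skipped.
    by_cases hτM : τ ∈ M.faces ∧ τ.card = 3
    · have hfreeM : M.IsFreePair σ τ := by
        refine ⟨mem_faces_of_subset hτM.1 hfree.2.2.1.subset (nonempty_of_mem_faces hfree.1), hτM.1,
          hfree.2.2.1, fun ρ hρ hlt => ?_⟩
        have h1 := Finset.card_lt_card hlt
        have h2 := hM ρ hρ
        exact hfree.2.2.2 ρ (hMN ρ hρ (by omega)) hlt
      obtain ⟨M', hM', hM'f⟩ := hfreeM.exists_elementaryCollapse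
      have hsub := hM'.faces_subset
      obtain ⟨G, hG, hG2⟩ := ih hN'3 (M := M') (fun ρ hρ => hM ρ (hsub hρ)) fun t ht ht3 => by
        rw [hN'f]
        refine ⟨hMN t (hsub ht) ht3, ?_⟩
        rw [hM'f] at ht
        exact ht.2
      exact ⟨G, Relation.ReflTransGen.head hM' hG, hG2⟩
    · refine ih hN'3 hM fun t ht ht3 => ?_
      rw [hN'f]
      refine ⟨hMN t ht ht3, ?_⟩
      rintro (rfl | rfl)
      · omega
      · exact hτM ⟨ht, ht3⟩

end PreAbstractSimplicialComplex

namespace PreAbstractSimplicialComplex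

variable {V : Type*} {K L M N : PreAbstractSimplicialComplex V} {σ τ : Finset V}

/-! ### Tetrahedra around a face -/

/-- The graph on the tetrahedra of `K` whose edges are the triangles of `Q` that contain `ρ`. -/
def triangleGraph (K : PreAbstractSimplicialComplex V) (Q : Set (Finset V)) (ρ : Finset V) :
    SimpleGraph (K.Simplices 3) where
  Adj F G := F ≠ G ∧ ∃ t ∈ Q, t.card = 3 ∧ ρ ⊆ t ∧ t ⊆ F.1 ∧ t ⊆ G.1
  symm := ⟨fun _ _ h => ⟨h.1.symm, h.2.imp fun _ h => ⟨h.1, h.2.1, h.2.2.1, h.2.2.2.2, h.2.2.2.1⟩⟩⟩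
  loopless := ⟨fun _ h => h.1 rfl⟩

theorem subset_triangle_of_subset {F G : K.Simplices 3} (hne : F ≠ G) {t : Finset V}
    (ht : t.card = 3) (htF : t ⊆ F.1) (htG : t ⊆ G.1) {ρ : Finset V} (hρF : ρ ⊆ F.1)
    (hρG : ρ ⊆ G.1) : ρ ⊆ t := by
  classical
  have hF := F.2.2
  have hG := G.2.2
  have hsub : t ⊆ F.1 ∩ G.1 := Finset.subset_inter htF htG
  have hlt : (F.1 ∩ G.1).card < 4 := by
    by_contra! h
    have h1 : F.1 ∩ G.1 = F.1 :=
      Finset.eq_of_subset_of_card_le Finset.inter_subset_left (by omega)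
    have h2 : F.1 ∩ G.1 = G.1 :=
      Finset.eq_of_subset_of_card_le Finset.inter_subset_right (by omega)
    exact hne (Subtype.ext (h1.symm.trans h2))
  have heq := Finset.eq_of_subset_of_card_le hsub (by omega)
  rw [heq]
  exact Finset.subset_inter hρF hρG

theorem triangle_eq {F G : K.Simplices 3} (hne : F ≠ G) {t t' : Finset V} (ht : t.card = 3)
    (htF : t ⊆ F.1) (htG : t ⊆ G.1) (ht' : t'.card = 3) (htF' : t' ⊆ F.1) (htG' : t' ⊆ G.1) :
    t' = t :=
  Finset.eq_of_subset_of_card_le (subset_triangle_of_subset hne ht htF htG htF' htG') (by omega)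

theorem eq_of_tetrahedron_subset {F : K.Simplices 3} {σ : Finset V} (h : F.1 ⊆ σ)
    (hσ : σ.card ≤ 4) : F.1 = σ :=
  Finset.eq_of_subset_of_card_le h (by rw [F.2.2]; exact hσ)


namespace IsSphereLike

theorem card_le (hK : K.IsSphereLike) (hσ : σ ∈ K.faces) : σ.card ≤ 4 := by
  obtain ⟨F, -, hF, hsub⟩ := hK.exists_tetrahedron σ hσ
  exact (Finset.card_le_card hsub).trans_eq hF

theorem finite_simplices (hK : K.IsSphereLike) : Finite (K.Simplices 3) :=
  (hK.finite.subset (t := {σ | σ ∈ K.faces ∧ σ.card = 3 + 1}) fun _ h => h.1).to_subtype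

theorem exists_simplex (hK : K.IsSphereLike) (hσ : σ ∈ K.faces) : ∃ F : K.Simplices 3, σ ⊆ F.1 := by
  obtain ⟨F, hF, hF4, hsub⟩ := hK.exists_tetrahedron σ hσ
  exact ⟨⟨F, hF, hF4⟩, hsub⟩

theorem exists_other (hK : K.IsSphereLike) (F : K.Simplices 3) {t : Finset V} (ht : t.card = 3)
    (htF : t ⊆ F.1) : ∃ G : K.Simplices 3, F ≠ G ∧ t ⊆ G.1 ∧
      ∀ H : K.Simplices 3, t ⊆ H.1 → H = F ∨ H = G := by
  have htK : t ∈ K.faces := mem_faces_of_subset F.2.1 htF (Finset.card_pos.1 (by omega))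
  obtain ⟨A, B, hA, hB, hA4, hB4, hAB, htA, htB, huniq⟩ := hK.triangle t htK ht
  have huniq' : ∀ H : K.Simplices 3, t ⊆ H.1 → H = ⟨A, hA, hA4⟩ ∨ H = ⟨B, hB, hB4⟩ := by
    intro H hH
    have hne : t ≠ H.1 := fun h => by have := H.2.2; rw [← h] at this; omega
    exact (huniq H.1 H.2.1 (hH.ssubset_of_ne hne)).imp Subtype.ext Subtype.ext
  rcases huniq' F htF with rfl | rfl
  · exact ⟨⟨B, hB, hB4⟩, fun h => hAB (congrArg Subtype.val h), htB, huniq'⟩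
  · exact ⟨⟨A, hA, hA4⟩, fun h => hAB (congrArg Subtype.val h).symm, htA,
      fun H hH => (huniq' H hH).symm⟩

theorem eq_or_eq (hK : K.IsSphereLike) {F G H : K.Simplices 3} (hne : F ≠ G) {t : Finset V}
    (ht : t.card = 3) (htF : t ⊆ F.1) (htG : t ⊆ G.1) (htH : t ⊆ H.1) : H = F ∨ H = G := by
  obtain ⟨G', -, -, h⟩ := hK.exists_other F ht htF
  rcases h G htG with h' | rfl
  · exact absurd h'.symm hne
  · exact h H htH

theorem sym2_eq (hK : K.IsSphereLike) {F G F' G' : K.Simplices 3} (hne : F ≠ G) (hne' : F' ≠ G')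
    {t : Finset V} (ht : t.card = 3) (htF : t ⊆ F.1) (htG : t ⊆ G.1) (htF' : t ⊆ F'.1)
    (htG' : t ⊆ G'.1) : s(F', G') = s(F, G) := by
  rcases hK.eq_or_eq hne ht htF htG htF' with rfl | rfl <;>
    rcases hK.eq_or_eq hne ht htF htG htG' with rfl | rfl
  · exact absurd rfl hne'
  · rfl
  · exact Sym2.eq_swap
  · exact absurd rfl hne'

theorem triangleGraph_reachable (hK : K.IsSphereLike) {ρ : Finset V} (hρ : ρ ∈ K.faces)
    (hcard : ρ.card ≤ 2) {F G : K.Simplices 3} (hF : ρ ⊆ F.1) (hG : ρ ⊆ G.1) :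
    (K.triangleGraph univ ρ).Reachable F G := by
  have := hK.star_connected ρ hρ hcard
    (fun X => ∃ h : X ∈ K.faces ∧ X.card = 3 + 1, (K.triangleGraph univ ρ).Reachable F ⟨X, h⟩)
    ?_ F.1 F.2.1 G.1 G.2.1 F.2.2 G.2.2 hF hG ⟨F.2, SimpleGraph.Reachable.refl _⟩
  · exact this.2
  · rintro A hA B hB hA4 hB4 t ht hρt htA htB ⟨h, hFA⟩
    refine ⟨⟨hB, hB4⟩, ?_⟩
    by_cases hAB : A = B
    · subst hAB
      exact hFA
    · refine hFA.trans (SimpleGraph.Adj.reachable ⟨?_, t, mem_univ _, ht, hρt, htA, htB⟩)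
      exact fun h => hAB (congrArg Subtype.val h)

/-- Tetrahedra at a common vertex are connected, and faces lead from any vertex to any other. -/
theorem dualGraph_reachable (hK : K.IsSphereLike) (F G : K.Simplices 3) :
    (K.dualGraph 3).Reachable F G := by
  have hstar : ∀ {v : V} {A B : K.Simplices 3}, v ∈ A.1 → v ∈ B.1 →
      (K.dualGraph 3).Reachable A B := by
    intro v A B hA hB
    refine (hK.triangleGraph_reachable (singleton_mem_faces A.2.1 hA) (by simp)
      (Finset.singleton_subset_iff.2 hA) (Finset.singleton_subset_iff.2 hB)).mono ?_
    rintro X Y ⟨hne, t, -, ht, -, htX, htY⟩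
    exact ⟨hne, t, ht, htX, htY⟩
  obtain ⟨a, ha⟩ := nonempty_of_mem_faces F.2.1
  obtain ⟨b, hb⟩ := nonempty_of_mem_faces G.2.1
  refine hK.connected (fun v => ∀ A : K.Simplices 3, v ∈ A.1 → (K.dualGraph 3).Reachable F A) ?_
    a b (singleton_mem_faces F.2.1 ha) (singleton_mem_faces G.2.1 hb) (fun A hA => hstar ha hA) G hb
  intro σ hσ x hx y hy hP A hyA
  obtain ⟨B, hB⟩ := hK.exists_simplex hσ
  exact (hP B (hB hx)).trans (hstar (hB hy) hyA)

/-- A tetrahedron at `e` has exactly two triangles containing `e`, and these lead to two different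
neighbours. -/
theorem isCycles_triangleGraph (hK : K.IsSphereLike) {e : Finset V} (he : e.card = 2) :
    (K.triangleGraph univ e).IsCycles := by
  classical
  rintro F ⟨G, -, t, -, -, het, htF, -⟩
  have heF := het.trans htF
  have hF := F.2.2
  obtain ⟨x, y, hxy, hxye⟩ := Finset.card_eq_two.1
    (show (F.1 \ e).card = 2 by rw [Finset.card_sdiff_of_subset heF]; omega)
  have hx : x ∈ F.1 \ e := by rw [hxye]; simp
  have hy : y ∈ F.1 \ e := by rw [hxye]; simp
  rw [Finset.mem_sdiff] at hx hy
  have hcx : (insert x e).card = 3 := by rw [Finset.card_insert_of_notMem hx.2, he]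
  have hcy : (insert y e).card = 3 := by rw [Finset.card_insert_of_notMem hy.2, he]
  have hxF : insert x e ⊆ F.1 := Finset.insert_subset hx.1 heF
  have hyF : insert y e ⊆ F.1 := Finset.insert_subset hy.1 heF
  obtain ⟨X, hFX, hxX, hX⟩ := hK.exists_other F hcx hxF
  obtain ⟨Y, hFY, hyY, hY⟩ := hK.exists_other F hcy hyF
  have hXY : X ≠ Y := by
    rintro rfl
    have := triangle_eq hFX hcx hxF hxX hcy hyF hyY
    have hmem : y ∈ insert x e := this ▸ Finset.mem_insert_self _ _
    rcases Finset.mem_insert.1 hmem with h | h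
    · exact hxy h.symm
    · exact hy.2 h
  suffices h : (K.triangleGraph univ e).neighborSet F = {X, Y} by rw [h, ncard_pair hXY]
  ext H
  simp only [SimpleGraph.mem_neighborSet, mem_insert_iff, mem_singleton_iff]
  constructor
  · rintro ⟨hne, t', -, ht', het', htF', htH'⟩
    obtain ⟨z, hz, rfl⟩ := Finset.exists_eq_insert_iff.2 ⟨het', by omega⟩
    have hz' : z ∈ F.1 \ e := Finset.mem_sdiff.2 ⟨htF' (Finset.mem_insert_self _ _), hz⟩
    rw [hxye, Finset.mem_insert, Finset.mem_singleton] at hz'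
    rcases hz' with rfl | rfl
    · exact Or.inl ((hX H htH').resolve_left hne.symm)
    · exact Or.inr ((hY H htH').resolve_left hne.symm)
  · rintro (rfl | rfl)
    · exact ⟨hFX, _, mem_univ _, hcx, Finset.subset_insert _ _, hxF, hxX⟩
    · exact ⟨hFY, _, mem_univ _, hcy, Finset.subset_insert _ _, hyF, hyY⟩

/-- Around an edge `e`, the tetrahedra form a single cycle. So if two tetrahedra that share a
triangle `t` are connected around `e` through triangles of `Q`, then any triangle around `e` other
than `t` lies in `Q`. -/
theorem mem_of_reachable (hK : K.IsSphereLike) {e t t' : Finset V} {Q : Set (Finset V)}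
    {F G : K.Simplices 3} (he : e.card = 2) (hne : F ≠ G) (ht : t.card = 3) (het : e ⊆ t)
    (htF : t ⊆ F.1) (htG : t ⊆ G.1) (htQ : t ∉ Q) (hreach : (K.triangleGraph Q e).Reachable F G)
    (ht' : t' ∈ K.faces) (ht'3 : t'.card = 3) (het' : e ⊆ t') (htt' : t' ≠ t) : t' ∈ Q := by
  classical
  have := hK.finite_simplices
  let H := K.triangleGraph univ e
  have := Fintype.ofFinite (K.Simplices 3)
  have : H.LocallyFinite := fun v => Fintype.ofFinite _
  have hle : K.triangleGraph Q e ≤ H := fun A B h =>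
    ⟨h.1, h.2.imp fun _ h => ⟨mem_univ _, h.2⟩⟩
  have hadj : H.Adj G F := ⟨hne.symm, t, mem_univ _, ht, het, htG, htF⟩
  obtain ⟨p, hp⟩ := hreach.exists_isPath
  have hnot : s(G, F) ∉ (p.mapLe hle).edges := by
    rw [SimpleGraph.Walk.edges_mapLe_eq_edges]
    intro hmem
    obtain ⟨-, t₁, ht₁Q, ht₁, -, ht₁G, ht₁F⟩ :=
      (SimpleGraph.mem_edgeSet _).1 (p.edges_subset_edgeSet hmem)
    exact htQ (triangle_eq hne ht htF htG ht₁ ht₁F ht₁G ▸ ht₁Q)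
  -- The path through `Q` closes up across `t` to a cycle. In a connected graph all of whose
  -- vertices have degree two, such a cycle uses every edge, so it crosses every triangle at `e`.
  have hc : ((p.mapLe hle).cons hadj).IsCycle :=
    (SimpleGraph.Walk.cons_isCycle_iff _ _).2 ⟨hp.mapLe hle, hnot⟩
  have hcyc : H.IsCycles := hK.isCycles_triangleGraph he
  let c := (p.mapLe hle).cons hadj
  have hiff : ∀ v ∈ c.toSubgraph.verts, ∀ w, c.toSubgraph.Adj v w ↔ H.Adj v w := fun v hv =>
    hc.adj_toSubgraph_iff_of_isCycles hcyc hv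
  obtain ⟨A, hA⟩ := hK.exists_simplex ht'
  obtain ⟨B, hAB, hB, -⟩ := hK.exists_other A ht'3 hA
  have hverts : ∀ X, H.Reachable G X → X ∈ c.toSubgraph.verts := by
    rintro X ⟨q⟩
    have : ∀ {Y Z : K.Simplices 3} (q : H.Walk Y Z), Y ∈ c.toSubgraph.verts →
        Z ∈ c.toSubgraph.verts := by
      intro Y Z q
      induction q with
      | nil => exact id
      | cons h _ ih => exact fun hY => ih (((hiff _ hY _).2 h).snd_mem)
    exact this q (SimpleGraph.Walk.start_mem_verts_toSubgraph _)
  have heK : e ∈ K.faces := mem_faces_of_subset ht' het' (Finset.card_pos.1 (by omega))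
  have hGA := hK.triangleGraph_reachable heK he.le (het.trans htG) (het'.trans hA)
  have hABadj : c.toSubgraph.Adj A B :=
    (hiff A (hverts A hGA) B).2 ⟨hAB, t', mem_univ _, ht'3, het', hA, hB⟩
  have hmem : s(A, B) ∈ c.edges := (SimpleGraph.Walk.mem_edges_toSubgraph c).1 hABadj
  rw [SimpleGraph.Walk.edges_cons, SimpleGraph.Walk.edges_mapLe_eq_edges, List.mem_cons] at hmem
  rcases hmem with h | h
  · exfalso
    have htA : t ⊆ A.1 ∧ t ⊆ B.1 := by
      rcases Sym2.eq_iff.1 h with ⟨rfl, rfl⟩ | ⟨rfl, rfl⟩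
      · exact ⟨htG, htF⟩
      · exact ⟨htF, htG⟩
    exact htt' (triangle_eq hAB ht htA.1 htA.2 ht'3 hA hB)
  · obtain ⟨-, t₁, ht₁Q, ht₁, -, ht₁A, ht₁B⟩ :=
      (SimpleGraph.mem_edgeSet _).1 (p.edges_subset_edgeSet h)
    exact triangle_eq hAB ht'3 hA hB ht₁ ht₁A ht₁B ▸ ht₁Q

/-- Conversely, if all triangles around `e` other than `t` lie in `Q`, then the two tetrahedra at
`t` are connected around `e` through triangles of `Q`. -/
theorem reachable_of_forall_mem (hK : K.IsSphereLike) {e t : Finset V} {Q : Set (Finset V)}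
    {F G : K.Simplices 3} (he : e.card = 2) (hne : F ≠ G) (ht : t.card = 3) (het : e ⊆ t)
    (htF : t ⊆ F.1) (htG : t ⊆ G.1)
    (hQ : ∀ t' ∈ K.faces, t'.card = 3 → e ⊆ t' → t' ≠ t → t' ∈ Q) :
    (K.triangleGraph Q e).Reachable F G := by
  have := hK.finite_simplices
  have hadj : (K.triangleGraph univ e).Adj F G := ⟨hne, t, mem_univ _, ht, het, htF, htG⟩
  refine ((hK.isCycles_triangleGraph he).reachable_deleteEdges hadj).mono ?_
  intro A B hAB
  rw [SimpleGraph.deleteEdges_adj] at hAB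
  obtain ⟨⟨hAB, t', -, ht', het', htA, htB⟩, hnot⟩ := hAB
  refine ⟨hAB, t', hQ t' (mem_faces_of_subset A.2.1 htA (Finset.card_pos.1 (by omega))) ht' het' ?_,
    ht', het', htA, htB⟩
  rintro rfl
  exact hnot (hK.sym2_eq hne hAB ht htF htG htA htB)

/-! ### Collapsing a sphere minus a tetrahedron -/

/-- A graph to which `K` minus a tetrahedron collapses is a tree. -/
theorem collapsible_of_collapsesTo_graph (hK : K.IsSphereLike) (Δ : K.Simplices 3)
    (h : (K.deleteFace Δ.1).CollapsesTo L) (h2 : ∀ σ ∈ L.faces, σ.card ≤ 2) : L.Collapsible := by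
  classical
  have hDK : ∀ σ ∈ K.faces, σ.card ≤ 3 → σ ∈ (K.deleteFace Δ.1).faces := fun σ hσ h3 =>
    ⟨hσ, fun hsub => by have := Finset.card_le_card hsub; rw [Δ.2.2] at this; omega⟩
  have hLK : L.faces ⊆ K.faces := h.faces_subset.trans fun _ h => h.1
  have htriple : ∀ {σ} {a b d : V}, σ ∈ K.faces → a ∈ σ → b ∈ σ → d ∈ σ →
      {a, b, d} ∈ (K.deleteFace Δ.1).faces := by
    intro σ a b d hσ ha hb hd
    refine hDK _ (mem_faces_of_subset hσ ?_ (Finset.insert_nonempty _ _)) Finset.card_le_three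
    simp [Finset.insert_subset_iff, ha, hb, hd]
  refine collapsible_of_graph (hK.finite.subset hLK) (h.nonempty ?_) h2 ?_ ?_
  · obtain ⟨σ, hσ⟩ := hK.nonempty
    obtain ⟨v, hv⟩ := nonempty_of_mem_faces hσ
    exact ⟨_, htriple hσ hv hv hv⟩
  · intro P hP a b ha hb
    obtain ⟨P', hP', hPP'⟩ := h.exists_isLocallyConst hP
    rw [← hPP' a ha, ← hPP' b hb]
    refine hK.connected P' (fun σ hσ x hx y hy => ?_) a b (hLK ha) (hLK hb)
    exact hP' _ (htriple hσ hx hx hy) x (by simp) y (by simp)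
  -- A cocycle of the graph extends backwards over the collapses to `K` minus `Δ`, hence to `K`,
  -- since the cocycle condition only involves faces with at most three vertices.
  · intro c hc
    obtain ⟨c', hc', hcc'⟩ := h.exists_isCocycle hc
    obtain ⟨φ, hφ⟩ := hK.cocycle c' fun σ hσ a ha b hb d hd =>
      hc' _ (htriple hσ ha hb hd) a (by simp) b (by simp) d (by simp)
    exact ⟨φ, fun a b hab => hcc' a b hab ▸ hφ _ (hLK hab) a (by simp) b (by simp)⟩

/-- When tetrahedra are removed from `K` by elementary collapses, starting from `Δ`, the removed
tetrahedra remain connected through removed triangles. -/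
theorem reachable_of_notMem (hK : K.IsSphereLike) (Δ : K.Simplices 3)
    (h : (K.deleteFace Δ.1).CollapsesTo L) (F : K.Simplices 3) (hF : F.1 ∉ L.faces) :
    (K.triangleGraph L.facesᶜ ∅).Reachable Δ F := by
  induction h generalizing F with
  | refl =>
    by_cases hFΔ : F = Δ
    · rw [hFΔ]
    · refine absurd ⟨F.2.1, fun hsub => hFΔ (Subtype.ext ?_)⟩ hF
      exact (eq_of_tetrahedron_subset hsub F.2.2.le).symm
  | @tail M L hM h ih =>
    have hle : K.triangleGraph M.facesᶜ ∅ ≤ K.triangleGraph L.facesᶜ ∅ := fun A B hAB =>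
      ⟨hAB.1, hAB.2.imp fun t ht => ⟨fun htL => ht.1 (h.faces_subset htL), ht.2⟩⟩
    by_cases hFM : F.1 ∈ M.faces
    · have hMK : M.faces ⊆ K.faces := (CollapsesTo.faces_subset hM).trans fun _ h => h.1
      obtain ⟨σ, τ, hfree, hL⟩ := h
      have hF' : F.1 = σ ∨ F.1 = τ := by
        rw [hL] at hF
        by_contra hne
        exact hF ⟨hFM, hne⟩
      have hFτ : F.1 = τ := by
        refine hF'.resolve_left fun hFσ => ?_
        have h1 := hfree.card_eq
        have h2 := hK.card_le (hMK hfree.2.1)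
        rw [← hFσ, F.2.2] at h1
        omega
      have hσ3 : σ.card = 3 := by
        have := hfree.card_eq
        rw [← hFτ, F.2.2] at this
        omega
      have hσF : σ ⊆ F.1 := hFτ ▸ hfree.2.2.1.subset
      obtain ⟨G, hFG, hσG, -⟩ := hK.exists_other F hσ3 hσF
      have hGM : G.1 ∉ M.faces := by
        intro hGM
        have : σ ≠ G.1 := fun h => by rw [h, G.2.2] at hσ3; omega
        exact hFG (Subtype.ext (hFτ.trans (hfree.2.2.2 _ hGM (hσG.ssubset_of_ne this)).symm))
      refine ((ih G hGM).mono hle).trans (SimpleGraph.Adj.reachable ?_)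
      refine ⟨hFG.symm, σ, fun hσL => ?_, hσ3, Finset.empty_subset _, hσG, hσF⟩
      rw [hL] at hσL
      exact hσL.2 (by simp)
    · exact (ih F hFM).mono hle

/-- If the tetrahedra of `K` are connected through the triangles of `Q`, then the tetrahedra that
remain in a subcomplex with fewer tetrahedra can be removed by elementary collapses which only
remove triangles in `Q`. -/
theorem exists_collapsesTo_of_connected (hK : K.IsSphereLike) {Q : Set (Finset V)}
    (hQ : ∀ F G : K.Simplices 3, (K.triangleGraph Q ∅).Reachable F G) (hLK : L.faces ⊆ K.faces)
    (hL : ∃ Δ : K.Simplices 3, Δ.1 ∉ L.faces) :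
    ∃ M, L.CollapsesTo M ∧ (∀ σ ∈ M.faces, σ.card ≤ 3) ∧
      ∀ σ ∈ L.faces, σ.card ≤ 3 → σ ∉ Q → σ ∈ M.faces := by
  obtain ⟨n, hn⟩ : ∃ n, L.faces.ncard = n := ⟨_, rfl⟩
  induction n using Nat.strong_induction_on generalizing L with
  | _ n ih =>
  by_cases h4 : ∀ σ ∈ L.faces, σ.card ≤ 3
  · exact ⟨L, Relation.ReflTransGen.refl, h4, fun σ hσ _ _ => hσ⟩
  push Not at h4
  obtain ⟨σ, hσ, hσ4⟩ := h4
  have hσ4' := hK.card_le (hLK hσ)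
  obtain ⟨Δ, hΔ⟩ := hL
  -- A path to a removed tetrahedron crosses from present to removed ones at some triangle of `Q`,
  -- which is therefore free.
  have hstep : ∃ F G : K.Simplices 3, (K.triangleGraph Q ∅).Adj F G ∧ F.1 ∈ L.faces ∧
      G.1 ∉ L.faces := by
    by_contra! hno
    have : ∀ {A B : K.Simplices 3} (_ : (K.triangleGraph Q ∅).Walk A B), A.1 ∈ L.faces →
        B.1 ∈ L.faces := by
      intro A B p
      induction p with
      | nil => exact id
      | cons h _ ih => exact fun hA => ih (hno _ _ h hA)
    obtain ⟨p⟩ := hQ ⟨σ, hLK hσ, by omega⟩ Δ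
    exact hΔ (this p hσ)
  obtain ⟨F, G, ⟨hFG, t, htQ, ht, -, htF, htG⟩, hF, hG⟩ := hstep
  have htFne : t ≠ F.1 := fun h => by rw [h, F.2.2] at ht; omega
  have hfree : L.IsFreePair t F.1 := by
    refine ⟨mem_faces_of_subset hF htF (Finset.card_pos.1 (by omega)), hF,
      htF.ssubset_of_ne htFne, fun ρ hρ hlt => ?_⟩
    have hρ4 : ρ.card = 4 := by
      have := Finset.card_lt_card hlt
      have := hK.card_le (hLK hρ)
      omega
    rcases hK.eq_or_eq (H := ⟨ρ, hLK hρ, hρ4⟩) hFG ht htF htG hlt.subset with h | h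
    · exact congrArg Subtype.val h
    · exact absurd (congrArg Subtype.val h ▸ hρ) hG
  obtain ⟨L', hL', hL'f⟩ := hfree.exists_elementaryCollapse
  have hsub := hL'.faces_subset
  have hFL' : F.1 ∉ L'.faces := fun h => by rw [hL'f] at h; exact h.2 (by simp)
  obtain ⟨M, hM, hM3, hMQ⟩ := ih L'.faces.ncard
    (hn ▸ Set.ncard_lt_ncard ⟨hsub, fun h => hFL' (h hF)⟩ (hK.finite.subset hLK))
    (hsub.trans hLK) ⟨F, hFL'⟩ rfl
  refine ⟨M, Relation.ReflTransGen.head hL' hM, hM3, fun σ hσ hσ3 hσQ => hMQ σ ?_ hσ3 hσQ⟩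
  rw [hL'f]
  refine ⟨hσ, ?_⟩
  rintro (rfl | rfl)
  · exact hσQ htQ
  · rw [F.2.2] at hσ3
    omega

end IsSphereLike

end PreAbstractSimplicialComplex

namespace PreAbstractSimplicialComplex

variable {V : Type*} {K L M N : PreAbstractSimplicialComplex V} {σ τ : Finset V}

/-! ### Spanning trees of the dual graph and collapses onto `K^T` -/

/-- The triangles that are crossed by the subgraph `T` of the dual graph. -/
def crossedTriangles (T : SimpleGraph (K.Simplices 3)) : Set (Finset V) :=
  {t | ∃ F G : K.Simplices 3, T.Adj F G ∧ t ⊆ F.1 ∧ t ⊆ G.1}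

theorem mem_cutComplex {T : SimpleGraph (K.Simplices 3)} :
    σ ∈ (K.cutComplex 3 T).faces ↔
      σ.Nonempty ∧ ∃ ρ ∈ K.faces, ρ.card = 3 ∧ σ ⊆ ρ ∧ ρ ∉ crossedTriangles T :=
  Iff.rfl

theorem mem_cutComplex_of_card_eq {T : SimpleGraph (K.Simplices 3)} (hσ : σ.card = 3) :
    σ ∈ (K.cutComplex 3 T).faces ↔ σ ∈ K.faces ∧ σ ∉ crossedTriangles T := by
  constructor
  · rintro ⟨-, ρ, hρ, hρ3, hsub, hρT⟩
    have := Finset.eq_of_subset_of_card_le hsub (by omega)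
    exact this ▸ ⟨hρ, hρT⟩
  · exact fun h => ⟨nonempty_of_mem_faces h.1, σ, h.1, hσ, Finset.Subset.rfl, h.2⟩

theorem card_le_of_mem_cutComplex {T : SimpleGraph (K.Simplices 3)}
    (hσ : σ ∈ (K.cutComplex 3 T).faces) : σ.card ≤ 3 := by
  obtain ⟨-, ρ, -, hρ3, hsub, -⟩ := hσ
  exact (Finset.card_le_card hsub).trans_eq hρ3

namespace IsSphereLike

theorem adj_of_mem_crossedTriangles (hK : K.IsSphereLike) {T : SimpleGraph (K.Simplices 3)}
    {t : Finset V} (ht : t ∈ crossedTriangles T) (ht3 : t.card = 3) {F G : K.Simplices 3}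
    (hne : F ≠ G) (htF : t ⊆ F.1) (htG : t ⊆ G.1) : T.Adj F G := by
  obtain ⟨F', G', hadj, htF', htG'⟩ := ht
  have := hK.sym2_eq hne hadj.ne ht3 htF htG htF' htG'
  rw [← SimpleGraph.mem_edgeSet, ← this]
  exact hadj

theorem triangleGraph_crossedTriangles (hK : K.IsSphereLike) {T : SimpleGraph (K.Simplices 3)}
    (hT : T ≤ K.dualGraph 3) : K.triangleGraph (crossedTriangles T) ∅ = T := by
  ext F G
  constructor
  · rintro ⟨hne, t, ht, ht3, -, htF, htG⟩
    exact hK.adj_of_mem_crossedTriangles ht ht3 hne htF htG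
  · intro h
    obtain ⟨hne, t, ht, htF, htG⟩ := hT h
    exact ⟨hne, t, ⟨F, G, h, htF, htG⟩, ht, Finset.empty_subset _, htF, htG⟩

/-- Any edge lies in a triangle that the spanning tree `T` does not cross. -/
theorem exists_notMem_crossedTriangles (hK : K.IsSphereLike) {T : SimpleGraph (K.Simplices 3)}
    (hT : T.IsAcyclic) {e : Finset V} (heK : e ∈ K.faces) (he : e.card ≤ 2) :
    ∃ t ∈ K.faces, t.card = 3 ∧ e ⊆ t ∧ t ∉ crossedTriangles T := by
  classical
  obtain ⟨F, heF⟩ := hK.exists_simplex heK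
  have hF := F.2.2
  obtain ⟨e', hee', heF', he'⟩ := Finset.exists_subsuperset_card_eq heF he (by omega)
  by_contra! hno
  replace hno : ∀ t ∈ K.faces, t.card = 3 → e' ⊆ t → t ∈ crossedTriangles T := fun t ht ht3 hsub =>
    hno t ht ht3 (hee'.trans hsub)
  obtain ⟨t, het, htF, ht⟩ :=
    Finset.exists_subsuperset_card_eq (n := 3) heF' (by omega) (by omega)
  have htK : t ∈ K.faces := mem_faces_of_subset F.2.1 htF (Finset.card_pos.1 (by omega))
  obtain ⟨G, hFG, htG, -⟩ := hK.exists_other F ht htF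
  have hadj := hK.adj_of_mem_crossedTriangles (hno t htK ht het) ht hFG htF htG
  -- If all triangles around `e'` were crossed, the cycle of tetrahedra there would lie in `T`, and
  -- the edge across `t` would not be a bridge.
  refine SimpleGraph.isAcyclic_iff_forall_adj_isBridge.1 hT hadj ?_
  refine (hK.reachable_of_forall_mem (Q := {t}ᶜ) he' hFG ht het htF htG
    fun t' _ _ _ h => h).mono ?_
  rintro A B ⟨hAB, t', htt', ht', het', htA, htB⟩
  have htK' : t' ∈ K.faces := mem_faces_of_subset A.2.1 htA (Finset.card_pos.1 (by omega))
  rw [SimpleGraph.deleteEdges_adj]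
  refine ⟨hK.adj_of_mem_crossedTriangles (hno t' htK' ht' het') ht' hAB htA htB, fun h => htt' ?_⟩
  rcases Sym2.eq_iff.1 h with ⟨rfl, rfl⟩ | ⟨rfl, rfl⟩
  · exact triangle_eq hFG ht htF htG ht' htA htB
  · exact triangle_eq hFG ht htF htG ht' htB htA

/-- `K` minus a tetrahedron collapses to `K^T`, for any spanning tree `T` of the dual graph. -/
theorem collapsesTo_cutComplex (hK : K.IsSphereLike) (Δ : K.Simplices 3)
    {T : SimpleGraph (K.Simplices 3)} (hT : K.IsDualSpanningTree 3 T) :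
    (K.deleteFace Δ.1).CollapsesTo (K.cutComplex 3 T) := by
  have hDK : ∀ σ ∈ K.faces, σ.card ≤ 3 → σ ∈ (K.deleteFace Δ.1).faces := fun σ hσ h3 =>
    ⟨hσ, fun hsub => by have := Finset.card_le_card hsub; rw [Δ.2.2] at this; omega⟩
  obtain ⟨M, hM, hM3, hMT⟩ := hK.exists_collapsesTo_of_connected (Q := crossedTriangles T)
    (L := K.deleteFace Δ.1)
    (fun F G => by
      rw [hK.triangleGraph_crossedTriangles hT.1]
      exact hT.2.connected.preconnected F G)
    (fun _ h => h.1) ⟨Δ, fun h => h.2 Finset.Subset.rfl⟩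
  have hMK : M.faces ⊆ K.faces := hM.faces_subset.trans fun _ h => h.1
  have hle : K.triangleGraph M.facesᶜ ∅ ≤ T := by
    rintro A B ⟨hAB, t, htM, ht, -, htA, htB⟩
    have htK : t ∈ K.faces := mem_faces_of_subset A.2.1 htA (Finset.card_pos.1 (by omega))
    refine hK.adj_of_mem_crossedTriangles ?_ ht hAB htA htB
    by_contra htT
    exact htM (hMT t (hDK t htK ht.le) ht.le htT)
  have hconn : (K.triangleGraph M.facesᶜ ∅).Connected := by
    have hnot : ∀ F : K.Simplices 3, F.1 ∉ M.faces := fun F hF => by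
      have := hM3 _ hF
      rw [F.2.2] at this
      omega
    have : Nonempty (K.Simplices 3) := ⟨Δ⟩
    exact ⟨fun F G => (hK.reachable_of_notMem Δ hM F (hnot F)).symm.trans
      (hK.reachable_of_notMem Δ hM G (hnot G))⟩
  -- The removed triangles form a connected spanning subgraph of `T`; trees are minimal connected,
  -- so precisely the crossed triangles have been removed.
  have hTle : T ≤ K.triangleGraph M.facesᶜ ∅ :=
    (SimpleGraph.isTree_iff_minimal_connected.1 hT.2).2 hconn hle
  suffices h : M = K.cutComplex 3 T by rwa [← h]
  refine ext_faces (Subset.antisymm (fun σ hσ => ?_) fun σ hσ => ?_)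
  · rcases (hM3 σ hσ).lt_or_eq with h | h
    · obtain ⟨t, htK, ht, hσt, htT⟩ :=
        hK.exists_notMem_crossedTriangles hT.2.isAcyclic (hMK hσ) (show σ.card ≤ 2 by omega)
      exact ⟨nonempty_of_mem_faces hσ, t, htK, ht, hσt, htT⟩
    · refine (mem_cutComplex_of_card_eq h).2 ⟨hMK hσ, ?_⟩
      rintro ⟨A, B, hAB, hσA, hσB⟩
      obtain ⟨hne, t, htM, ht, -, htA, htB⟩ := hTle hAB
      exact htM (triangle_eq hne ht htA htB h hσA hσB ▸ hσ)
  · obtain ⟨hne, ρ, hρ, hρ3, hsub, hρT⟩ := mem_cutComplex.1 hσ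
    exact mem_faces_of_subset (hMT ρ (hDK ρ hρ hρ3.le) hρ3.le hρT) hsub hne

/-- The spanning tree is chosen after the collapse: it crosses only triangles missing from `M`, so
the triangles of `M` belong to `K^T` and a collapse of `K^T` can be replayed on them. -/
theorem extensivelyCollapsible_deleteFace (hK : K.IsSphereLike)
    (h : ∀ T : SimpleGraph (K.Simplices 3), K.IsDualSpanningTree 3 T →
      (K.cutComplex 3 T).Collapsible) (Δ : K.Simplices 3) :
    (K.deleteFace Δ.1).ExtensivelyCollapsible := by
  intro L hL
  have hLK : L.faces ⊆ K.faces := hL.faces_subset.trans fun _ h => h.1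
  obtain ⟨M, hM, hM3, -⟩ := hK.exists_collapsesTo_of_connected (Q := univ) (L := L)
    (fun F G => (hK.dualGraph_reachable F G).mono
      (show K.dualGraph 3 ≤ K.triangleGraph univ ∅ from fun A B hAB =>
        ⟨hAB.1, hAB.2.imp fun _ h => ⟨mem_univ _, h.1, Finset.empty_subset _, h.2⟩⟩))
    hLK ⟨Δ, fun h => (hL.faces_subset h).2 Finset.Subset.rfl⟩
  have hDM := Relation.ReflTransGen.trans hL hM
  have hMK : M.faces ⊆ K.faces := hM.faces_subset.trans hLK
  have hconn : (K.triangleGraph M.facesᶜ ∅).Connected := by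
    have hnot : ∀ F : K.Simplices 3, F.1 ∉ M.faces := fun F hF => by
      have := hM3 _ hF
      rw [F.2.2] at this
      omega
    have : Nonempty (K.Simplices 3) := ⟨Δ⟩
    exact ⟨fun F G => (hK.reachable_of_notMem Δ hDM F (hnot F)).symm.trans
      (hK.reachable_of_notMem Δ hDM G (hnot G))⟩
  obtain ⟨T, hTle, hT⟩ := hconn.exists_isTree_le
  have hspan : K.IsDualSpanningTree 3 T := ⟨fun {A B} (hAB : T.Adj A B) => by
    obtain ⟨hne, t, -, ht, -, htA, htB⟩ := hTle hAB
    exact ⟨hne, t, ht, htA, htB⟩, hT⟩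
  obtain ⟨P, v, hP, hv⟩ := h T hspan
  obtain ⟨G, hG, hG2⟩ := hP.exists_graph (M := M) (fun σ hσ => card_le_of_mem_cutComplex hσ)
    (fun σ hσ => by
      rw [hv] at hσ
      rw [mem_singleton_iff.1 hσ, Finset.card_singleton]
      omega) hM3 fun t ht ht3 => by
      refine (mem_cutComplex_of_card_eq ht3).2 ⟨hMK ht, ?_⟩
      rintro ⟨A, B, hAB, htA, htB⟩
      obtain ⟨hne, t', htM, ht', -, htA', htB'⟩ := hTle hAB
      exact htM (triangle_eq hne ht' htA' htB' ht3 htA htB ▸ ht)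
  have hMG := Relation.ReflTransGen.trans hM hG
  exact CollapsesTo.collapsible hMG (hK.collapsible_of_collapsesTo_graph Δ
    (Relation.ReflTransGen.trans hL hMG) hG2)

end IsSphereLike

/-! ### Gluings along triangles -/

/-- The gluing of the tetrahedra of `K` along the triangles that do not belong to `N`. -/
def triangleGluing (K N : PreAbstractSimplicialComplex V) : Setoid (K.Cell 3) where
  r c c' := c.face = c'.face ∧ (K.triangleGraph N.facesᶜ c.face).Reachable c.simplex c'.simplex
  iseqv := ⟨fun _ => ⟨rfl, SimpleGraph.Reachable.refl _⟩, fun h => ⟨h.1.symm, h.1 ▸ h.2.symm⟩,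
    fun h h' => ⟨h.1.trans h'.1, h.2.trans (h.1.symm ▸ h'.2)⟩⟩

theorem triangleGluing_le_fullGluing : triangleGluing K N ≤ K.fullGluing 3 := fun {_ _} h => h.1

theorem triangleGluing_le {r : Setoid (K.Cell 3)} (h : ∀ c c' : K.Cell 3, c.face = c'.face →
    (K.triangleGraph N.facesᶜ c.face).Adj c.simplex c'.simplex → r c c') :
    triangleGluing K N ≤ r := by
  rintro ⟨F, e, hne, heF⟩ ⟨G, e', hne', heG⟩ ⟨hee', ⟨p⟩⟩
  obtain rfl : e = e' := hee'
  change (K.triangleGraph N.facesᶜ e).Walk F G at p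
  induction p with
  | nil => exact r.refl _
  | @cons A B C hAB p ih =>
    obtain ⟨-, t, -, -, het, -, htB⟩ := id hAB
    exact r.trans (h ⟨A, e, hne, heF⟩ ⟨B, e, hne, het.trans htB⟩ rfl hAB)
      (ih (het.trans htB) heG)

theorem mem_of_triangleGluing {c c' : K.Cell 3} (h : triangleGluing K N c c')
    (hc : c.face.card = 3) (hne : c.simplex ≠ c'.simplex) : c.face ∉ N.faces := by
  obtain ⟨-, ⟨p⟩⟩ := h
  obtain ⟨-, t, htN, ht, het, -, -⟩ := p.adj_snd (SimpleGraph.Walk.not_nil_of_ne hne)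
  rwa [Finset.eq_of_subset_of_card_le het (by omega)]

theorem LCGluing.le {r r' : Setoid (K.Cell 3)} (h : LCGluing r r') : r ≤ r' := by
  obtain ⟨a, b, -, -, -, -, ⟨φ, h⟩, -⟩ := h
  rw [h]
  exact le_sup_left

namespace IsSphereLike

/-- Two distinct tetrahedra that share a triangle meet in nothing more, so gluing along `T` only
identifies cells across crossed triangles. -/
theorem treeOfSimplices_eq (hK : K.IsSphereLike) {T : SimpleGraph (K.Simplices 3)}
    (hT : T ≤ K.dualGraph 3) : treeOfSimplices T = triangleGluing K (K.cutComplex 3 T) := by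
  apply le_antisymm
  · refine Setoid.eqvGen_le ?_
    rintro c c' ⟨hadj, hface⟩
    obtain ⟨hne, t, ht, htF, htG⟩ := hT hadj
    refine ⟨hface, SimpleGraph.Adj.reachable ⟨hne, t, fun htN => ?_, ht, ?_, htF, htG⟩⟩
    · exact ((mem_cutComplex_of_card_eq ht).1 htN).2 ⟨_, _, hadj, htF, htG⟩
    · exact subset_triangle_of_subset hne ht htF htG c.subset (hface ▸ c'.subset)
  · refine triangleGluing_le fun c c' hface hadj => ?_
    obtain ⟨hne, t, htN, ht, -, htF, htG⟩ := hadj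
    refine Relation.EqvGen.rel _ _ ⟨?_, hface⟩
    refine hK.adj_of_mem_crossedTriangles ?_ ht hne htF htG
    by_contra htT
    exact htN ((mem_cutComplex_of_card_eq ht).2
      ⟨mem_faces_of_subset c.simplex.2.1 htF (Finset.card_pos.1 (by omega)), htT⟩)

/-- Both conditions are inherited from `K` when only copies of the same face are identified. -/
theorem isPseudomanifold (hK : K.IsSphereLike) {r : Setoid (K.Cell 3)} (hr : r ≤ K.fullGluing 3) :
    IsPseudomanifold r := by
  refine ⟨fun c c' h hs => Cell.ext hs (hr h), fun c₁ c₂ c₃ h₁ h₂ h₃ h₁₂ h₂₃ => ?_⟩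
  have h12 : c₁.face = c₂.face := hr h₁₂
  have h23 : c₂.face = c₃.face := hr h₂₃
  by_contra! hne
  rcases hK.eq_or_eq hne.1 h₁ c₁.subset (h12 ▸ c₂.subset) (h12.trans h23 ▸ c₃.subset) with h | h
  · exact hne.2.2 h.symm
  · exact hne.2.1 h.symm

/-- Once all triangles have been glued, all cells have been glued. -/
theorem triangleGluing_eq_fullGluing (hK : K.IsSphereLike)
    (hN : ∀ t ∈ K.faces, t.card = 3 → t ∉ N.faces) :
    triangleGluing K N = K.fullGluing 3 := by
  refine le_antisymm triangleGluing_le_fullGluing ?_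
  intro c c' hface
  replace hface : c.face = c'.face := hface
  refine ⟨hface, ?_⟩
  have hcK : c.face ∈ K.faces := mem_faces_of_subset c.simplex.2.1 c.subset c.nonempty
  have hc' : c.face ⊆ c'.simplex.1 := hface ▸ c'.subset
  by_cases hs : c.simplex = c'.simplex
  · rw [hs]
  by_cases h2 : c.face.card ≤ 2
  · refine (hK.triangleGraph_reachable hcK h2 c.subset hc').mono ?_
    rintro A B ⟨hne, t, -, ht, h⟩
    exact ⟨hne, t, hN t (mem_faces_of_subset A.2.1 h.2.1 (Finset.card_pos.1 (by omega))) ht, ht, h⟩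
  · have h3 : c.face.card = 3 := by
      by_contra h3
      have h4 := hK.card_le hcK
      have h1 := Finset.eq_of_subset_of_card_le c.subset (by rw [c.simplex.2.2]; omega)
      have h2 := Finset.eq_of_subset_of_card_le hc' (by rw [c'.simplex.2.2]; omega)
      exact hs (Subtype.ext (h1.symm.trans h2))
    exact SimpleGraph.Adj.reachable
      ⟨hs, c.face, hN _ hcK h3, h3, Finset.Subset.rfl, c.subset, hc'⟩

/-- Identifying the two sides of the triangle `t` by the identity has the effect of gluing `t`. -/
theorem sup_identify_eq (hK : K.IsSphereLike) {a b : K.Cell 3} {t : Finset V} (ht : t.card = 3)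
    (ha : a.face = t) (hb : b.face = t) (hab : a.simplex ≠ b.simplex)
    (hL : ∀ t' ∈ K.faces, t'.card = 3 → (t' ∈ L.faces ↔ t' ∈ N.faces ∧ t' ≠ t))
    {φ : {v // v ∈ a.face} ≃ {v // v ∈ b.face}} (hφ : ∀ v, (φ v).1 = v.1) :
    triangleGluing K N ⊔ Relation.EqvGen.setoid (Identify a b φ) = triangleGluing K L := by
  have htA : t ⊆ a.simplex.1 := ha ▸ a.subset
  have htB : t ⊆ b.simplex.1 := hb ▸ b.subset
  have htK : t ∈ K.faces := mem_faces_of_subset a.simplex.2.1 htA (Finset.card_pos.1 (by omega))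
  have hid : ∀ {c c' : K.Cell 3}, c.simplex = a.simplex → c'.simplex = b.simplex →
      c.face = c'.face → c.face ⊆ t → Identify a b φ c c' := by
    intro c c' hc hc' hface hct
    refine ⟨⟨hc, ha ▸ hct⟩, ⟨hc', hb ▸ hface ▸ hct⟩, fun v => ?_⟩
    rw [hφ, hface]
  apply le_antisymm
  · refine sup_le (triangleGluing_le fun c c' hface hadj => ?_) (Setoid.eqvGen_le ?_)
    · obtain ⟨hne, t', htN, ht', hct, htc, htc'⟩ := hadj
      refine ⟨hface, SimpleGraph.Adj.reachable ⟨hne, t', fun htL => htN ?_, ht', hct, htc, htc'⟩⟩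
      exact ((hL t' (mem_faces_of_subset c.simplex.2.1 htc
        (Finset.card_pos.1 (by omega))) ht').1 htL).1
    · rintro c c' ⟨⟨hca, hcat⟩, ⟨hcb, hcbt⟩, hcc'⟩
      have hface : c.face = c'.face := by
        ext v
        constructor
        · intro hv
          have := (hcc' ⟨v, hcat hv⟩).1 hv
          rwa [hφ] at this
        · intro hv
          have hvb : v ∈ a.face := ha ▸ hb ▸ hcbt hv
          refine (hcc' ⟨v, hvb⟩).2 ?_
          rwa [hφ]
      refine ⟨hface, SimpleGraph.Adj.reachable ?_⟩
      rw [hca, hcb]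
      exact ⟨hab, t, fun htL => ((hL t htK ht).1 htL).2 rfl, ht, ha ▸ hcat, htA, htB⟩
  · refine triangleGluing_le fun c c' hface hadj => ?_
    obtain ⟨hne, t', htL, ht', hct, htc, htc'⟩ := hadj
    have htK' : t' ∈ K.faces := mem_faces_of_subset c.simplex.2.1 htc (Finset.card_pos.1 (by omega))
    by_cases htt' : t' = t
    · subst htt'
      refine (le_sup_right : _ ≤ triangleGluing K N ⊔ Relation.EqvGen.setoid (Identify a b φ)) ?_
      rcases Sym2.eq_iff.1 (hK.sym2_eq hab hne ht htA htB htc htc') with ⟨h, h'⟩ | ⟨h, h'⟩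
      · exact Relation.EqvGen.rel _ _ (hid h h' hface hct)
      · exact Relation.EqvGen.symm _ _ (Relation.EqvGen.rel _ _ (hid h' h hface.symm (hface ▸ hct)))
    · refine (le_sup_left : triangleGluing K N ≤ _) ?_
      exact ⟨hface, SimpleGraph.Adj.reachable
        ⟨hne, t', fun htN => htL ((hL t' htK' ht').2 ⟨htN, htt'⟩), ht', hct, htc, htc'⟩⟩

/-- A collapse of a two-dimensional complex to a complex without triangles gives a sequence of
LC gluings. -/
theorem reflTransGen_lcGluing (hK : K.IsSphereLike) (h : N.CollapsesTo L) (hNK : N.faces ⊆ K.faces)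
    (hN : ∀ σ ∈ N.faces, σ.card ≤ 3) (hL : ∀ σ ∈ L.faces, σ.card ≤ 2) :
    Relation.ReflTransGen LCGluing (triangleGluing K N) (K.fullGluing 3) := by
  induction h using Relation.ReflTransGen.head_induction_on with
  | refl =>
    rw [hK.triangleGluing_eq_fullGluing fun t _ ht htL => by have := hL t htL; omega]
  | @head N M h hM ih =>
    have hsub := h.faces_subset
    have ih' := ih (hsub.trans hNK) fun σ hσ => hN σ (hsub hσ)
    obtain ⟨e, t, hfree, hMf⟩ := h
    have hcard := hfree.card_eq
    have htN3 := hN t hfree.2.1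
    -- Collapsing a triangle through a free edge is an LC gluing. Collapsing an edge through a
    -- vertex leaves the unglued triangles, and hence the gluing, unchanged.
    by_cases ht : t.card = 3
    · have htK := hNK hfree.2.1
      have he : e.card = 2 := by omega
      have hte := hfree.2.2.1.subset
      obtain ⟨F, htF⟩ := hK.exists_simplex htK
      obtain ⟨G, hFG, htG, -⟩ := hK.exists_other F ht htF
      let a : K.Cell 3 := ⟨F, t, nonempty_of_mem_faces htK, htF⟩
      let b : K.Cell 3 := ⟨G, t, nonempty_of_mem_faces htK, htG⟩
      have hsup := hK.sup_identify_eq (a := a) (b := b) (L := M) (N := N) ht rfl rfl hFG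
        (fun t' _ ht' => by
          rw [hMf]
          simp only [Set.mem_sdiff, mem_insert_iff, mem_singleton_iff, not_or]
          refine and_congr_right fun _ => ⟨fun h => h.2, fun h => ⟨?_, h⟩⟩
          rintro rfl
          omega) (φ := Equiv.refl _) fun _ => rfl
      refine Relation.ReflTransGen.head ⟨a, b, ⟨ht, fun c hc => ?_⟩, ⟨ht, fun c hc => ?_⟩, fun h => ?_,
        ⟨⟨F, e, nonempty_of_mem_faces hfree.1, hte.trans htF⟩,
          ⟨G, e, nonempty_of_mem_faces hfree.1, hte.trans htG⟩, ⟨rfl, hte⟩, ⟨rfl, hte⟩,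
          hcard.symm.trans ht, rfl, ?_⟩, ⟨Equiv.refl _, hsup.symm⟩,
        hK.isPseudomanifold triangleGluing_le_fullGluing⟩ ih'
      · by_contra hne
        exact mem_of_triangleGluing hc ht (Ne.symm hne) hfree.2.1
      · by_contra hne
        exact mem_of_triangleGluing hc ht (Ne.symm hne) hfree.2.1
      · exact mem_of_triangleGluing h ht hFG hfree.2.1
      · refine hK.reachable_of_forall_mem he hFG ht hte htF htG ?_
        intro t' _ ht' het' htt' htN'
        exact htt' (hfree.2.2.2 t' htN' (het'.ssubset_of_ne fun h => by
          have : e.card = t'.card := congrArg Finset.card h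
          omega))
    · have : triangleGluing K N = triangleGluing K M := by
        refine le_antisymm (triangleGluing_le fun c c' hface hadj => ?_)
          (triangleGluing_le fun c c' hface hadj => ?_)
        · exact ⟨hface, SimpleGraph.Adj.reachable ⟨hadj.1,
            hadj.2.imp fun t h => ⟨fun htM => h.1 (hsub htM), h.2⟩⟩⟩
        · refine ⟨hface, SimpleGraph.Adj.reachable ⟨hadj.1, hadj.2.imp fun t' h =>
            ⟨fun htN => h.1 ?_, h.2⟩⟩⟩
          rw [hMf]
          refine ⟨htN, ?_⟩
          have := h.2.1
          rintro (rfl | rfl)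
          · omega
          · exact ht this
      rwa [this]

/-- A sequence of LC gluings to `K` gives a collapse to a graph. -/
theorem exists_graph_of_lcGluing (hK : K.IsSphereLike) {r : Setoid (K.Cell 3)}
    (h : Relation.ReflTransGen LCGluing r (K.fullGluing 3)) (hr : r = triangleGluing K N)
    (hNK : N.faces ⊆ K.faces) (hN : ∀ σ ∈ N.faces, σ.card ≤ 3) :
    ∃ G, N.CollapsesTo G ∧ ∀ σ ∈ G.faces, σ.card ≤ 2 := by
  induction h using Relation.ReflTransGen.head_induction_on generalizing N with
  | refl =>
    refine ⟨N, Relation.ReflTransGen.refl, fun σ hσ => ?_⟩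
    by_contra h2
    have hσ3 : σ.card = 3 := by have := hN σ hσ; omega
    obtain ⟨F, hF⟩ := hK.exists_simplex (hNK hσ)
    obtain ⟨G, hFG, hG, -⟩ := hK.exists_other F hσ3 hF
    have : K.fullGluing 3 ⟨F, σ, nonempty_of_mem_faces hσ, hF⟩
        ⟨G, σ, nonempty_of_mem_faces hσ, hG⟩ := rfl
    rw [hr] at this
    exact mem_of_triangleGluing this hσ3 hFG hσ
  | @head r r' h hr' ih =>
    subst hr
    -- Identifications are never undone, and the final complex identifies only copies of the same
    -- face. So each gluing map must fix the vertices, and the two triangles glued are the two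
    -- copies of one triangle of `K`.
    have hfull : r' ≤ K.fullGluing 3 := by
      clear ih h
      induction hr' using Relation.ReflTransGen.head_induction_on with
      | refl => exact le_rfl
      | head h _ ih => exact h.le.trans ih
    obtain ⟨a, b, ha, hb, hab, ⟨e, e', he, he', hecard, hee'⟩, ⟨φ, hφ⟩, -⟩ := h
    have hid : ∀ {c c' : K.Cell 3}, Identify a b φ c c' → c.face = c'.face := fun {c c'} h =>
      hfull (hφ ▸ (le_sup_right : _ ≤ triangleGluing K N ⊔ Relation.EqvGen.setoid (Identify a b φ))
        (Relation.EqvGen.rel _ _ h))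
    have hface : a.face = b.face := by
      refine hid ⟨⟨rfl, Finset.Subset.rfl⟩, ⟨rfl, Finset.Subset.rfl⟩, fun v => ?_⟩
      exact iff_of_true v.2 (φ v).2
    have hφid : ∀ v, (φ v).1 = v.1 := by
      intro v
      have := hid (c := ⟨a.simplex, {v.1}, Finset.singleton_nonempty _,
          Finset.singleton_subset_iff.2 (a.subset v.2)⟩)
        (c' := ⟨b.simplex, {(φ v).1}, Finset.singleton_nonempty _,
          Finset.singleton_subset_iff.2 (b.subset (φ v).2)⟩)
        ⟨⟨rfl, Finset.singleton_subset_iff.2 v.2⟩, ⟨rfl, Finset.singleton_subset_iff.2 (φ v).2⟩,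
          fun w => by
            simp only [Finset.mem_singleton]
            rw [← Subtype.ext_iff, ← Subtype.ext_iff, φ.injective.eq_iff]⟩
      exact (Finset.singleton_injective this).symm
    have hne : a.simplex ≠ b.simplex := fun h => by
      rw [Cell.ext h hface] at hab
      exact hab ((triangleGluing K N).refl _)
    have ht : a.face.card = 3 := ha.1
    have htB : a.face ⊆ b.simplex.1 := hface ▸ b.subset
    have htK : a.face ∈ K.faces := mem_faces_of_subset a.simplex.2.1 a.subset a.nonempty
    have htN : a.face ∈ N.faces := by
      by_contra htN
      exact hab ⟨hface, SimpleGraph.Adj.reachable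
        ⟨hne, a.face, htN, ht, Finset.Subset.rfl, a.subset, htB⟩⟩
    have he2 : e.face.card = 2 := by omega
    have hreach : (K.triangleGraph N.facesᶜ e.face).Reachable a.simplex b.simplex := by
      rw [← he.1, ← he'.1]
      exact hee'.2
    -- The shared edge has been identified around the other side, so every triangle there other than
    -- `a.face` has already been glued.
    have hfree : N.IsFreePair e.face a.face := by
      refine ⟨mem_faces_of_subset htN he.2 e.nonempty, htN, he.2.ssubset_of_ne fun h => ?_,
        fun ρ hρ hlt => ?_⟩
      · rw [h] at he2
        omega
      · by_contra hρt
        have h1 := Finset.card_lt_card hlt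
        have h2 := hN ρ hρ
        exact hK.mem_of_reachable he2 hne ht he.2 a.subset htB (not_not_intro htN) hreach (hNK hρ)
          (by omega) hlt.subset hρt hρ
    obtain ⟨M, hM, hMf⟩ := hfree.exists_elementaryCollapse
    have hsub := hM.faces_subset
    have hr'M : r' = triangleGluing K M := by
      rw [hφ]
      refine hK.sup_identify_eq ht rfl hface.symm hne (fun t' _ ht' => ?_) hφid
      rw [hMf]
      simp only [Set.mem_sdiff, mem_insert_iff, mem_singleton_iff, not_or]
      refine and_congr_right fun _ => ⟨fun h => h.2, fun h => ⟨?_, h⟩⟩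
      rintro rfl
      omega
    obtain ⟨G, hG, hG2⟩ := ih hr'M (hsub.trans hNK) fun σ hσ => hN σ (hsub hσ)
    exact ⟨G, Relation.ReflTransGen.head hM hG, hG2⟩

theorem lcAlong_iff_collapsible_cutComplex (hK : K.IsSphereLike) {T : SimpleGraph (K.Simplices 3)}
    (hT : K.IsDualSpanningTree 3 T) : K.LCAlong 3 T ↔ (K.cutComplex 3 T).Collapsible := by
  have hsub : (K.cutComplex 3 T).faces ⊆ K.faces := by
    rintro σ ⟨hne, ρ, hρ, -, hσρ, -⟩
    exact mem_faces_of_subset hρ hσρ hne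
  constructor
  · intro h
    obtain ⟨G, hG, hG2⟩ := hK.exists_graph_of_lcGluing h (hK.treeOfSimplices_eq hT.1) hsub
      fun σ hσ => card_le_of_mem_cutComplex hσ
    obtain ⟨Δ⟩ := hT.2.connected.nonempty
    exact hG.collapsible (hK.collapsible_of_collapsesTo_graph Δ
      (Relation.ReflTransGen.trans (hK.collapsesTo_cutComplex Δ hT) hG) hG2)
  · rintro ⟨L, v, hL, hv⟩
    rw [LCAlong, hK.treeOfSimplices_eq hT.1]
    refine hK.reflTransGen_lcGluing hL hsub (fun σ hσ => card_le_of_mem_cutComplex hσ) ?_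
    intro σ hσ
    rw [hv] at hσ
    rw [mem_singleton_iff.1 hσ, Finset.card_singleton]
    omega

end IsSphereLike

end PreAbstractSimplicialComplex

end

theorem theorem2p6 {E : Type*} [NormedAddCommGroup E] [NormedSpace ℝ E]
    (S : Geometry.SimplicialComplex ℝ E) (hS : S.IsTriangulatedSphere 3) :
    List.TFAE [
      S.toPreAbstractSimplicialComplex.ExtensivelyLC 3,
      ∀ T : SimpleGraph (S.toPreAbstractSimplicialComplex.Simplices 3),
        S.toPreAbstractSimplicialComplex.IsDualSpanningTree 3 T →
          (S.toPreAbstractSimplicialComplex.cutComplex 3 T).Collapsible,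
      ∀ Δ : S.toPreAbstractSimplicialComplex.Simplices 3,
        (S.toPreAbstractSimplicialComplex.deleteFace Δ.1).ExtensivelyCollapsible,
      ∃ Δ : S.toPreAbstractSimplicialComplex.Simplices 3,
        (S.toPreAbstractSimplicialComplex.deleteFace Δ.1).ExtensivelyCollapsible] := by
  have hK := hS.isSphereLike
  tfae_have 1 ↔ 2 :=
    forall₂_congr fun T hT => hK.lcAlong_iff_collapsible_cutComplex hT
  tfae_have 2 → 3 := hK.extensivelyCollapsible_deleteFace
  tfae_have 3 → 4 := fun h => by
    obtain ⟨σ, hσ⟩ := hK.nonempty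
    obtain ⟨F, -⟩ := hK.exists_simplex hσ
    exact ⟨F, h F⟩
  -- `K^T` is itself one of the complexes to which the sphere minus `Δ` collapses, whichever
  -- tetrahedron `Δ` is.
  tfae_have 4 → 2 := fun ⟨Δ, h⟩ T hT => h _ (hK.collapsesTo_cutComplex Δ hT)
  tfae_finish
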